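/- **Setting.** Let $p(\theta)$ be a (measurable) prior density on $\mathbb R^d$, let $p(y\mid\theta)$ be the likelihood at the observed data $y$, and let $\{q_\lambda:\lambda\in\mathcal M\}$, with $\mathcal M\subset\mathbb R^D$ open, be a family of probability densities on $\mathbb R^d$, jointly measurable in $(\lambda,\theta)$. The densities have a common support: there is a measurable set $S\subset\mathbb R^d$ such that, for all $\lambda\in\mathcal M$, $q_\lambda>0$ on $S$ and $q_\lambda=0$ off $S$; for each $\theta\in S$ the map $\lambda\mapsto\log q_\lambda(\theta)$ is $C^1$ on $\mathcal M$; and $p(\theta)>0$, $p(y\mid\theta)>0$ for a.e. $\theta\in S$. Put $h_\lambda(\theta)=\log p(\theta)+\log p(y\mid\theta)-\log q_\lambda(\theta)$, assumed $q_\lambda$-integrable for every $\lambda\in\mathcal M$, and $$\mathcal L(\lambda)=-\mathbb E_{q_\lambda}[h_\lambda(\theta)],\qquad \ell(\theta,\lambda)=-\nabla_\lambda\log q_\lambda(\theta)\,h_\lambda(\theta),\qquad I_F(\lambda)=\mathbb E_{q_\lambda}\big[\nabla_\lambda\log q_\lambda(\theta)\,\nabla_\lambda\log q_\lambda(\theta)^\top\big].$$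 **Algorithm (weighted averaged inversion-free natural gradient VB).** Fix $\alpha\in(1/2,1)$, $c_\alpha>0$, $c'_\alpha\ge0$, $\beta\in(0,\alpha-1/2)$, $c_\beta\ge0$, $w\ge0$, an integer $B\ge1$, a positive definite $H_0\in\mathbb R^{D\times D}$ (for instance $H_0=\epsilon\mathbb I_D$ with $\epsilon>0$), $\lambda^{(0)}=\overline\lambda^{(0)}\in\mathbb R^D$, and $\tau_k=c_\alpha/(c'_\alpha+k)^\alpha$. For $s=0,1,2,\dots$, conditionally on the past, draw independently $\theta_{s+1,1},\dots,\theta_{s+1,B}\sim q_{\lambda^{(s)}}$, $\overline\theta_{s+1}\sim q_{\overline\lambda^{(s)}}$ and $Z_{s+1}\sim\mathcal N(0,\mathbb I_D)$, and set, with $\phi_{s+1}=\nabla_\lambda\log q_{\overline\lambda^{(s)}}(\overline\theta_{s+1})$, $$\tilde{\mathbf H}_{s+1}=\frac1{s+1}\Big(H_0+\sum_{k=1}^{s+1}\phi_k\phi_k^\top+c_\beta\sum_{k=1}^{s+1}k^{-\beta}Z_kZ_k^\top\Big),\qquad \lambda^{(s+1)}=\lambda^{(s)}-\tau_{s+1}\tilde{\mathbf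 H}_{s+1}^{-1}\frac1B\sum_{i=1}^B\ell(\theta_{s+1,i},\lambda^{(s)}),$$ $$\overline\lambda^{(s+1)}=\overline\lambda^{(s)}+\frac{(\log(s+1))^w}{\sum_{k=0}^s(\log(k+1))^w}\big(\lambda^{(s+1)}-\overline\lambda^{(s)}\big)\qquad(\text{with }0^0=1\text{ and }0/0=0).$$ Assume that almost surely $\lambda^{(s)},\overline\lambda^{(s)}\in\mathcal M$ for all $s$. **Theorem.** Let $\lambda^*\in\mathcal M$ and suppose that $\lambda^{(k)}\to\lambda^*$ almost surely. Assume that $\mathcal L$ is differentiable on $\mathcal M$ with $\nabla_\lambda\mathcal L(\lambda^*)=0$ and that $\mathcal L$ is twice continuously differentiable in a neighbourhood of $\lambda^*$. Suppose that there are $\eta>\frac1\alpha-1$ and nonnegative constants $C_{\eta,0},C_{\eta,1},C'_0,C'_1$ such that for all $\lambda\in\mathcal M$ $$\mathbb E_{q_\lambda}\big[\|\ell(\theta,\lambda)\|^{2+2\eta}\big]\le C_{\eta,0}+C_{\eta,1}\,|\mathcal L(\lambda)-\mathcal L(\lambda^*)|^{1+\eta},\qquad \mathbb E_{q_\lambda}\big[\|\nabla_\lambda\log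 q_\lambda(\theta)\|^4\big]\le C'_0+C'_1\,(\mathcal L(\lambda)-\mathcal L(\lambda^*))^2$$ (the absolute value is superfluous when $\lambda^*$ is a global minimizer of $\mathcal L$). Suppose finally that the Hessian $\nabla^2_\lambda\mathcal L(\lambda^*)$ and $I_F(\lambda^*)$ are positive definite. Then $$\|\lambda^{(s)}-\lambda^*\|^2=\mathcal O\Big(\frac{\log s}{s^\alpha}\Big)\quad\text{almost surely.}$$ -/

import Mathlib

open MeasureTheory ProbabilityTheory Filter Topology Asymptotics

noncomputable section

namespace VB

/-- `ℝⁿ` with the Euclidean norm. -/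
abbrev Vec (n : ℕ) : Type := EuclideanSpace ℝ (Fin n)

/-- A variational Bayes problem: model parameter `θ ∈ ℝᵈ`, variational parameter `lam ∈ M ⊆ ℝᴰ`.
`prior θ` is `p(θ)`, `lik θ` is `p(y ∣ θ)` at the observed data `y`, and `q lam θ` is the
variational density `q_lam(θ)` with respect to Lebesgue measure. -/
structure Problem (d D : ℕ) where
  /-- the variational parameter space -/
  M : Set (Vec D)
  prior : Vec d → ℝ
  lik : Vec d → ℝ
  q : Vec D → Vec d → ℝ
  /-- the common support of the densities `q lam`, `lam ∈ M` -/
  supp : Set (Vec d)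
  isOpen_M : IsOpen M
  measurable_prior : Measurable prior
  measurable_lik : Measurable lik
  measurable_q : Measurable (Function.uncurry q)
  measurableSet_supp : MeasurableSet supp
  q_pos : ∀ lam ∈ M, ∀ θ ∈ supp, 0 < q lam θ
  q_eq_zero : ∀ lam ∈ M, ∀ θ ∉ supp, q lam θ = 0
  lintegral_q : ∀ lam ∈ M, ∫⁻ θ, ENNReal.ofReal (q lam θ) = 1
  /-- `lam ↦ log q_lam(θ)` is continuously differentiable on `M` -/
  contDiffOn_log_q : ∀ θ ∈ supp, ContDiffOn ℝ 1 (fun lam => Real.log (q lam θ)) M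
  prior_lik_pos : ∀ᵐ θ, θ ∈ supp → 0 < prior θ ∧ 0 < lik θ
  /-- the lower bound is well defined: `h_lam` is `q_lam`-integrable -/
  integrable_h : ∀ lam ∈ M, Integrable
    (fun θ => Real.log (prior θ) + Real.log (lik θ) - Real.log (q lam θ))
    (volume.withDensity fun θ => ENNReal.ofReal (q lam θ))

namespace Problem

variable {d D : ℕ} (V : Problem d D)

/-- The distribution on `ℝᵈ` with density `q_lam`. -/
def law (lam : Vec D) : Measure (Vec d) :=
  volume.withDensity fun θ => ENNReal.ofReal (V.q lam θ)

/-- `h_lam(θ) = log p(θ) + log p(y ∣ θ) - log q_lam(θ)`. -/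
def h (lam : Vec D) (θ : Vec d) : ℝ :=
  Real.log (V.prior θ) + Real.log (V.lik θ) - Real.log (V.q lam θ)

/-- The lower bound `LB(lam) = E_{q_lam}[h_lam(θ)]`. -/
def LB (lam : Vec D) : ℝ := ∫ θ, V.h lam θ ∂(V.law lam)

/-- The loss `𝓛 = -LB`. -/
def loss (lam : Vec D) : ℝ := -V.LB lam

/-- The score `∇_lam log q_lam(θ)`. -/
def score (lam : Vec D) (θ : Vec d) : Vec D :=
  gradient (fun l => Real.log (V.q l θ)) lam

/-- The Fisher information matrix `I_F(lam) = E_{q_lam}[∇ log q_lam (∇ log q_lam)ᵀ]`. -/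
def fisher (lam : Vec D) : Matrix (Fin D) (Fin D) ℝ :=
  Matrix.of fun i j => ∫ θ, V.score lam θ i * V.score lam θ j ∂(V.law lam)

/-- The single-sample gradient `ℓ(θ, lam) = -∇_lam log q_lam(θ) × h_lam(θ)`. -/
def ell (θ : Vec d) (lam : Vec D) : Vec D := -(V.h lam θ • V.score lam θ)

end Problem

/-- The Hessian matrix `(∂²f / ∂x_i ∂x_j)(x)`. -/
def hessian {D : ℕ} (f : Vec D → ℝ) (x : Vec D) : Matrix (Fin D) (Fin D) ℝ :=
  Matrix.of fun i j =>
    iteratedFDeriv ℝ 2 f x ![EuclideanSpace.single i 1, EuclideanSpace.single j 1]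

/-- The tuning constants and the initial values of the algorithm. -/
structure Tuning (D : ℕ) where
  α : ℝ
  cα : ℝ
  cα' : ℝ
  β : ℝ
  cβ : ℝ
  /-- exponent of the averaging weights -/
  w : ℝ
  /-- number of samples in each gradient estimate -/
  B : ℕ
  H0 : Matrix (Fin D) (Fin D) ℝ
  lam0 : Vec D
  α_gt : 1 / 2 < α
  α_lt : α < 1
  cα_pos : 0 < cα
  cα'_nonneg : 0 ≤ cα'
  β_pos : 0 < β
  β_lt : β < α - 1 / 2
  cβ_nonneg : 0 ≤ cβ
  w_nonneg : 0 ≤ w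
  B_pos : 0 < B
  H0_posDef : H0.PosDef

/-- The step size `τ_k = c_α / (c_α' + k) ^ α`. -/
def Tuning.τ {D : ℕ} (T : Tuning D) (k : ℕ) : ℝ := T.cα / (T.cα' + (k : ℝ)) ^ T.α

/-- The fresh samples of one iteration: `θ₁, …, θ_B` for the gradient estimate, then `θ̄` and `Z`
for the update of the Fisher matrix estimate. -/
abbrev Draw (d D B : ℕ) : Type := (Fin B → Vec d) × Vec d × Vec D

/-- The state of the algorithm after `s` iterations. -/
structure State (D : ℕ) where
  /-- the iterate `lam⁽ˢ⁾` -/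
  lam : Vec D
  /-- the weighted average of the iterates -/
  avg : Vec D
  /-- the unnormalized Fisher estimate
  `H₀ + ∑_{k<s} φ_{k+1} φ_{k+1}ᵀ + c_β ∑_{k=1}^s k^{-β} Z_k Z_kᵀ` -/
  H : Matrix (Fin D) (Fin D) ℝ

variable {d D : ℕ}

/-- The estimate `B⁻¹ ∑ᵢ ℓ(θᵢ, lam)` of the gradient of the loss. -/
def gradEstimate (V : Problem d D) {B : ℕ} (lam : Vec D) (θ : Fin B → Vec d) : Vec D :=
  (B : ℝ)⁻¹ • ∑ i, V.ell (θ i) lam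

/-- The iteration number `s + 1` (`s = 0, 1, …`) of the algorithm, with fresh samples `x`. -/
def step (V : Problem d D) (T : Tuning D) (s : ℕ) (S : State D) (x : Draw d D T.B) : State D :=
  let φ : Vec D := V.score S.avg x.2.1
  let Z : Vec D := x.2.2
  let H : Matrix (Fin D) (Fin D) ℝ :=
    S.H + Matrix.vecMulVec φ φ + (T.cβ * ((s : ℝ) + 1) ^ (-T.β)) • Matrix.vecMulVec Z Z
  let lam : Vec D :=
    S.lam - T.τ (s + 1) •
      Matrix.toEuclideanLin ((((s : ℝ) + 1)⁻¹ • H)⁻¹) (gradEstimate V S.lam x.1)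
  let avg : Vec D :=
    S.avg + (Real.log ((s : ℝ) + 1) ^ T.w /
      ∑ k ∈ Finset.range (s + 1), Real.log ((k : ℝ) + 1) ^ T.w) • (lam - S.avg)
  ⟨lam, avg, H⟩

/-- The run of the weighted averaged inversion-free natural gradient algorithm along the samples
`x 0, x 1, …`, where `x s` is drawn in iteration `s + 1`. -/
def run (V : Problem d D) (T : Tuning D) (x : ℕ → Draw d D T.B) : ℕ → State D
  | 0 => ⟨T.lam0, T.lam0, T.H0⟩
  | s + 1 => step V T s (run V T x s) (x s)

/-- The law of the fresh samples of one iteration in state `S`: all independent, with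
`θᵢ ∼ q_{lam}`, `θ̄ ∼ q_{avg}` and `Z ∼ 𝓝(0, I)`. -/
def drawLaw (V : Problem d D) (B : ℕ) (S : State D) : Measure (Draw d D B) :=
  (Measure.pi fun _ : Fin B => V.law S.lam).prod ((V.law S.avg).prod (stdGaussian (Vec D)))

/-- `X 0, X 1, …` are the samples drawn by the algorithm: `X s` is known at time `s + 1`, and
conditionally on the past `ℱ s` it has the law `drawLaw` of the current state. -/
structure IsSampling (V : Problem d D) (T : Tuning D) {Ω : Type*} [mΩ : MeasurableSpace Ω]
    (P : Measure Ω) (ℱ : Filtration ℕ mΩ) (X : ℕ → Ω → Draw d D T.B) : Prop where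
  measurable : ∀ s, Measurable[ℱ (s + 1)] (X s)
  condLaw : ∀ s, ∀ A : Set Ω, MeasurableSet[ℱ s] A → ∀ C : Set (Draw d D T.B), MeasurableSet C →
    P (A ∩ X s ⁻¹' C) = ∫⁻ ω in A, drawLaw V T.B (run V T (fun k => X k ω) s) C ∂P

end VB

end

noncomputable section

namespace VB

/-! ### An exponential inequality for a damped martingale recursion -/

/-! Write `Δ n` for the error of the iterate, `A n` for the preconditioner of iteration `n + 1` and
`t = (n + 1)⁻ᵅ`. The gradient estimate is its conditional mean minus a centred noise. The matrix `A
n` already contains the fresh draws `θ̄` and `Z`, but given the past these are independent of the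
gradient samples, so `A n` times the noise is still a martingale difference (`integral_noise`). This
noise is collected in a process `M` with `M (n + 1) = (1 - t) M n + t ζ n`, and the difference `R =
Δ - M` then satisfies a recursion without noise.

Rate of `M`: the gradient samples have only a moment of order `p = 2 + 2η`, so they are truncated at
`(n + 1) ^ κ` with `1 / p < κ < α / 2`; such a `κ` exists exactly because `η > 1 / α - 1`. By
Borel–Cantelli the truncation is eventually inactive (`IsSampling.eventually_norm_el_le`), and its
bias is of order `n ^ (κ (1 - p))`, hence at most `n ^ (-α / 2)`. For the truncated noise an
exponential moment bound (`exp_moment_le`) followed by Chernoff and Borel–Cantelli gives `M =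
O(√(log n / nᵅ))` almost surely (`recursion_isBigO`, `IsSampling.noise_isBigO`).

Rate of `R`: near `λ*` the mean gradient is `∇²𝓛(λ*) Δ + o(Δ)`, and `A n` tends to `I_F(λ*)⁻¹`. So
`R` follows a perturbed linear recursion with matrix `I_F⁻¹ ∇²𝓛`. This matrix need not be symmetric,
but it contracts the quadratic form of `I_F`, since `⟪I_F x, I_F⁻¹ ∇²𝓛 x⟫ = ⟪x, ∇²𝓛 x⟫`
(`linear_recursion_isBigO`, `rate_of_recursion`).

Two facts feed this. The convergence of `A n` follows from the strong law for orthogonal variables,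
convergence of the averaged iterates, and continuity of the Fisher matrix
(`IsSampling.tendsto_runH`). The mean gradient is `∇𝓛` (`IsGood.integral_el_eq`); no domination is
assumed, so both this and the continuity rest on uniform second moments, through a Fatou argument
(`eventually_integral_mul_gt`) and Fubini with the fundamental theorem of calculus. All moment
bounds are needed only on a neighbourhood `U` of `λ*`, which the iterates and their averages
eventually do not leave. -/

theorem one_sub_rpow_le {α : ℝ} (hα1 : α ≤ 1) (n : ℕ) :
    1 - ((n : ℝ) + 1) ^ (-α) ≤ n / ((n : ℝ) + 1) := by
  have h1 : ((n : ℝ) + 1) ^ (-1 : ℝ) ≤ ((n : ℝ) + 1) ^ (-α) :=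
    Real.rpow_le_rpow_of_exponent_le (by linarith [Nat.cast_nonneg (α := ℝ) n]) (by linarith)
  rw [Real.rpow_neg_one] at h1
  have h2 : (n : ℝ) / ((n : ℝ) + 1) = 1 - ((n : ℝ) + 1)⁻¹ := by field_simp; ring
  linarith

theorem one_sub_rpow_mem {α : ℝ} (hα0 : 0 < α) (n : ℕ) :
    0 < ((n : ℝ) + 1) ^ (-α) ∧ ((n : ℝ) + 1) ^ (-α) ≤ 1 := by
  refine ⟨by positivity, Real.rpow_le_one_of_one_le_of_nonpos ?_ (by linarith)⟩
  linarith [Nat.cast_nonneg (α := ℝ) n]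

/-- Since `γ ≤ 1`, the ratio `n / (n + 1)` is at most its own `γ`-th power. With `γ = α - κ` this
keeps the admissible range of exponents stable under damping; with `γ = α` it propagates the
variance proxy `n⁻ᵅ`. -/
theorem one_sub_rpow_mul_le {α : ℝ} (hα1 : α ≤ 1) {γ : ℝ} (hγ1 : γ ≤ 1) (n : ℕ) :
    (1 - ((n : ℝ) + 1) ^ (-α)) * ((n : ℝ) + 1) ^ γ ≤ (n : ℝ) ^ γ := by
  rcases Nat.eq_zero_or_pos n with rfl | hn
  · simp only [Nat.cast_zero, zero_add, Real.one_rpow, sub_self, zero_mul]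
    exact Real.rpow_nonneg le_rfl _
  have hn' : (0 : ℝ) < n := by exact_mod_cast hn
  have h1 : (n : ℝ) / ((n : ℝ) + 1) ≤ ((n : ℝ) / ((n : ℝ) + 1)) ^ γ := by
    have := Real.rpow_le_rpow_of_exponent_ge (x := (n : ℝ) / ((n : ℝ) + 1)) (by positivity)
      (by rw [div_le_one (by positivity)]; linarith) hγ1
    simpa using this
  calc (1 - ((n : ℝ) + 1) ^ (-α)) * ((n : ℝ) + 1) ^ γ
      ≤ ((n : ℝ) / ((n : ℝ) + 1)) ^ γ * ((n : ℝ) + 1) ^ γ := by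
        gcongr
        exact (one_sub_rpow_le hα1 n).trans h1
    _ = (n : ℝ) ^ γ := by
        rw [Real.div_rpow hn'.le (by positivity)]
        field_simp

section Recursion

variable {Ω : Type*} {α κ K σ : ℝ} {m ζ : ℕ → Ω → ℝ}

/-- The bound may depend on `n`; it serves only to make the exponentials integrable. -/
theorem recursion_bounded (hm0 : ∀ ω, m 0 ω = 0)
    (hm : ∀ n ω, m (n + 1) ω =
      (1 - ((n : ℝ) + 1) ^ (-α)) * m n ω + ((n : ℝ) + 1) ^ (-α) * ζ n ω)
    (hb : ∀ n ω, |ζ n ω| ≤ K * ((n : ℝ) + 1) ^ κ) (n : ℕ) : ∃ b, ∀ ω, |m n ω| ≤ b := by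
  induction n with
  | zero => exact ⟨0, fun ω => by simp [hm0]⟩
  | succ n ih =>
    obtain ⟨b, hb'⟩ := ih
    refine ⟨|1 - ((n : ℝ) + 1) ^ (-α)| * b +
      |((n : ℝ) + 1) ^ (-α)| * (K * ((n : ℝ) + 1) ^ κ), fun ω => ?_⟩
    rw [hm]
    refine (abs_add_le _ _).trans ?_
    rw [abs_mul, abs_mul]
    gcongr
    · exact hb' ω
    · exact hb n ω

variable [MeasurableSpace Ω] {P : Measure Ω}

/-- Induction on `n`: one step replaces `x` by `(1 - t) x` and adds the increment `x t ζ`, to which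
`exp y ≤ 1 + y + y²` applies as long as `|y| ≤ 1`. The linear term integrates to zero and the
quadratic one costs a factor `1 + σ (x t)²`. Centring and conditional variance are needed only
against the weights `exp (c m)`, hence the form of `h1` and `h2`. -/
theorem exp_moment_le [IsProbabilityMeasure P] (hα0 : 0 < α) (hα1 : α ≤ 1) (hκ0 : 0 ≤ κ)
    (hK : 0 < K) (hσ : 0 ≤ σ) (hm0 : ∀ ω, m 0 ω = 0)
    (hm : ∀ n ω, m (n + 1) ω =
      (1 - ((n : ℝ) + 1) ^ (-α)) * m n ω + ((n : ℝ) + 1) ^ (-α) * ζ n ω)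
    (hmm : ∀ n, Measurable (m n)) (hζm : ∀ n, Measurable (ζ n))
    (hb : ∀ n ω, |ζ n ω| ≤ K * ((n : ℝ) + 1) ^ κ)
    (h1 : ∀ n c, ∫ ω, Real.exp (c * m n ω) * ζ n ω ∂P = 0)
    (h2 : ∀ n c, ∫ ω, Real.exp (c * m n ω) * ζ n ω ^ 2 ∂P ≤ σ * ∫ ω, Real.exp (c * m n ω) ∂P)
    (n : ℕ) : ∀ x : ℝ, |x| ≤ (n : ℝ) ^ (α - κ) / K →
      ∫ ω, Real.exp (x * m n ω) ∂P ≤ Real.exp (σ * x ^ 2 * (n : ℝ) ^ (-α)) := by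
  induction n with
  | zero =>
    intro x _
    have : (0 : ℝ) ^ (-α) = 0 := Real.zero_rpow (by linarith)
    simp [hm0, this]
  | succ n ih =>
    intro x hx
    push_cast at hx ⊢
    set t : ℝ := ((n : ℝ) + 1) ^ (-α) with ht
    obtain ⟨ht0, ht1⟩ : 0 < t ∧ t ≤ 1 := one_sub_rpow_mem hα0 n
    have hn1 : (0 : ℝ) < (n : ℝ) + 1 := by positivity
    obtain ⟨b, hbm⟩ := recursion_bounded hm0 hm hb n
    set c : ℝ := (1 - t) * x with hc
    set E : Ω → ℝ := fun ω => Real.exp (c * m n ω) with hE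
    have hEm : Measurable E := ((hmm n).const_mul c).exp
    have hEb : ∀ ω, ‖E ω‖ ≤ Real.exp (|c| * b) := fun ω => by
      rw [Real.norm_eq_abs, abs_of_pos (Real.exp_pos _), Real.exp_le_exp]
      calc c * m n ω ≤ |c * m n ω| := le_abs_self _
        _ = |c| * |m n ω| := abs_mul _ _
        _ ≤ |c| * b := by gcongr; exact hbm ω
    have iE : Integrable E P := Integrable.of_bound hEm.aestronglyMeasurable _ (.of_forall hEb)
    have iEζ : Integrable (fun ω => E ω * ζ n ω) P := by
      refine iE.mul_bdd (c := K * ((n : ℝ) + 1) ^ κ) (hζm n).aestronglyMeasurable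
        (.of_forall fun ω => ?_)
      exact hb n ω
    have iEζ2 : Integrable (fun ω => E ω * ζ n ω ^ 2) P := by
      refine iE.mul_bdd (c := (K * ((n : ℝ) + 1) ^ κ) ^ 2)
        ((hζm n).pow_const 2).aestronglyMeasurable (.of_forall fun ω => ?_)
      rw [norm_pow]
      exact pow_le_pow_left₀ (norm_nonneg _) (hb n ω) 2
    have hcle : |c| ≤ (n : ℝ) ^ (α - κ) / K := by
      rw [hc, abs_mul, abs_of_nonneg (by linarith)]
      calc (1 - t) * |x| ≤ (1 - t) * (((n : ℝ) + 1) ^ (α - κ) / K) := by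
            gcongr
        _ = ((1 - t) * ((n : ℝ) + 1) ^ (α - κ)) / K := by ring
        _ ≤ (n : ℝ) ^ (α - κ) / K := by
            gcongr
            exact one_sub_rpow_mul_le hα1 (by linarith) n
    have hu : (1 - t) * (n : ℝ) ^ (-α) ≤ t := by
      rcases Nat.eq_zero_or_pos n with rfl | hn
      · simp [ht]
      have hn' : (0 : ℝ) < n := by exact_mod_cast hn
      have := one_sub_rpow_mul_le hα1 hα1 n
      rw [← ht] at this
      have h3 : ((n : ℝ) + 1) ^ α = t⁻¹ := by rw [ht, Real.rpow_neg hn1.le, inv_inv]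
      rw [h3] at this
      rw [Real.rpow_neg hn'.le]
      have h4 : 0 < (n : ℝ) ^ α := by positivity
      rw [mul_inv_le_iff₀ h4]
      rwa [mul_inv_le_iff₀ ht0, mul_comm] at this
    -- The range of `x` is chosen so that the powers `α - κ`, `-α` and `κ` cancel exactly.
    have hy : ∀ ω, |x * t * ζ n ω| ≤ 1 := fun ω => by
      rw [abs_mul, abs_mul, abs_of_pos ht0]
      calc |x| * t * |ζ n ω|
          ≤ (((n : ℝ) + 1) ^ (α - κ) / K) * t * (K * ((n : ℝ) + 1) ^ κ) := by
            gcongr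
            exact hb n ω
        _ = ((n : ℝ) + 1) ^ (α - κ) * ((n : ℝ) + 1) ^ (-α) * ((n : ℝ) + 1) ^ κ := by
            rw [ht]; field_simp
        _ = 1 := by
            rw [← Real.rpow_add hn1, ← Real.rpow_add hn1,
              show α - κ + -α + κ = 0 by ring, Real.rpow_zero]
    have hpt : ∀ ω, Real.exp (x * m (n + 1) ω) ≤
        E ω + x * t * (E ω * ζ n ω) + (x * t) ^ 2 * (E ω * ζ n ω ^ 2) := fun ω => by
      have e1 : x * m (n + 1) ω = c * m n ω + x * t * ζ n ω := by rw [hm, hc, ht]; ring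
      rw [e1, Real.exp_add]
      have e2 := (abs_le.1 (Real.abs_exp_sub_one_sub_id_le (hy ω))).2
      have e3 : Real.exp (x * t * ζ n ω) ≤ 1 + x * t * ζ n ω + (x * t * ζ n ω) ^ 2 := by linarith
      calc Real.exp (c * m n ω) * Real.exp (x * t * ζ n ω)
          ≤ Real.exp (c * m n ω) * (1 + x * t * ζ n ω + (x * t * ζ n ω) ^ 2) := by gcongr
        _ = _ := by simp only [hE]; ring
    have iL : Integrable (fun ω => Real.exp (x * m (n + 1) ω)) P := by
      refine ((iE.add (iEζ.const_mul (x * t))).add (iEζ2.const_mul ((x * t) ^ 2))).mono'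
        ((hmm (n + 1)).const_mul x).exp.aestronglyMeasurable (.of_forall fun ω => ?_)
      rw [Real.norm_eq_abs, abs_of_pos (Real.exp_pos _)]
      exact hpt ω
    have hE0 : 0 ≤ ∫ ω, E ω ∂P := integral_nonneg fun ω => (Real.exp_pos _).le
    calc ∫ ω, Real.exp (x * m (n + 1) ω) ∂P
        ≤ ∫ ω, (E ω + x * t * (E ω * ζ n ω) + (x * t) ^ 2 * (E ω * ζ n ω ^ 2)) ∂P :=
          integral_mono iL ((iE.add (iEζ.const_mul _)).add (iEζ2.const_mul _)) hpt
      _ = ∫ ω, E ω ∂P + x * t * ∫ ω, E ω * ζ n ω ∂P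
            + (x * t) ^ 2 * ∫ ω, E ω * ζ n ω ^ 2 ∂P := by
          have e1 := integral_add (iE.add (iEζ.const_mul (x * t))) (iEζ2.const_mul ((x * t) ^ 2))
          have e2 := integral_add iE (iEζ.const_mul (x * t))
          simp only [Pi.add_apply, integral_const_mul] at e1 e2
          rw [e1, e2]
      _ ≤ ∫ ω, E ω ∂P + (x * t) ^ 2 * (σ * ∫ ω, E ω ∂P) := by
          rw [h1 n c, mul_zero, add_zero]
          gcongr
          exact h2 n c
      _ = (1 + (x * t) ^ 2 * σ) * ∫ ω, E ω ∂P := by ring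
      _ ≤ Real.exp ((x * t) ^ 2 * σ) * Real.exp (σ * c ^ 2 * (n : ℝ) ^ (-α)) := by
          gcongr
          · rw [add_comm]; exact Real.add_one_le_exp _
          · exact ih c hcle
      _ ≤ Real.exp (σ * x ^ 2 * t) := by
          rw [← Real.exp_add, Real.exp_le_exp]
          -- The proxy closes up because `t² + (1 - t) t = t`.
          have e4 : (1 - t) ^ 2 * (n : ℝ) ^ (-α) ≤ (1 - t) * t := by
            calc (1 - t) ^ 2 * (n : ℝ) ^ (-α) = (1 - t) * ((1 - t) * (n : ℝ) ^ (-α)) := by ring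
              _ ≤ (1 - t) * t := by gcongr
          calc (x * t) ^ 2 * σ + σ * c ^ 2 * (n : ℝ) ^ (-α)
              = σ * x ^ 2 * (t ^ 2 + (1 - t) ^ 2 * (n : ℝ) ^ (-α)) := by rw [hc]; ring
            _ ≤ σ * x ^ 2 * (t ^ 2 + (1 - t) * t) := by gcongr
            _ = σ * x ^ 2 * t := by ring

/-- After squaring, the claim is `log n = o(n ^ (α - 2κ))`. It makes the optimal Chernoff parameter
admissible in `exp_moment_le`, and is where `κ < α / 2` is needed. -/
theorem eventually_log_rpow_le (hκ : κ < α / 2) (hK : 0 < K) :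
    ∀ᶠ n : ℕ in atTop,
      √((n : ℝ) ^ α * Real.log n) ≤ (n : ℝ) ^ (α - κ) / K := by
  have h1 : (fun x : ℝ => Real.log x) =o[atTop] fun x : ℝ => x ^ (α - 2 * κ) :=
    isLittleO_log_rpow_atTop (by linarith)
  have h2 := (h1.comp_tendsto tendsto_natCast_atTop_atTop).bound (c := (K ^ 2)⁻¹) (by positivity)
  filter_upwards [h2, eventually_ge_atTop 1] with n hn hn1
  have hn0 : (0 : ℝ) < n := by exact_mod_cast hn1
  have hl : 0 ≤ Real.log n := Real.log_natCast_nonneg n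
  simp only [Function.comp, Real.norm_eq_abs] at hn
  rw [abs_of_nonneg hl, abs_of_pos (by positivity)] at hn
  refine Real.sqrt_le_iff.2 ⟨by positivity, ?_⟩
  calc (n : ℝ) ^ α * Real.log n ≤ (n : ℝ) ^ α * ((K ^ 2)⁻¹ * (n : ℝ) ^ (α - 2 * κ)) := by gcongr
    _ = ((n : ℝ) ^ α * (n : ℝ) ^ (α - 2 * κ)) / K ^ 2 := by field_simp
    _ = ((n : ℝ) ^ (α - κ) / K) ^ 2 := by
      rw [div_pow, ← Real.rpow_add hn0, sq ((n : ℝ) ^ (α - κ)), ← Real.rpow_add hn0]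
      congr 2
      ring

theorem recursion_upper_tail [IsProbabilityMeasure P] (hα0 : 0 < α) (hα1 : α ≤ 1) (hκ0 : 0 ≤ κ)
    (hκ : κ < α / 2) (hK : 0 < K) (hσ : 0 ≤ σ) (hm0 : ∀ ω, m 0 ω = 0)
    (hm : ∀ n ω, m (n + 1) ω =
      (1 - ((n : ℝ) + 1) ^ (-α)) * m n ω + ((n : ℝ) + 1) ^ (-α) * ζ n ω)
    (hmm : ∀ n, Measurable (m n)) (hζm : ∀ n, Measurable (ζ n))
    (hb : ∀ n ω, |ζ n ω| ≤ K * ((n : ℝ) + 1) ^ κ)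
    (h1 : ∀ n c, ∫ ω, Real.exp (c * m n ω) * ζ n ω ∂P = 0)
    (h2 : ∀ n c, ∫ ω, Real.exp (c * m n ω) * ζ n ω ^ 2 ∂P ≤ σ * ∫ ω, Real.exp (c * m n ω) ∂P) :
    ∀ᵐ ω ∂P, ∀ᶠ n : ℕ in atTop, m n ω ≤ (σ + 2) * √(Real.log n / (n : ℝ) ^ α) := by
  have key : ∀ᶠ n : ℕ in atTop,
      P {ω | (σ + 2) * √(Real.log n / (n : ℝ) ^ α) < m n ω} ≤
        ENNReal.ofReal (1 / (n : ℝ) ^ 2) := by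
    filter_upwards [eventually_log_rpow_le (K := K) hκ hK, eventually_ge_atTop 1] with n hn hn1
    have hn0 : (0 : ℝ) < n := by exact_mod_cast hn1
    have hl : 0 ≤ Real.log n := Real.log_natCast_nonneg n
    -- With this `x` and threshold `y`, the Chernoff exponent `-x y + σ x² n⁻ᵅ` equals `-(σ + 2) log
    -- n + σ log n = -2 log n`, which is summable after exponentiation.
    set x : ℝ := √((n : ℝ) ^ α * Real.log n) with hx
    have hx0 : 0 ≤ x := Real.sqrt_nonneg _
    set y : ℝ := (σ + 2) * √(Real.log n / (n : ℝ) ^ α) with hy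
    have hxy : x * y = (σ + 2) * Real.log n := by
      rw [hx, hy, mul_left_comm, ← Real.sqrt_mul (by positivity)]
      have : (n : ℝ) ^ α * Real.log n * (Real.log n / (n : ℝ) ^ α) = Real.log n ^ 2 := by
        field_simp
      rw [this, Real.sqrt_sq hl]
    have hx2 : x ^ 2 * (n : ℝ) ^ (-α) = Real.log n := by
      rw [hx, Real.sq_sqrt (by positivity), Real.rpow_neg hn0.le]
      field_simp
    obtain ⟨b, hbm⟩ := recursion_bounded hm0 hm hb n
    have hint : Integrable (fun ω => Real.exp (x * m n ω)) P := by
      refine Integrable.of_bound ((hmm n).const_mul x).exp.aestronglyMeasurable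
        (Real.exp (|x| * b)) (.of_forall fun ω => ?_)
      rw [Real.norm_eq_abs, abs_of_pos (Real.exp_pos _), Real.exp_le_exp]
      calc x * m n ω ≤ |x * m n ω| := le_abs_self _
        _ = |x| * |m n ω| := abs_mul _ _
        _ ≤ |x| * b := by gcongr; exact hbm ω
    have hch := measure_ge_le_exp_mul_mgf (μ := P) (X := m n) y hx0 hint
    have hmgf : mgf (m n) P x ≤ Real.exp (σ * x ^ 2 * (n : ℝ) ^ (-α)) :=
      exp_moment_le hα0 hα1 hκ0 hK hσ hm0 hm hmm hζm hb h1 h2 n x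
        (by rwa [abs_of_nonneg hx0])
    have hle : P.real {ω | y ≤ m n ω} ≤ 1 / (n : ℝ) ^ 2 := by
      refine hch.trans ?_
      calc Real.exp (-x * y) * mgf (m n) P x
          ≤ Real.exp (-x * y) * Real.exp (σ * x ^ 2 * (n : ℝ) ^ (-α)) := by gcongr
        _ = Real.exp (-(2 * Real.log n)) := by
            rw [← Real.exp_add, mul_assoc σ, hx2]
            congr 1
            linarith
        _ = 1 / (n : ℝ) ^ 2 := by
            rw [Real.exp_neg, two_mul, Real.exp_add, Real.exp_log hn0]
            field_simp
    calc P {ω | y < m n ω} ≤ P {ω | y ≤ m n ω} := measure_mono fun ω (h : y < m n ω) => h.le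
      _ = ENNReal.ofReal (P.real {ω | y ≤ m n ω}) := by
          rw [Measure.real, ENNReal.ofReal_toReal (measure_ne_top _ _)]
      _ ≤ _ := ENNReal.ofReal_le_ofReal hle
  obtain ⟨N, hN⟩ := eventually_atTop.1 key
  have hsum : ∑' n, P {ω | (σ + 2) * √(Real.log (n + N : ℕ) / ((n + N : ℕ) : ℝ) ^ α) <
      m (n + N) ω} ≠ ⊤ := by
    refine ne_top_of_le_ne_top ?_ (ENNReal.tsum_le_tsum fun n => hN (n + N) (by omega))
    have hs : Summable fun n : ℕ => 1 / ((n + N : ℕ) : ℝ) ^ 2 :=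
      (summable_nat_add_iff (f := fun n : ℕ => 1 / (n : ℝ) ^ 2) N).2
        (Real.summable_one_div_nat_pow.2 (by norm_num))
    rw [← ENNReal.ofReal_tsum_of_nonneg (fun n => by positivity) hs]
    exact ENNReal.ofReal_ne_top
  filter_upwards [ae_eventually_notMem hsum] with ω hω
  obtain ⟨n₀, hn₀⟩ := eventually_atTop.1 hω
  filter_upwards [eventually_ge_atTop (n₀ + N)] with n hn
  have := hn₀ (n - N) (by omega)
  simpa [Nat.sub_add_cancel (by omega : N ≤ n)] using this

/-- A scalar recursion with step sizes `(n + 1)⁻ᵅ` driven by martingale differences `ζ n` of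
bounded conditional variance and of size `O(nᵏ)`, `k < α / 2`, is `O(√(log n / nᵅ))`. -/
theorem recursion_isBigO [IsProbabilityMeasure P] (hα0 : 0 < α) (hα1 : α ≤ 1) (hκ0 : 0 ≤ κ)
    (hκ : κ < α / 2) (hK : 0 < K) (hσ : 0 ≤ σ) (hm0 : ∀ ω, m 0 ω = 0)
    (hm : ∀ n ω, m (n + 1) ω =
      (1 - ((n : ℝ) + 1) ^ (-α)) * m n ω + ((n : ℝ) + 1) ^ (-α) * ζ n ω)
    (hmm : ∀ n, Measurable (m n)) (hζm : ∀ n, Measurable (ζ n))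
    (hb : ∀ n ω, |ζ n ω| ≤ K * ((n : ℝ) + 1) ^ κ)
    (h1 : ∀ n c, ∫ ω, Real.exp (c * m n ω) * ζ n ω ∂P = 0)
    (h2 : ∀ n c, ∫ ω, Real.exp (c * m n ω) * ζ n ω ^ 2 ∂P ≤ σ * ∫ ω, Real.exp (c * m n ω) ∂P) :
    ∀ᵐ ω ∂P, (fun n => m n ω) =O[atTop] fun n : ℕ => √(Real.log n / (n : ℝ) ^ α) := by
  have hup := recursion_upper_tail hα0 hα1 hκ0 hκ hK hσ hm0 hm hmm hζm hb h1 h2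
  -- The hypotheses are invariant under `(m, ζ) ↦ (-m, -ζ)`, with `c` replaced by `-c`.
  have hlo := recursion_upper_tail (m := fun n ω => -m n ω) (ζ := fun n ω => -ζ n ω) (P := P)
    hα0 hα1 hκ0 hκ hK hσ (fun ω => by simp [hm0]) (fun n ω => by rw [hm]; ring)
    (fun n => (hmm n).neg) (fun n => (hζm n).neg) (fun n ω => by rw [abs_neg]; exact hb n ω)
    (fun n c => by
      have := h1 n (-c)
      simp only [mul_neg, neg_mul, integral_neg] at this ⊢
      rw [this, neg_zero])
    (fun n c => by simpa using h2 n (-c))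
  filter_upwards [hup, hlo] with ω hu hl
  refine IsBigO.of_bound (σ + 2) ?_
  filter_upwards [hu, hl] with n h1 h2
  rw [Real.norm_eq_abs, Real.norm_eq_abs, abs_of_nonneg (Real.sqrt_nonneg _), abs_le]
  exact ⟨by linarith, h1⟩

end Recursion

/-! ### A strong law of large numbers for orthogonal random variables -/

section SLLN

variable {Ω : Type*} [MeasurableSpace Ω] {P : Measure Ω}

/-- By Tonelli `∑ Y k ²` has finite expectation, so it is almost surely finite and its terms vanish
in the limit. -/
theorem ae_tendsto_zero_of_summable_sq {Y : ℕ → Ω → ℝ} {a : ℕ → ℝ} (hY : ∀ k, MemLp (Y k) 2 P)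
    (ha : Summable a) (h : ∀ k, ∫ ω, Y k ω ^ 2 ∂P ≤ a k) :
    ∀ᵐ ω ∂P, Tendsto (fun k => Y k ω) atTop (𝓝 0) := by
  have h0 : ∀ k, 0 ≤ a k := fun k => (integral_nonneg fun ω => sq_nonneg _).trans (h k)
  have h1 : ∀ k, ∫⁻ ω, ENNReal.ofReal (Y k ω ^ 2) ∂P ≤ ENNReal.ofReal (a k) := fun k => by
    rw [← ofReal_integral_eq_lintegral_ofReal (hY k).integrable_sq
      (.of_forall fun ω => sq_nonneg _)]
    exact ENNReal.ofReal_le_ofReal (h k)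
  have hm : ∀ k, AEMeasurable (fun ω => ENNReal.ofReal (Y k ω ^ 2)) P := fun k =>
    ((hY k).aestronglyMeasurable.aemeasurable.pow_const 2).ennreal_ofReal
  have h2 : ∫⁻ ω, ∑' k, ENNReal.ofReal (Y k ω ^ 2) ∂P ≠ ⊤ := by
    rw [lintegral_tsum hm]
    refine ne_top_of_le_ne_top ?_ (ENNReal.tsum_le_tsum h1)
    rw [← ENNReal.ofReal_tsum_of_nonneg h0 ha]
    exact ENNReal.ofReal_ne_top
  filter_upwards [ae_lt_top' (AEMeasurable.tsum hm) h2] with ω hω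
  have h3 := ENNReal.tendsto_atTop_zero_of_tsum_ne_top hω.ne
  have h4 : Tendsto (fun k => Y k ω ^ 2) atTop (𝓝 0) := by
    have := (ENNReal.tendsto_toReal ENNReal.zero_ne_top).comp h3
    simpa [Function.comp_def, ENNReal.toReal_ofReal (sq_nonneg _)] using this
  have h5 := h4.sqrt
  simp only [Real.sqrt_sq_eq_abs, Real.sqrt_zero] at h5
  exact (tendsto_zero_iff_abs_tendsto_zero _).2 h5

variable {d : ℕ → Ω → ℝ} {C : ℝ}

theorem integral_sq_sum_le (hd : ∀ k, MemLp (d k) 2 P) (hC : ∀ k, ∫ ω, d k ω ^ 2 ∂P ≤ C)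
    (horth : ∀ j k, j < k → ∫ ω, d j ω * d k ω ∂P = 0) (n : ℕ) :
    ∫ ω, (∑ k ∈ Finset.range n, d k ω) ^ 2 ∂P ≤ n * C := by
  induction n with
  | zero => simp
  | succ n ih =>
    have hS : MemLp (fun ω => ∑ k ∈ Finset.range n, d k ω) 2 P :=
      memLp_finsetSum _ fun k _ => hd k
    have i1 := hS.integrable_sq
    have i2 := (hd n).integrable_sq
    have i3 : ∀ k, Integrable (fun ω => d k ω * d n ω) P := fun k => (hd k).integrable_mul (hd n)
    have i4 : Integrable (fun ω => ∑ k ∈ Finset.range n, d k ω * d n ω) P :=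
      integrable_finsetSum _ fun k _ => i3 k
    have e : ∀ ω, (∑ k ∈ Finset.range (n + 1), d k ω) ^ 2 =
        (∑ k ∈ Finset.range n, d k ω) ^ 2 + 2 * (∑ k ∈ Finset.range n, d k ω * d n ω)
          + d n ω ^ 2 := fun ω => by
      rw [Finset.sum_range_succ, ← Finset.sum_mul]; ring
    simp_rw [e]
    have e1 := integral_add (i1.add (i4.const_mul 2)) i2
    have e2 := integral_add i1 (i4.const_mul 2)
    simp only [Pi.add_apply, integral_const_mul] at e1 e2
    rw [e1, e2, integral_finsetSum _ fun k _ => i3 k,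
      Finset.sum_eq_zero fun k hk => horth k n (Finset.mem_range.1 hk)]
    push_cast
    linarith [hC n]

/-- Pairwise orthogonal random variables with bounded second moments obey the strong law of large
numbers. -/
theorem strong_law_of_orthogonal (hd : ∀ k, MemLp (d k) 2 P)
    (hC : ∀ k, ∫ ω, d k ω ^ 2 ∂P ≤ C) (horth : ∀ j k, j < k → ∫ ω, d j ω * d k ω ∂P = 0) :
    ∀ᵐ ω ∂P, Tendsto (fun n : ℕ => (∑ k ∈ Finset.range n, d k ω) / n) atTop (𝓝 0) := by
  have hC0 : 0 ≤ C := (integral_nonneg fun ω => sq_nonneg _).trans (hC 0)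
  have hsum : Summable fun k : ℕ => 9 * C * (1 / ((k + 1 : ℕ) : ℝ) ^ 2) :=
    ((summable_nat_add_iff (f := fun n : ℕ => 1 / (n : ℝ) ^ 2) 1).2
        (Real.summable_one_div_nat_pow.2 (by norm_num))).mul_left _
  -- Along the squares `(k + 1)²` the normalized partial sums have second moments of order `k⁻²`.
  have hA := ae_tendsto_zero_of_summable_sq (P := P)
    (Y := fun k ω => (((k : ℝ) + 1) ^ 2)⁻¹ * ∑ j ∈ Finset.range ((k + 1) ^ 2), d j ω)
    (fun k => (memLp_finsetSum _ fun j _ => hd j).const_mul _) hsum (fun k => by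
      simp_rw [mul_pow]
      rw [integral_const_mul]
      have := integral_sq_sum_le hd hC horth ((k + 1) ^ 2)
      push_cast at this ⊢
      calc ((((k : ℝ) + 1) ^ 2)⁻¹) ^ 2 * ∫ ω, (∑ j ∈ Finset.range ((k + 1) ^ 2), d j ω) ^ 2 ∂P
          ≤ ((((k : ℝ) + 1) ^ 2)⁻¹) ^ 2 * (((k : ℝ) + 1) ^ 2 * C) := by gcongr
        _ = C * (1 / ((k : ℝ) + 1) ^ 2) := by field_simp
        _ ≤ 9 * C * (1 / ((k : ℝ) + 1) ^ 2) := by gcongr; linarith)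
  -- Between consecutive squares there are only `2k + 3 ≤ 3 (k + 1)` terms, so Cauchy–Schwarz
  -- suffices there; this gives the factor 9.
  have hB := ae_tendsto_zero_of_summable_sq (P := P)
    (Y := fun k ω => (((k : ℝ) + 1) ^ 2)⁻¹ *
      ∑ j ∈ Finset.Ico ((k + 1) ^ 2) ((k + 2) ^ 2), |d j ω|)
    (fun k => (memLp_finsetSum _ fun j _ => (hd j).abs).const_mul _) hsum (fun k => by
      simp_rw [mul_pow]
      rw [integral_const_mul]
      have hcard : ((Finset.Ico ((k + 1) ^ 2) ((k + 2) ^ 2)).card : ℝ) = 2 * k + 3 := by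
        rw [Nat.card_Ico, Nat.cast_sub (by gcongr; omega)]
        push_cast
        ring
      have h1 : ∫ ω, (∑ j ∈ Finset.Ico ((k + 1) ^ 2) ((k + 2) ^ 2), |d j ω|) ^ 2 ∂P ≤
          (2 * k + 3) * ((2 * k + 3) * C) := by
        calc ∫ ω, (∑ j ∈ Finset.Ico ((k + 1) ^ 2) ((k + 2) ^ 2), |d j ω|) ^ 2 ∂P
            ≤ ∫ ω, (2 * k + 3) * ∑ j ∈ Finset.Ico ((k + 1) ^ 2) ((k + 2) ^ 2), d j ω ^ 2 ∂P := by
              refine integral_mono ?_ ?_ fun ω => ?_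
              · exact (memLp_finsetSum _ fun j _ => (hd j).abs).integrable_sq
              · exact (integrable_finsetSum _ fun j _ => (hd j).integrable_sq).const_mul _
              · have := sq_sum_le_card_mul_sum_sq
                  (s := Finset.Ico ((k + 1) ^ 2) ((k + 2) ^ 2)) (f := fun j => |d j ω|)
                simpa only [sq_abs, hcard] using this
          _ = (2 * k + 3) * ∑ j ∈ Finset.Ico ((k + 1) ^ 2) ((k + 2) ^ 2), ∫ ω, d j ω ^ 2 ∂P := by
              rw [integral_const_mul, integral_finsetSum _ fun j _ => (hd j).integrable_sq]
          _ ≤ (2 * k + 3) * ∑ j ∈ Finset.Ico ((k + 1) ^ 2) ((k + 2) ^ 2), C := by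
              gcongr with j _
              exact hC j
          _ = (2 * k + 3) * ((2 * k + 3) * C) := by
              rw [Finset.sum_const, nsmul_eq_mul, hcard]
      calc ((((k : ℝ) + 1) ^ 2)⁻¹) ^ 2 *
            ∫ ω, (∑ j ∈ Finset.Ico ((k + 1) ^ 2) ((k + 2) ^ 2), |d j ω|) ^ 2 ∂P
          ≤ ((((k : ℝ) + 1) ^ 2)⁻¹) ^ 2 * ((2 * k + 3) * ((2 * k + 3) * C)) := by gcongr
        _ ≤ ((((k : ℝ) + 1) ^ 2)⁻¹) ^ 2 * ((3 * (k + 1)) * ((3 * (k + 1)) * C)) := by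
            have : (2 * k + 3 : ℝ) ≤ 3 * (k + 1) := by linarith [Nat.cast_nonneg (α := ℝ) k]
            gcongr
        _ = 9 * C * (1 / ((k + 1 : ℕ) : ℝ) ^ 2) := by push_cast; field_simp; ring)
  filter_upwards [hA, hB] with ω hA hB
  -- The subtraction of 1 matches the indexing of the blocks by `k + 1`.
  have hs : Tendsto (fun n : ℕ => Nat.sqrt n - 1) atTop atTop := by
    refine tendsto_atTop.2 fun b => ?_
    filter_upwards [eventually_ge_atTop ((b + 1) * (b + 1))] with n hn
    have := Nat.le_sqrt.2 hn
    omega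
  have hAB := ((hA.abs.add hB.abs).comp hs)
  rw [abs_zero, add_zero] at hAB
  refine squeeze_zero_norm' ?_ hAB
  filter_upwards [eventually_ge_atTop 1] with n hn
  obtain ⟨k, hk⟩ : ∃ k, Nat.sqrt n = k + 1 :=
    ⟨Nat.sqrt n - 1, by have := Nat.sqrt_pos.2 hn; omega⟩
  have hlo : (k + 1) ^ 2 ≤ n := by rw [sq, ← hk]; exact Nat.sqrt_le n
  have hhi : n < (k + 2) ^ 2 := by
    have := Nat.lt_succ_sqrt n
    rw [hk] at this
    rw [sq]; exact this
  have hlo' : ((k : ℝ) + 1) ^ 2 ≤ n := by exact_mod_cast hlo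
  have hT : |∑ j ∈ Finset.Ico ((k + 1) ^ 2) n, d j ω| ≤
      ∑ j ∈ Finset.Ico ((k + 1) ^ 2) ((k + 2) ^ 2), |d j ω| :=
    (Finset.abs_sum_le_sum_abs _ _).trans (Finset.sum_le_sum_of_subset_of_nonneg
      (Finset.Ico_subset_Ico_right hhi.le) fun _ _ _ => abs_nonneg _)
  simp only [Function.comp, hk, Nat.add_sub_cancel]
  rw [← Finset.sum_range_add_sum_Ico _ hlo, Real.norm_eq_abs, abs_div, Nat.abs_cast, abs_mul,
    abs_mul, abs_of_pos (by positivity : 0 < (((k : ℝ) + 1) ^ 2)⁻¹), ← mul_add, ← div_eq_inv_mul]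
  refine div_le_div₀ (by positivity) ((abs_add_le _ _).trans ?_) (by positivity) hlo'
  exact add_le_add le_rfl (hT.trans (le_abs_self _))

end SLLN

/-! ### Weighted averages -/

/-- A weighted average with weights `ℓ k` of divergent sum, of a convergent sequence. -/
theorem tendsto_of_weighted_average {E : Type*} [NormedAddCommGroup E] [NormedSpace ℝ E]
    {x y : ℕ → E} {x₀ : E} {l : ℕ → ℝ} (hl : ∀ k, 0 ≤ l k)
    (hdiv : Tendsto (fun n => ∑ k ∈ Finset.range n, l k) atTop atTop)
    (hx : Tendsto x atTop (𝓝 x₀))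
    (hy : ∀ n, y (n + 1) = y n + (l n / ∑ k ∈ Finset.range (n + 1), l k) • (x (n + 1) - y n)) :
    Tendsto y atTop (𝓝 x₀) := by
  -- Multiplied by the total weight, the averaging recursion telescopes.
  have hrec : ∀ n, (∑ k ∈ Finset.range n, l k) • (y n - x₀) =
      ∑ k ∈ Finset.range n, l k • (x (k + 1) - x₀) := by
    intro n
    induction n with
    | zero => simp
    | succ n ih =>
      rw [Finset.sum_range_succ (fun k => l k • (x (k + 1) - x₀)), ← ih]
      set W := ∑ k ∈ Finset.range (n + 1), l k with hW
      have hWs : W = ∑ k ∈ Finset.range n, l k + l n := Finset.sum_range_succ _ _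
      -- Vanishing initial weights do occur (`log 1 = 0`); both sides are then zero, whatever the
      -- value of `0 / 0`.
      rcases eq_or_ne W 0 with h0 | h0
      · have h1 : ∀ k ∈ Finset.range (n + 1), l k = 0 :=
          (Finset.sum_eq_zero_iff_of_nonneg fun k _ => hl k).1 h0
        have h2 : l n = 0 := h1 n (by simp)
        have h3 : ∑ k ∈ Finset.range n, l k = 0 := by rw [h2, add_zero] at hWs; rw [← hWs, h0]
        rw [h0, h2, h3]; simp
      · rw [hy, ← hW]
        have e : W • (y n + (l n / W) • (x (n + 1) - y n) - x₀) =
            W • (y n - x₀) + l n • (x (n + 1) - y n) := by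
          rw [add_sub_right_comm, smul_add, smul_smul, mul_div_cancel₀ _ h0]
        rw [e, hWs]
        module
  have ho : (fun k => l k • (x (k + 1) - x₀)) =o[atTop] l := by
    have h1 : (fun k => x (k + 1) - x₀) =o[atTop] fun _ => (1 : ℝ) := by
      rw [isLittleO_one_iff]
      have := (hx.comp (tendsto_add_atTop_nat 1)).sub_const x₀
      simpa using this
    have := (isBigO_refl l atTop).smul_isLittleO h1
    simpa using this
  have h2 := ho.sum_range hl hdiv
  rw [← tendsto_sub_nhds_zero_iff]
  have h3 : (fun n => (∑ k ∈ Finset.range n, l k)⁻¹ •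
      ∑ k ∈ Finset.range n, l k • (x (k + 1) - x₀)) =o[atTop] fun _ => (1 : ℝ) := by
    have := (isBigO_refl (fun n => (∑ k ∈ Finset.range n, l k)⁻¹) atTop).smul_isLittleO h2
    refine this.trans_isBigO (IsBigO.of_bound 1 (.of_forall fun n => ?_))
    simp only [smul_eq_mul, norm_one, mul_one]
    rcases eq_or_ne (∑ k ∈ Finset.range n, l k) 0 with h | h
    · simp [h]
    · rw [inv_mul_cancel₀ h]; simp
  refine ((isLittleO_one_iff ℝ).1 h3).congr' ?_
  filter_upwards [hdiv.eventually_gt_atTop 0] with n hn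
  rw [← hrec, smul_smul, inv_mul_cancel₀ hn.ne', one_smul]

/-- The terms are eventually at least 1, so the series cannot be summable. -/
theorem tendsto_sum_log_rpow {w : ℝ} (hw : 0 ≤ w) :
    Tendsto (fun n => ∑ k ∈ Finset.range n, Real.log ((k : ℝ) + 1) ^ w) atTop atTop := by
  have h0 : ∀ k : ℕ, 0 ≤ Real.log ((k : ℝ) + 1) ^ w := fun k =>
    Real.rpow_nonneg (Real.log_nonneg (by linarith [Nat.cast_nonneg (α := ℝ) k])) _
  rw [← not_summable_iff_tendsto_nat_atTop_of_nonneg h0]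
  intro h
  have h1 := h.tendsto_atTop_zero
  have h2 : ∀ᶠ k : ℕ in atTop, Real.log ((k : ℝ) + 1) ^ w < 1 := h1.eventually_lt_const one_pos
  have h3 : ∀ᶠ k : ℕ in atTop, 1 ≤ Real.log ((k : ℝ) + 1) := by
    have : Tendsto (fun k : ℕ => Real.log ((k : ℝ) + 1)) atTop atTop :=
      Real.tendsto_log_atTop.comp (tendsto_atTop_add_const_right _ _ tendsto_natCast_atTop_atTop)
    exact this.eventually_ge_atTop 1
  obtain ⟨k, hk, hk'⟩ := (h2.and h3).exists
  linarith [Real.one_le_rpow hk' hw]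

/-! ### Deterministic stochastic-approximation recursions -/

section Deterministic

variable {α c₁ c₂ : ℝ} {τ : ℕ → ℝ}

theorem tendsto_rpow_neg_succ (hα : 0 < α) :
    Tendsto (fun n : ℕ => ((n : ℝ) + 1) ^ (-α)) atTop (𝓝 0) :=
  (tendsto_rpow_neg_atTop hα).comp
    (tendsto_atTop_add_const_right _ _ tendsto_natCast_atTop_atTop)

/-- From `n` to `n + 1` the rate loses at most a factor `1 - 1 / (n + 1)`. For `α < 1` the step `c τ
n` eventually exceeds `1 / (n + 1)`, so the contraction outpaces the decay of the rate, for every `c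
> 0`. -/
theorem rate_succ_ge (hα0 : 0 < α) (hα1 : α < 1) (hc₁ : 0 < c₁)
    (hτ₁ : ∀ n : ℕ, c₁ * ((n : ℝ) + 1) ^ (-α) ≤ τ n) {c : ℝ} (hc : 0 < c) :
    ∀ᶠ n : ℕ in atTop, (1 - c * τ n) * (Real.log n / (n : ℝ) ^ α) ≤
      Real.log (n + 1 : ℕ) / ((n + 1 : ℕ) : ℝ) ^ α := by
  have h1 := (tendsto_rpow_neg_succ (α := 1 - α) (by linarith)).eventually_le_const
    (show (0 : ℝ) < c * c₁ by positivity)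
  filter_upwards [h1, eventually_ge_atTop 1] with n hn hn1
  have hn0 : (0 : ℝ) < n := by exact_mod_cast hn1
  have hn2 : (0 : ℝ) < (n : ℝ) + 1 := by positivity
  have h2 : ((n : ℝ) + 1)⁻¹ ≤ c * τ n := by
    calc ((n : ℝ) + 1)⁻¹ = ((n : ℝ) + 1) ^ (-(1 - α)) * ((n : ℝ) + 1) ^ (-α) := by
          rw [← Real.rpow_add hn2, show -(1 - α) + -α = -1 by ring, Real.rpow_neg_one]
      _ ≤ (c * c₁) * ((n : ℝ) + 1) ^ (-α) := by gcongr
      _ = c * (c₁ * ((n : ℝ) + 1) ^ (-α)) := by ring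
      _ ≤ c * τ n := by gcongr; exact hτ₁ n
  have h3 : 1 - c * τ n ≤ ((n : ℝ) / ((n : ℝ) + 1)) ^ α := by
    have h4 := Real.rpow_le_rpow_of_exponent_ge (x := (n : ℝ) / ((n : ℝ) + 1)) (by positivity)
      (by rw [div_le_one (by positivity)]; linarith) hα1.le
    rw [Real.rpow_one] at h4
    refine le_trans ?_ h4
    have : (n : ℝ) / ((n : ℝ) + 1) = 1 - ((n : ℝ) + 1)⁻¹ := by field_simp; ring
    linarith
  have hl : 0 ≤ Real.log n := Real.log_natCast_nonneg n
  push_cast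
  calc (1 - c * τ n) * (Real.log n / (n : ℝ) ^ α)
      ≤ ((n : ℝ) / ((n : ℝ) + 1)) ^ α * (Real.log n / (n : ℝ) ^ α) := by gcongr
    _ = Real.log n / ((n : ℝ) + 1) ^ α := by
        rw [Real.div_rpow hn0.le hn2.le]; field_simp
    _ ≤ Real.log ((n : ℝ) + 1) / ((n : ℝ) + 1) ^ α := by gcongr; linarith

theorem tendsto_step (hα0 : 0 < α) (hc₁ : 0 < c₁)
    (hτ₁ : ∀ n : ℕ, c₁ * ((n : ℝ) + 1) ^ (-α) ≤ τ n)
    (hτ₂ : ∀ n : ℕ, τ n ≤ c₂ * ((n : ℝ) + 1) ^ (-α)) : Tendsto τ atTop (𝓝 0) := by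
  have h := (tendsto_rpow_neg_succ hα0).const_mul c₂
  rw [mul_zero] at h
  exact squeeze_zero (fun n => le_trans (by positivity) (hτ₁ n)) hτ₂ h

/-- Half of the contraction absorbs the forcing term, provided the constant in front of the rate is
large; the other half beats the decay of the rate by `rate_succ_ge`. -/
theorem scalar_recursion_isBigO (hα0 : 0 < α) (hα1 : α < 1) (hc₁ : 0 < c₁)
    (hτ₁ : ∀ n : ℕ, c₁ * ((n : ℝ) + 1) ^ (-α) ≤ τ n)
    (hτ₂ : ∀ n : ℕ, τ n ≤ c₂ * ((n : ℝ) + 1) ^ (-α)) {a : ℕ → ℝ} {c C : ℝ} (hc : 0 < c)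
    (ha0 : ∀ n, 0 ≤ a n)
    (ha : ∀ᶠ n : ℕ in atTop, a (n + 1) ≤ (1 - c * τ n) * a n +
      C * τ n * (Real.log n / (n : ℝ) ^ α)) :
    a =O[atTop] fun n : ℕ => Real.log n / (n : ℝ) ^ α := by
  have hτ0 := tendsto_step hα0 hc₁ hτ₁ hτ₂
  have hτ0' := hτ0.eventually_le_const (show (0 : ℝ) < 1 / c by positivity)
  obtain ⟨N, hN⟩ := eventually_atTop.1 ((ha.and hτ0').and
    ((rate_succ_ge hα0 hα1 hc₁ hτ₁ (half_pos hc)).and (eventually_ge_atTop 2)))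
  set s : ℕ → ℝ := fun n => Real.log n / (n : ℝ) ^ α with hs
  -- Here `N ≥ 2` matters: `log N` must be positive for a multiple of `s N` to dominate `a N`.
  have hsN : 0 < s N := by
    have h2 := (hN N le_rfl).2.2
    have : (1 : ℝ) < N := by exact_mod_cast h2
    have := Real.log_pos this
    positivity
  have hs0 : ∀ n, 0 ≤ s n := fun n => div_nonneg (Real.log_natCast_nonneg n) (by positivity)
  set K : ℝ := max (2 * C / c) (a N / s N) with hK
  have hKC : C ≤ K * c / 2 := by
    have : 2 * C / c ≤ K := le_max_left _ _
    rw [div_le_iff₀ hc] at this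
    linarith
  have hKa : a N ≤ K * s N := by
    have : a N / s N ≤ K := le_max_right _ _
    rwa [div_le_iff₀ hsN] at this
  have hK0 : 0 ≤ K := (div_nonneg (ha0 N) hsN.le).trans (le_max_right _ _)
  have key : ∀ n, N ≤ n → a n ≤ K * s n := by
    intro n hn
    induction n, hn using Nat.le_induction with
    | base => exact hKa
    | succ n hn ih =>
      obtain ⟨⟨h1, h2⟩, h3, -⟩ := hN n hn
      have hτp : 0 ≤ τ n := le_trans (by positivity) (hτ₁ n)
      have h4 : 0 ≤ 1 - c * τ n := by
        rw [le_div_iff₀ hc] at h2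
        linarith
      calc a (n + 1) ≤ (1 - c * τ n) * a n + C * τ n * s n := h1
        _ ≤ (1 - c * τ n) * (K * s n) + (K * c / 2) * τ n * s n := by
            have := hs0 n
            gcongr
        _ = K * ((1 - c / 2 * τ n) * s n) := by ring
        _ ≤ K * s (n + 1) := by gcongr
  refine IsBigO.of_bound K ?_
  filter_upwards [eventually_ge_atTop N] with n hn
  rw [Real.norm_eq_abs, Real.norm_eq_abs, abs_of_nonneg (ha0 n), abs_of_nonneg (hs0 n)]
  exact key n hn

open scoped InnerProductSpace in
/-- A perturbed linear recursion `R ↦ R - τ Γ R + τ e`, contracting for the quadratic form of the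
symmetric positive operator `F`. -/
theorem linear_recursion_isBigO {E : Type*} [NormedAddCommGroup E] [InnerProductSpace ℝ E]
    (hα0 : 0 < α) (hα1 : α < 1) (hc₁ : 0 < c₁)
    (hτ₁ : ∀ n : ℕ, c₁ * ((n : ℝ) + 1) ^ (-α) ≤ τ n)
    (hτ₂ : ∀ n : ℕ, τ n ≤ c₂ * ((n : ℝ) + 1) ^ (-α))
    (F Γ : E →L[ℝ] E) (hF : ∀ x y, ⟪F x, y⟫_ℝ = ⟪x, F y⟫_ℝ) {c₀ h₀ : ℝ} (hc₀ : 0 < c₀)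
    (hFpos : ∀ x, c₀ * ‖x‖ ^ 2 ≤ ⟪x, F x⟫_ℝ) (hh₀ : 0 < h₀)
    (hΓ : ∀ x, h₀ * ‖x‖ ^ 2 ≤ ⟪F x, Γ x⟫_ℝ) {R e₁ e₂ : ℕ → E}
    (hR : ∀ᶠ n in atTop, R (n + 1) = R n - τ n • Γ (R n) + τ n • (e₁ n + e₂ n))
    (he₁ : e₁ =o[atTop] fun n : ℕ => ‖R n‖ + √(Real.log n / (n : ℝ) ^ α))
    (he₂ : e₂ =O[atTop] fun n : ℕ => √(Real.log n / (n : ℝ) ^ α)) :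
    R =O[atTop] fun n : ℕ => √(Real.log n / (n : ℝ) ^ α) := by
  have hs0 : ∀ n : ℕ, 0 ≤ Real.log n / (n : ℝ) ^ α :=
    fun n => div_nonneg (Real.log_natCast_nonneg n) (by positivity)
  obtain ⟨C', hC', he₂'⟩ := he₂.exists_pos
  -- The additional 1 takes up the part of `e₁` that is small relative to the rate.
  set C : ℝ := C' + 1 with hCdef
  have hC : 0 < C := by positivity
  -- The added 1 keeps `f` positive even on the trivial space.
  set f : ℝ := ‖F‖ + 1 with hf
  have hf0 : 0 < f := by positivity
  set g : ℝ := ‖Γ‖ with hg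
  have hg0 : 0 ≤ g := norm_nonneg _
  have hWle : ∀ x, ⟪x, F x⟫_ℝ ≤ f * ‖x‖ ^ 2 := fun x => by
    calc ⟪x, F x⟫_ℝ ≤ ‖x‖ * ‖F x‖ := real_inner_le_norm _ _
      _ ≤ ‖x‖ * (‖F‖ * ‖x‖) := by gcongr; exact F.le_opNorm x
      _ = ‖F‖ * ‖x‖ ^ 2 := by ring
      _ ≤ f * ‖x‖ ^ 2 := by gcongr; linarith
  set ε : ℝ := min 1 (h₀ / (8 * f)) with hε
  have hε0 : 0 < ε := lt_min one_pos (by positivity)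
  have hε1 : ε ≤ 1 := min_le_left _ _
  have hε2 : 2 * f * ε ≤ h₀ / 4 := by
    have : ε ≤ h₀ / (8 * f) := min_le_right _ _
    rw [le_div_iff₀ (by positivity)] at this
    linarith
  set C₂ : ℝ := 4 / h₀ * f ^ 2 * C ^ 2 + 2 * f * C ^ 2 with hC₂
  have hτ0 := tendsto_step hα0 hc₁ hτ₁ hτ₂
  have hsmall := hτ0.eventually_le_const
    (show (0 : ℝ) < min 1 (h₀ / (4 * f * (1 + g) ^ 2)) by
      refine lt_min one_pos ?_
      positivity)
  -- Lyapunov function `⟪x, F x⟫`. The descent is at least `2 τ h₀ ‖x‖²`; the cross term with the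
  -- perturbation and the second-order term may each consume `τ h₀ ‖x‖² / 2`, and what remains is at
  -- least `(h₀ / f) τ ⟪x, F x⟫`. The constant `ε` and the smallness of `τ n` are fixed by this
  -- budget.
  have hW : (fun n => ⟪R n, F (R n)⟫_ℝ) =O[atTop] fun n : ℕ => Real.log n / (n : ℝ) ^ α := by
    refine scalar_recursion_isBigO hα0 hα1 hc₁ hτ₁ hτ₂ (c := h₀ / f) (C := C₂) (by positivity)
      (fun n => le_trans (by positivity) (hFpos (R n))) ?_
    filter_upwards [hR, he₁.bound hε0, he₂'.bound, hsmall] with n hR h1 h2 h3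
    have hτp : 0 ≤ τ n := le_trans (by positivity) (hτ₁ n)
    rw [Real.norm_eq_abs, abs_of_nonneg (Real.sqrt_nonneg _)] at h2
    set v : ℝ := √(Real.log n / (n : ℝ) ^ α) with hv
    have hv0 : 0 ≤ v := Real.sqrt_nonneg _
    have hv2 : v ^ 2 = Real.log n / (n : ℝ) ^ α := Real.sq_sqrt (hs0 n)
    rw [← hv2]
    set x := R n
    set e := e₁ n + e₂ n with he
    have hen : ‖e‖ ≤ ε * ‖x‖ + C * v := by
      rw [Real.norm_eq_abs, abs_of_nonneg (by positivity)] at h1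
      have : ε * v ≤ 1 * v := by gcongr
      calc ‖e‖ ≤ ε * (‖x‖ + v) + C' * v := (norm_add_le _ _).trans (add_le_add h1 h2)
        _ ≤ ε * ‖x‖ + C * v := by rw [hCdef]; linarith
    set X := ‖x‖ with hX
    have hX0 : 0 ≤ X := norm_nonneg _
    have h4 : τ n * (2 * f * (1 + g) ^ 2) ≤ h₀ / 2 := by
      have := h3.trans (min_le_right _ _)
      rw [le_div_iff₀ (by positivity)] at this
      linarith
    have h5 : τ n ≤ 1 := h3.trans (min_le_left _ _)
    have hexp : ⟪R (n + 1), F (R (n + 1))⟫_ℝ = ⟪x, F x⟫_ℝ - 2 * τ n * ⟪F x, Γ x⟫_ℝ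
        + 2 * τ n * ⟪F x, e⟫_ℝ + τ n ^ 2 * ⟪e - Γ x, F (e - Γ x)⟫_ℝ := by
      have e1 : R (n + 1) = x + τ n • (e - Γ x) := by
        rw [hR]; module
      rw [e1, map_add, map_smul, inner_add_left, inner_add_right, inner_add_right,
        real_inner_smul_left, real_inner_smul_right, real_inner_smul_left, real_inner_smul_right,
        ← hF x (e - Γ x), real_inner_comm (F x) (e - Γ x), inner_sub_right (F x)]
      ring
    have hb1 : ⟪F x, e⟫_ℝ ≤ f * X * (ε * X + C * v) := by
      calc ⟪F x, e⟫_ℝ ≤ ‖F x‖ * ‖e‖ := real_inner_le_norm _ _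
        _ ≤ (f * X) * (ε * X + C * v) := by
          gcongr
          exact (F.le_opNorm x).trans (by gcongr; linarith)
    have hb2 : ⟪e - Γ x, F (e - Γ x)⟫_ℝ ≤ f * (2 * ((1 + g) ^ 2 * X ^ 2 + C ^ 2 * v ^ 2)) := by
      refine (hWle _).trans ?_
      have : ‖e - Γ x‖ ≤ (1 + g) * X + C * v := by
        calc ‖e - Γ x‖ ≤ ‖e‖ + ‖Γ x‖ := norm_sub_le _ _
          _ ≤ (ε * X + C * v) + g * X := add_le_add hen (Γ.le_opNorm x)
          _ ≤ (1 * X + C * v) + g * X := by gcongr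
          _ = _ := by ring
      gcongr
      calc ‖e - Γ x‖ ^ 2 ≤ ((1 + g) * X + C * v) ^ 2 := by gcongr
        _ ≤ _ := by nlinarith [sq_nonneg ((1 + g) * X - C * v)]
    -- Young's inequality, as the expansion of a square.
    have hb3 : 2 * (f * X * (C * v)) ≤ h₀ / 4 * X ^ 2 + 4 / h₀ * f ^ 2 * C ^ 2 * v ^ 2 := by
      have h6 : 0 ≤ (4 / h₀) * (h₀ / 4 * X - f * C * v) ^ 2 := by positivity
      have h7 : (4 / h₀) * (h₀ / 4 * X - f * C * v) ^ 2 =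
          h₀ / 4 * X ^ 2 + 4 / h₀ * f ^ 2 * C ^ 2 * v ^ 2 - 2 * (f * X * (C * v)) := by
        field_simp
        ring
      linarith
    have hb4 : 2 * τ n * ⟪F x, e⟫_ℝ ≤
        τ n * (h₀ / 2 * X ^ 2 + 4 / h₀ * f ^ 2 * C ^ 2 * v ^ 2) := by
      calc 2 * τ n * ⟪F x, e⟫_ℝ ≤ 2 * τ n * (f * X * (ε * X + C * v)) := by gcongr
        _ = τ n * ((2 * f * ε) * X ^ 2 + 2 * (f * X * (C * v))) := by ring
        _ ≤ τ n * (h₀ / 4 * X ^ 2 + (h₀ / 4 * X ^ 2 + 4 / h₀ * f ^ 2 * C ^ 2 * v ^ 2)) := by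
          gcongr
        _ = _ := by ring
    have hb5 : τ n ^ 2 * ⟪e - Γ x, F (e - Γ x)⟫_ℝ ≤
        τ n * (h₀ / 2 * X ^ 2 + 2 * f * C ^ 2 * v ^ 2) := by
      calc τ n ^ 2 * ⟪e - Γ x, F (e - Γ x)⟫_ℝ
          ≤ τ n ^ 2 * (f * (2 * ((1 + g) ^ 2 * X ^ 2 + C ^ 2 * v ^ 2))) := by gcongr
        _ = τ n * ((τ n * (2 * f * (1 + g) ^ 2)) * X ^ 2 + τ n * (2 * f * C ^ 2 * v ^ 2)) := by
          ring
        _ ≤ τ n * (h₀ / 2 * X ^ 2 + 1 * (2 * f * C ^ 2 * v ^ 2)) := by gcongr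
        _ = _ := by ring
    have hb6 : τ n * (h₀ * X ^ 2) ≤ τ n * ⟪F x, Γ x⟫_ℝ := by gcongr; exact hΓ x
    have hb7 : h₀ / f * τ n * ⟪x, F x⟫_ℝ ≤ τ n * (h₀ * X ^ 2) := by
      calc h₀ / f * τ n * ⟪x, F x⟫_ℝ ≤ h₀ / f * τ n * (f * X ^ 2) := by gcongr; exact hWle x
        _ = _ := by field_simp
    rw [hexp]
    have : C₂ * τ n * v ^ 2 = τ n * (4 / h₀ * f ^ 2 * C ^ 2 * v ^ 2) +
        τ n * (2 * f * C ^ 2 * v ^ 2) := by rw [hC₂]; ring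
    clear_value C₂ e x
    clear hexp hb1 hb2 hb3
    generalize ⟪x, F x⟫_ℝ = w₁ at *
    generalize ⟪F x, Γ x⟫_ℝ = w₂ at *
    generalize ⟪F x, e⟫_ℝ = w₃ at *
    generalize ⟪e - Γ x, F (e - Γ x)⟫_ℝ = w₄ at *
    rw [this]
    linarith
  obtain ⟨K, hK, hWK⟩ := hW.exists_pos
  refine IsBigO.of_bound √(K / c₀) ?_
  filter_upwards [hWK.bound] with n hn
  rw [Real.norm_eq_abs, Real.norm_eq_abs, abs_of_nonneg (hs0 n)] at hn
  rw [Real.norm_eq_abs, abs_of_nonneg (Real.sqrt_nonneg _), ← Real.sqrt_mul (by positivity)]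
  refine Real.le_sqrt_of_sq_le ?_
  have h1 := (hFpos (R n)).trans ((le_abs_self _).trans hn)
  rw [div_mul_eq_mul_div, le_div_iff₀ hc₀]
  linarith

end Deterministic

/-! ### Parametric integrals -/

section Parametric

variable {X : Type*} [MeasurableSpace X] {μ : Measure X}

theorem integrable_mul_of_sq {w f : X → ℝ} (hw0 : ∀ᵐ x ∂μ, 0 ≤ w x) (hw : Integrable w μ)
    (hfm : AEStronglyMeasurable (fun x => f x * w x) μ)
    (hf : Integrable (fun x => f x ^ 2 * w x) μ) : Integrable (fun x => f x * w x) μ := by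
  refine (hf.add hw).mono' hfm ?_
  filter_upwards [hw0] with x hx
  rw [Real.norm_eq_abs, abs_mul, abs_of_nonneg hx]
  have : |f x| ≤ f x ^ 2 + 1 := by
    rw [← sq_abs]; nlinarith [sq_nonneg (|f x| - 1)]
  calc |f x| * w x ≤ (f x ^ 2 + 1) * w x := by gcongr
    _ = _ := by simp only [Pi.add_apply]; ring

/-- Fatou's lemma needs a nonnegative integrand, so `f` is completed to the square `δ (f + 1 /
(2δ))² = f + δ f² + 1 / (4δ)`. The added constant integrates to the same value for all densities,
and the added `δ f²` costs at most `δ C`, which is below `ε`. -/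
theorem eventually_integral_mul_gt {w f : ℕ → X → ℝ} {w₀ f₀ : X → ℝ} {C : ℝ}
    (hw0 : ∀ n, ∀ᵐ x ∂μ, 0 ≤ w n x) (hwi : ∀ n, Integrable (w n) μ)
    (hw1 : ∀ n, ∫ x, w n x ∂μ = 1)
    (hw0' : ∀ᵐ x ∂μ, 0 ≤ w₀ x) (hwi' : Integrable w₀ μ) (hw1' : ∫ x, w₀ x ∂μ = 1)
    (hfm : ∀ n, AEStronglyMeasurable (fun x => f n x * w n x) μ)
    (hfi : ∀ n, Integrable (fun x => f n x ^ 2 * w n x) μ)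
    (hfC : ∀ n, ∫ x, f n x ^ 2 * w n x ∂μ ≤ C)
    (hfm' : AEStronglyMeasurable (fun x => f₀ x * w₀ x) μ)
    (hfi' : Integrable (fun x => f₀ x ^ 2 * w₀ x) μ)
    (hlim : ∀ᵐ x ∂μ, Tendsto (fun n => w n x) atTop (𝓝 (w₀ x)) ∧
      Tendsto (fun n => f n x * w n x) atTop (𝓝 (f₀ x * w₀ x)) ∧
      Tendsto (fun n => f n x ^ 2 * w n x) atTop (𝓝 (f₀ x ^ 2 * w₀ x))) {ε : ℝ} (hε : 0 < ε) :
    ∀ᶠ n in atTop, ∫ x, f₀ x * w₀ x ∂μ - ε < ∫ x, f n x * w n x ∂μ := by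
  have hC0 : 0 ≤ C := by
    refine le_trans (integral_nonneg_of_ae ?_) (hfC 0)
    filter_upwards [hw0 0] with x hx
    exact mul_nonneg (sq_nonneg _) hx
  -- This makes `δ C < ε`; the remaining gap `ε - δ C` is left for the liminf.
  set δ : ℝ := ε / (2 * (C + 1)) with hδ
  have hδ0 : 0 < δ := by positivity
  have hδC : δ * C < ε := by
    rw [hδ, div_mul_eq_mul_div, div_lt_iff₀ (by positivity)]
    nlinarith
  let G : (X → ℝ) → (X → ℝ) → X → ℝ := fun f w x =>
    f x * w x + δ * (f x ^ 2 * w x) + (4 * δ)⁻¹ * w x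
  have hG0 : ∀ (f w : X → ℝ) x, 0 ≤ w x → 0 ≤ G f w x := fun f w x hx => by
    have : G f w x = δ * (f x + (2 * δ)⁻¹) ^ 2 * w x := by
      simp only [G]; field_simp; ring
    rw [this]; positivity
  have i1 : ∀ n, Integrable (fun x => f n x * w n x) μ := fun n =>
    integrable_mul_of_sq (hw0 n) (hwi n) (hfm n) (hfi n)
  have i0 : Integrable (fun x => f₀ x * w₀ x) μ := integrable_mul_of_sq hw0' hwi' hfm' hfi'
  have iG : ∀ n, Integrable (G (f n) (w n)) μ := fun n =>
    ((i1 n).add ((hfi n).const_mul δ)).add ((hwi n).const_mul _)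
  have iG0 : Integrable (G f₀ w₀) μ := (i0.add (hfi'.const_mul δ)).add (hwi'.const_mul _)
  have vG : ∀ n, ∫ x, G (f n) (w n) x ∂μ =
      ∫ x, f n x * w n x ∂μ + δ * ∫ x, f n x ^ 2 * w n x ∂μ + (4 * δ)⁻¹ := fun n => by
    have e1 := integral_add ((i1 n).add ((hfi n).const_mul δ)) ((hwi n).const_mul (4 * δ)⁻¹)
    have e2 := integral_add (i1 n) ((hfi n).const_mul δ)
    simp only [Pi.add_apply, integral_const_mul, hw1, mul_one] at e1 e2
    rw [e1, e2]
  have vG0 : ∫ x, G f₀ w₀ x ∂μ =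
      ∫ x, f₀ x * w₀ x ∂μ + δ * ∫ x, f₀ x ^ 2 * w₀ x ∂μ + (4 * δ)⁻¹ := by
    have e1 := integral_add (i0.add (hfi'.const_mul δ)) (hwi'.const_mul (4 * δ)⁻¹)
    have e2 := integral_add i0 (hfi'.const_mul δ)
    simp only [Pi.add_apply, integral_const_mul, hw1', mul_one] at e1 e2
    rw [e1, e2]
  have hn0 : 0 ≤ ∫ x, f₀ x ^ 2 * w₀ x ∂μ := by
    refine integral_nonneg_of_ae ?_
    filter_upwards [hw0'] with x hx
    exact mul_nonneg (sq_nonneg _) hx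
  set a : ℝ := ∫ x, G f₀ w₀ x ∂μ with ha
  set b : ℕ → ℝ := fun n => ∫ x, G (f n) (w n) x ∂μ with hb
  have ea : ENNReal.ofReal a = ∫⁻ x, ENNReal.ofReal (G f₀ w₀ x) ∂μ :=
    ofReal_integral_eq_lintegral_ofReal iG0 (by
      filter_upwards [hw0'] with x hx using hG0 _ _ _ hx)
  have eb : ∀ n, ENNReal.ofReal (b n) = ∫⁻ x, ENNReal.ofReal (G (f n) (w n) x) ∂μ := fun n =>
    ofReal_integral_eq_lintegral_ofReal (iG n) (by
      filter_upwards [hw0 n] with x hx using hG0 _ _ _ hx)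
  have hfatou : ENNReal.ofReal a ≤ liminf (fun n => ENNReal.ofReal (b n)) atTop := by
    simp_rw [ea, eb]
    refine le_trans (le_of_eq (lintegral_congr_ae ?_)) (lintegral_liminf_le' fun n =>
      (iG n).aestronglyMeasurable.aemeasurable.ennreal_ofReal)
    filter_upwards [hlim] with x ⟨h1, h2, h3⟩
    refine (Tendsto.liminf_eq ?_).symm
    exact (ENNReal.continuous_ofReal.tendsto _).comp
      ((h2.add (h3.const_mul δ)).add (h1.const_mul _))
  have ha0 : 0 ≤ a := integral_nonneg_of_ae (by
    filter_upwards [hw0'] with x hx using hG0 _ _ _ hx)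
  have hev : ∀ᶠ n in atTop, a - (ε - δ * C) < b n := by
    rcases lt_or_ge (a - (ε - δ * C)) 0 with hneg | hpos
    · refine .of_forall fun n => hneg.trans_le (integral_nonneg_of_ae ?_)
      filter_upwards [hw0 n] with x hx using hG0 _ _ _ hx
    · have hlt : ENNReal.ofReal (a - (ε - δ * C)) < liminf (fun n => ENNReal.ofReal (b n)) atTop :=
        lt_of_lt_of_le ((ENNReal.ofReal_lt_ofReal_iff_of_nonneg hpos).2 (by linarith)) hfatou
      filter_upwards [eventually_lt_of_lt_liminf hlt] with n hn
      exact (ENNReal.ofReal_lt_ofReal_iff_of_nonneg hpos).1 hn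
  filter_upwards [hev] with n hn
  have h1 : b n = _ := vG n
  have h2 : a = _ := vG0
  have h3 : δ * ∫ x, f n x ^ 2 * w n x ∂μ ≤ δ * C := by gcongr; exact hfC n
  have h4 : 0 ≤ δ * ∫ x, f₀ x ^ 2 * w₀ x ∂μ := by positivity
  linarith

/-- Convergence of the expectations of `f n` under the densities `w n`, when the second moments
are bounded. -/
theorem tendsto_integral_mul_of_sq_bounded {w f : ℕ → X → ℝ} {w₀ f₀ : X → ℝ} {C : ℝ}
    (hw0 : ∀ n, ∀ᵐ x ∂μ, 0 ≤ w n x) (hwi : ∀ n, Integrable (w n) μ)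
    (hw1 : ∀ n, ∫ x, w n x ∂μ = 1)
    (hw0' : ∀ᵐ x ∂μ, 0 ≤ w₀ x) (hwi' : Integrable w₀ μ) (hw1' : ∫ x, w₀ x ∂μ = 1)
    (hfm : ∀ n, AEStronglyMeasurable (fun x => f n x * w n x) μ)
    (hfi : ∀ n, Integrable (fun x => f n x ^ 2 * w n x) μ)
    (hfC : ∀ n, ∫ x, f n x ^ 2 * w n x ∂μ ≤ C)
    (hfm' : AEStronglyMeasurable (fun x => f₀ x * w₀ x) μ)
    (hfi' : Integrable (fun x => f₀ x ^ 2 * w₀ x) μ)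
    (hlim : ∀ᵐ x ∂μ, Tendsto (fun n => w n x) atTop (𝓝 (w₀ x)) ∧
      Tendsto (fun n => f n x * w n x) atTop (𝓝 (f₀ x * w₀ x)) ∧
      Tendsto (fun n => f n x ^ 2 * w n x) atTop (𝓝 (f₀ x ^ 2 * w₀ x))) :
    Tendsto (fun n => ∫ x, f n x * w n x ∂μ) atTop (𝓝 (∫ x, f₀ x * w₀ x ∂μ)) := by
  rw [Metric.tendsto_nhds]
  intro ε hε
  have hup := eventually_integral_mul_gt hw0 hwi hw1 hw0' hwi' hw1' hfm hfi hfC hfm' hfi' hlim hε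
  have hlo := eventually_integral_mul_gt (f := fun n x => -f n x) (f₀ := fun x => -f₀ x) (C := C)
    hw0 hwi hw1 hw0' hwi' hw1'
    (fun n => by simp only [neg_mul]; exact (hfm n).neg)
    (by simpa only [neg_sq] using hfi) (by simpa only [neg_sq] using hfC)
    (by simp only [neg_mul]; exact hfm'.neg) (by simpa only [neg_sq] using hfi')
    (by
      filter_upwards [hlim] with x ⟨h1, h2, h3⟩
      refine ⟨h1, ?_, by simpa only [neg_sq] using h3⟩
      simpa only [neg_mul] using h2.neg) hε
  filter_upwards [hup, hlo] with n h1 h2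
  simp only [neg_mul, integral_neg] at h2
  rw [Real.dist_eq, abs_lt]
  constructor <;> linarith

/-- Differentiation under the integral sign, when the integral of the derivative is continuous and
its first moment is bounded. -/
theorem hasDerivAt_integral_of_continuous [SFinite μ] {Φ Φ' : ℝ → X → ℝ} {δ C : ℝ} (hδ : 0 < δ)
    (hΦ : ∀ᵐ x ∂μ, ∀ u ∈ Set.Icc (-δ) δ, HasDerivAt (fun u => Φ u x) (Φ' u x) u)
    (hc : ∀ᵐ x ∂μ, ContinuousOn (fun u => Φ' u x) (Set.Icc (-δ) δ))
    (hi : ∀ u ∈ Set.Icc (-δ) δ, Integrable (Φ u) μ)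
    (hm : Measurable (Function.uncurry Φ'))
    (hi' : ∀ u ∈ Set.Icc (-δ) δ, Integrable (Φ' u) μ)
    (hC : ∀ u ∈ Set.Icc (-δ) δ, ∫ x, |Φ' u x| ∂μ ≤ C)
    (hcont : ContinuousOn (fun u => ∫ x, Φ' u x ∂μ) (Set.Icc (-δ) δ)) :
    HasDerivAt (fun u => ∫ x, Φ u x ∂μ) (∫ x, Φ' 0 x ∂μ) 0 := by
  have h0 : (0 : ℝ) ∈ Set.Icc (-δ) δ := ⟨by linarith, hδ.le⟩
  have hsub : ∀ t ∈ Set.Icc (-δ) δ, Set.uIcc 0 t ⊆ Set.Icc (-δ) δ := fun t ht =>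
    Set.uIcc_subset_Icc h0 ht
  -- The fundamental theorem of calculus holds for each `x`, and Fubini exchanges the two integrals;
  -- the uniform first moment `C` gives integrability on the product. Continuity of the integrated
  -- derivative then allows differentiation in `t`.
  have key : ∀ t ∈ Set.Icc (-δ) δ,
      ∫ x, Φ t x ∂μ = ∫ x, Φ 0 x ∂μ + ∫ u in (0 : ℝ)..t, ∫ x, Φ' u x ∂μ := by
    intro t ht
    have hint : Integrable (Function.uncurry Φ') ((volume.restrict (Set.uIoc 0 t)).prod μ) := by
      rw [integrable_prod_iff hm.aestronglyMeasurable]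
      have hmem : ∀ᵐ u ∂(volume.restrict (Set.uIoc 0 t)), u ∈ Set.Icc (-δ) δ := by
        filter_upwards [ae_restrict_mem measurableSet_uIoc] with u hu
        exact hsub t ht (Set.uIoc_subset_uIcc hu)
      refine ⟨?_, ?_⟩
      · filter_upwards [hmem] with u hu
        exact hi' u hu
      · have : IsFiniteMeasure (volume.restrict (Set.uIoc 0 t)) := by
          rw [Set.uIoc]; infer_instance
        refine Integrable.of_bound (C := C)
          (hm.norm.aestronglyMeasurable.integral_prod_right') ?_
        filter_upwards [hmem] with u hu
        rw [Real.norm_eq_abs, abs_of_nonneg (integral_nonneg fun x => norm_nonneg _)]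
        exact hC u hu
    rw [intervalIntegral_integral_swap hint, ← sub_eq_iff_eq_add',
      ← integral_sub (hi t ht) (hi 0 h0)]
    refine integral_congr_ae ?_
    filter_upwards [hΦ, hc] with x hx hcx
    refine (intervalIntegral.integral_eq_sub_of_hasDerivAt
      (fun u hu => hx u (hsub t ht hu)) ?_).symm
    exact (hcx.mono (hsub t ht)).intervalIntegrable
  have hnhds : Set.Icc (-δ) δ ∈ 𝓝 (0 : ℝ) := Icc_mem_nhds (by linarith) hδ
  have hD : HasDerivAt (fun t => ∫ u in (0 : ℝ)..t, ∫ x, Φ' u x ∂μ) (∫ x, Φ' 0 x ∂μ) 0 := by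
    refine intervalIntegral.integral_hasDerivAt_right (by simp) ?_ (hcont.continuousAt hnhds)
    exact (hcont.mono Set.Ioo_subset_Icc_self).stronglyMeasurableAtFilter isOpen_Ioo 0
      ⟨by linarith, hδ⟩
  refine (hD.const_add (∫ x, Φ 0 x ∂μ)).congr_of_eventuallyEq ?_
  filter_upwards [hnhds] with t ht using key t ht

theorem integrable_norm_rpow_of_lintegral {E : Type*} [NormedAddCommGroup E] [MeasurableSpace E]
    [BorelSpace E] {g : X → E} (hg : Measurable g) {p C : ℝ} (hp : 0 ≤ p)
    (hC : 0 ≤ C) (h : ∫⁻ x, ‖g x‖ₑ ^ p ∂μ ≤ ENNReal.ofReal C) :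
    Integrable (fun x => ‖g x‖ ^ p) μ ∧ ∫ x, ‖g x‖ ^ p ∂μ ≤ C := by
  have e : ∀ x, ENNReal.ofReal (‖g x‖ ^ p) = ‖g x‖ₑ ^ p := fun x => by
    rw [← ENNReal.ofReal_rpow_of_nonneg (norm_nonneg _) hp, ofReal_norm]
  have hm : Measurable fun x => ‖g x‖ ^ p := hg.norm.pow_const p
  have h0 : 0 ≤ᵐ[μ] fun x => ‖g x‖ ^ p := .of_forall fun x => by positivity
  refine ⟨⟨hm.aestronglyMeasurable, ?_⟩, ?_⟩
  · rw [hasFiniteIntegral_iff_ofReal h0]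
    simp_rw [e]
    exact h.trans_lt ENNReal.ofReal_lt_top
  · rw [integral_eq_lintegral_of_nonneg_ae h0 hm.aestronglyMeasurable]
    simp_rw [e]
    exact ENNReal.toReal_le_of_le_ofReal hC h

end Parametric

namespace Problem

variable {d D : ℕ} (V : Problem d D)

/-! ### The score and the gradient samples as jointly measurable functions -/

open Classical in
/-- The score, set to zero outside `M × supp`. -/
def sc (lam : Vec D) (θ : Vec d) : Vec D :=
  if lam ∈ V.M ∧ θ ∈ V.supp then V.score lam θ else 0

/-- The single-sample gradient built from `sc`. -/
def el (θ : Vec d) (lam : Vec D) : Vec D := -(V.h lam θ • V.sc lam θ)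

variable {V} {lam : Vec D} {θ : Vec d}

theorem sc_eq (hl : lam ∈ V.M) (hθ : θ ∈ V.supp) : V.sc lam θ = V.score lam θ := if_pos ⟨hl, hθ⟩

theorem el_eq (hl : lam ∈ V.M) (hθ : θ ∈ V.supp) : V.el θ lam = V.ell θ lam := by
  rw [el, sc_eq hl hθ, ell]

theorem differentiableAt_log_q (hl : lam ∈ V.M) (hθ : θ ∈ V.supp) :
    DifferentiableAt ℝ (fun l => Real.log (V.q l θ)) lam :=
  ((V.contDiffOn_log_q θ hθ).contDiffAt (V.isOpen_M.mem_nhds hl)).differentiableAt (by simp)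

theorem gradient_apply_eq {f : Vec D → ℝ} (x : Vec D) (k : Fin D) :
    gradient f x k = fderiv ℝ f x (EuclideanSpace.single k 1) := by
  have : inner ℝ (gradient f x) (EuclideanSpace.single k (1 : ℝ)) =
      fderiv ℝ f x (EuclideanSpace.single k 1) := by
    rw [gradient, InnerProductSpace.toDual_symm_apply]
  rw [← this, EuclideanSpace.inner_single_right]
  simp

theorem continuousOn_sc (hθ : θ ∈ V.supp) : ContinuousOn (fun l => V.sc l θ) V.M := by
  have h1 : ContinuousOn (fun l => fderiv ℝ (fun l => Real.log (V.q l θ)) l) V.M :=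
    (V.contDiffOn_log_q θ hθ).continuousOn_fderiv_of_isOpen V.isOpen_M le_rfl
  have h2 : ContinuousOn (fun l => V.score l θ) V.M :=
    (InnerProductSpace.toDual ℝ (Vec D)).symm.continuous.comp_continuousOn h1
  exact h2.congr fun l hl => sc_eq hl hθ

/-- On `M × supp` a partial derivative is a limit of difference quotients, each jointly measurable
because `q` is measurable on the whole space, so the shifted point need not lie in `M`. -/
theorem measurable_sc_apply (k : Fin D) :
    Measurable fun p : Vec D × Vec d => V.sc p.1 p.2 k := by
  classical
  set e : Vec D := EuclideanSpace.single k 1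
  set S : Set (Vec D × Vec d) := V.M ×ˢ V.supp with hS
  have hSm : MeasurableSet S := V.isOpen_M.measurableSet.prod V.measurableSet_supp
  set g : ℕ → Vec D × Vec d → ℝ := fun n => S.indicator fun p => ((n : ℝ) + 1) •
    (Real.log (V.q (p.1 + ((n : ℝ) + 1)⁻¹ • e) p.2) - Real.log (V.q p.1 p.2)) with hg
  have hq : ∀ v : Vec D, Measurable fun p : Vec D × Vec d => V.q (p.1 + v) p.2 := fun v =>
    V.measurable_q.comp ((measurable_fst.add_const v).prodMk measurable_snd)
  have hgm : ∀ n, Measurable (g n) := fun n => by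
    refine Measurable.indicator ?_ hSm
    exact ((hq _).log.sub (V.measurable_q.log)).const_smul ((n : ℝ) + 1)
  refine measurable_of_tendsto_metrizable hgm (tendsto_pi_nhds.2 fun p => ?_)
  by_cases hp : p ∈ S
  · have h1 := (differentiableAt_log_q hp.1 hp.2).hasFDerivAt.lim e
      (c := fun n : ℕ => (n : ℝ) + 1) (l := atTop) (by
        refine (tendsto_atTop_add_const_right _ 1 tendsto_natCast_atTop_atTop).congr' ?_
        filter_upwards with n
        rw [Real.norm_eq_abs, abs_of_pos (by positivity)])
    simp only [hg, Set.indicator_of_mem hp, sc_eq hp.1 hp.2]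
    rw [score, gradient_apply_eq]
    exact h1
  · have : V.sc p.1 p.2 = 0 := if_neg hp
    simp only [hg, Set.indicator_of_notMem hp, this]
    exact tendsto_const_nhds

theorem measurable_vec {X : Type*} [MeasurableSpace X] {f : X → Vec D}
    (hf : ∀ k, Measurable fun x => f x k) : Measurable f :=
  (MeasurableEquiv.toLp 2 (Fin D → ℝ)).measurable.comp (measurable_pi_iff.2 hf)

theorem measurable_vec_apply {X : Type*} [MeasurableSpace X] {f : X → Vec D}
    (hf : Measurable f) (k : Fin D) : Measurable fun x => f x k :=
  (EuclideanSpace.proj (𝕜 := ℝ) k).continuous.measurable.comp hf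

variable (V) in
theorem measurable_sc : Measurable fun p : Vec D × Vec d => V.sc p.1 p.2 :=
  measurable_vec fun k => measurable_sc_apply k

variable (V) in
theorem measurable_h : Measurable fun p : Vec D × Vec d => V.h p.1 p.2 :=
  ((V.measurable_prior.log.comp measurable_snd).add (V.measurable_lik.log.comp measurable_snd)).sub
    V.measurable_q.log

variable (V) in
theorem measurable_el : Measurable fun p : Vec D × Vec d => V.el p.2 p.1 :=
  (V.measurable_h.smul V.measurable_sc).neg

/-! ### Expectations under `q_lam` -/

theorem q_nonneg (hl : lam ∈ V.M) (θ : Vec d) : 0 ≤ V.q lam θ := by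
  by_cases hθ : θ ∈ V.supp
  · exact (V.q_pos lam hl θ hθ).le
  · exact (V.q_eq_zero lam hl θ hθ).ge

theorem measurable_q_right (lam : Vec D) : Measurable (V.q lam) :=
  V.measurable_q.comp measurable_prodMk_left

theorem isProbabilityMeasure_law (hl : lam ∈ V.M) : IsProbabilityMeasure (V.law lam) :=
  ⟨by rw [law, withDensity_apply _ MeasurableSet.univ, setLIntegral_univ, V.lintegral_q lam hl]⟩

theorem integral_law (hl : lam ∈ V.M) (f : Vec d → ℝ) :
    ∫ θ, f θ ∂(V.law lam) = ∫ θ, f θ * V.q lam θ := by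
  rw [law, integral_withDensity_eq_integral_toReal_smul
    (measurable_q_right lam).ennreal_ofReal (.of_forall fun _ => ENNReal.ofReal_lt_top)]
  refine integral_congr_ae (.of_forall fun θ => ?_)
  simp only [ENNReal.toReal_ofReal (q_nonneg hl θ), smul_eq_mul, mul_comm]

theorem integrable_law (hl : lam ∈ V.M) {f : Vec d → ℝ} :
    Integrable f (V.law lam) ↔ Integrable (fun θ => f θ * V.q lam θ) := by
  rw [law, integrable_withDensity_iff (measurable_q_right lam).ennreal_ofReal
    (.of_forall fun _ => ENNReal.ofReal_lt_top)]
  simp only [ENNReal.toReal_ofReal (q_nonneg hl _)]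

theorem ae_mem_supp (hl : lam ∈ V.M) : ∀ᵐ θ ∂(V.law lam), θ ∈ V.supp := by
  rw [law, ae_withDensity_iff (measurable_q_right lam).ennreal_ofReal]
  refine .of_forall fun θ hθ => ?_
  by_contra h
  exact hθ (by rw [V.q_eq_zero lam hl θ h, ENNReal.ofReal_zero])

theorem integrable_q (hl : lam ∈ V.M) : Integrable (V.q lam) := by
  have := isProbabilityMeasure_law hl
  have := (integrable_law hl (f := fun _ => 1)).1 (integrable_const _)
  simpa using this

theorem integral_q (hl : lam ∈ V.M) : ∫ θ, V.q lam θ = 1 := by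
  have := isProbabilityMeasure_law hl
  have := integral_law hl (fun _ => 1)
  simpa using this.symm

theorem continuousOn_q (hθ : θ ∈ V.supp) : ContinuousOn (fun l => V.q l θ) V.M := by
  have h1 : ContinuousOn (fun l => Real.exp (Real.log (V.q l θ))) V.M :=
    (V.contDiffOn_log_q θ hθ).continuousOn.rexp
  exact h1.congr fun l hl => (Real.exp_log (V.q_pos l hl θ hθ)).symm

/-- Both integrand and density vary with the parameter. Pointwise they converge on the common
support, and bounded second moments replace a dominating function, via
`tendsto_integral_mul_of_sq_bounded` along sequences. -/
theorem continuousOn_integral_law {U : Set (Vec D)} (hU : U ⊆ V.M) {f : Vec D → Vec d → ℝ} {C : ℝ}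
    (hfm : ∀ l ∈ U, Measurable (f l)) (hfc : ∀ θ ∈ V.supp, ContinuousOn (fun l => f l θ) U)
    (hfi : ∀ l ∈ U, Integrable (fun θ => f l θ ^ 2) (V.law l))
    (hfC : ∀ l ∈ U, ∫ θ, f l θ ^ 2 ∂(V.law l) ≤ C) :
    ContinuousOn (fun l => ∫ θ, f l θ ∂(V.law l)) U := by
  intro l₀ hl₀
  refine tendsto_of_seq_tendsto fun x hx => ?_
  obtain ⟨hx1, hx2⟩ := tendsto_nhdsWithin_iff.1 hx
  obtain ⟨N, hN⟩ := eventually_atTop.1 hx2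
  -- The shift makes every term of the sequence lie in `U`, where the moment bounds hold.
  rw [← tendsto_add_atTop_iff_nat N]
  have hxU : ∀ n, x (n + N) ∈ U := fun n => hN _ (by omega)
  have hx' : Tendsto (fun n => x (n + N)) atTop (𝓝[U] l₀) := hx.comp (tendsto_add_atTop_nat N)
  simp_rw [Function.comp_def]
  have e : ∀ n, ∫ θ, f (x (n + N)) θ ∂(V.law (x (n + N))) =
      ∫ θ, f (x (n + N)) θ * V.q (x (n + N)) θ := fun n => integral_law (hU (hxU n)) _
  simp_rw [e]
  rw [integral_law (hU hl₀)]
  refine tendsto_integral_mul_of_sq_bounded (C := C)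
    (fun n => .of_forall fun θ => q_nonneg (hU (hxU n)) θ) (fun n => integrable_q (hU (hxU n)))
    (fun n => integral_q (hU (hxU n))) (.of_forall fun θ => q_nonneg (hU hl₀) θ)
    (integrable_q (hU hl₀)) (integral_q (hU hl₀))
    (fun n => ((hfm _ (hxU n)).mul (measurable_q_right _)).aestronglyMeasurable)
    (fun n => (integrable_law (hU (hxU n))).1 (hfi _ (hxU n)))
    (fun n => (integral_law (hU (hxU n)) _).symm.trans_le (hfC _ (hxU n)))
    ((hfm _ hl₀).mul (measurable_q_right _)).aestronglyMeasurable
    ((integrable_law (hU hl₀)).1 (hfi _ hl₀)) (.of_forall fun θ => ?_)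
  by_cases hθ : θ ∈ V.supp
  · have h1 : Tendsto (fun n => V.q (x (n + N)) θ) atTop (𝓝 (V.q l₀ θ)) :=
      (((continuousOn_q hθ).mono hU) l₀ hl₀).tendsto.comp hx'
    have h2 : Tendsto (fun n => f (x (n + N)) θ) atTop (𝓝 (f l₀ θ)) :=
      ((hfc θ hθ) l₀ hl₀).tendsto.comp hx'
    exact ⟨h1, h2.mul h1, (h2.pow 2).mul h1⟩
  · have h1 : ∀ n, V.q (x (n + N)) θ = 0 := fun n => V.q_eq_zero _ (hU (hxU n)) θ hθ
    simp [h1, V.q_eq_zero _ (hU hl₀) θ hθ]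

/-! ### The gradient of the loss is the expectation of `ℓ` -/

theorem hasDerivAt_log_q_line {v : Vec D} {u : ℝ} (k : Fin D)
    (hl : v + u • EuclideanSpace.single k (1 : ℝ) ∈ V.M) (hθ : θ ∈ V.supp) :
    HasDerivAt (fun u : ℝ => Real.log (V.q (v + u • EuclideanSpace.single k (1 : ℝ)) θ))
      (V.sc (v + u • EuclideanSpace.single k (1 : ℝ)) θ k) u := by
  have h1 := (differentiableAt_log_q hl hθ).hasFDerivAt
  have h2 : HasDerivAt (fun u : ℝ => v + u • EuclideanSpace.single k (1 : ℝ))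
      (EuclideanSpace.single k (1 : ℝ)) u := by
    simpa using ((hasDerivAt_id u).smul_const (EuclideanSpace.single k (1 : ℝ))).const_add v
  have h3 := h1.comp_hasDerivAt u h2
  rw [sc_eq hl hθ, score, gradient_apply_eq]
  exact h3

theorem hasDerivAt_q_line {v : Vec D} {u : ℝ} (k : Fin D)
    (hl : v + u • EuclideanSpace.single k (1 : ℝ) ∈ V.M) (hθ : θ ∈ V.supp) :
    HasDerivAt (fun u : ℝ => V.q (v + u • EuclideanSpace.single k (1 : ℝ)) θ)
      (V.sc (v + u • EuclideanSpace.single k (1 : ℝ)) θ k *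
        V.q (v + u • EuclideanSpace.single k (1 : ℝ)) θ) u := by
  have h1 := (hasDerivAt_log_q_line k hl hθ).exp
  rw [Real.exp_log (V.q_pos _ hl θ hθ), mul_comm] at h1
  refine h1.congr_of_eventuallyEq ?_
  have h2 : ContinuousAt (fun u : ℝ => v + u • EuclideanSpace.single k (1 : ℝ)) u := by fun_prop
  filter_upwards [h2.preimage_mem_nhds (V.isOpen_M.mem_nhds hl)] with u' hu'
  exact (Real.exp_log (V.q_pos _ hu' θ hθ)).symm

/-- `U` is an open set on which the samples have uniformly bounded moments. -/
structure IsGood (V : Problem d D) (p C : ℝ) (U : Set (Vec D)) : Prop where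
  isOpen : IsOpen U
  subset : U ⊆ V.M
  two_le : 2 ≤ p
  one_le : 1 ≤ C
  integrable_el : ∀ l ∈ U, Integrable (fun θ => ‖V.el θ l‖ ^ p) (V.law l)
  integral_el : ∀ l ∈ U, ∫ θ, ‖V.el θ l‖ ^ p ∂(V.law l) ≤ C
  integrable_sc : ∀ l ∈ U, Integrable (fun θ => ‖V.sc l θ‖ ^ 4) (V.law l)
  integral_sc : ∀ l ∈ U, ∫ θ, ‖V.sc l θ‖ ^ 4 ∂(V.law l) ≤ C

/-- Pointwise `y² ≤ 1 + y ^ p` for `y ≥ 0` and `p ≥ 2`, which avoids Hölder's inequality. -/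
theorem sq_moment_of_moment {X : Type*} [MeasurableSpace X] {μ : Measure X}
    [IsProbabilityMeasure μ] {g : X → Vec D} (hg : Measurable g) {p C : ℝ} (hp : 2 ≤ p)
    (hi : Integrable (fun x => ‖g x‖ ^ p) μ) (hC : ∫ x, ‖g x‖ ^ p ∂μ ≤ C) (k : Fin D) :
    Integrable (fun x => g x k ^ 2) μ ∧ ∫ x, g x k ^ 2 ∂μ ≤ 1 + C := by
  have hle : ∀ x, g x k ^ 2 ≤ 1 + ‖g x‖ ^ p := fun x => by
    have h1 : |g x k| ≤ ‖g x‖ := by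
      simpa using EuclideanSpace.norm_eq (g x) ▸ PiLp.norm_apply_le (g x) k
    have h2 : g x k ^ 2 ≤ ‖g x‖ ^ 2 := by rw [← sq_abs]; gcongr
    rcases le_total ‖g x‖ 1 with h | h
    · have : ‖g x‖ ^ 2 ≤ 1 := pow_le_one₀ (norm_nonneg _) h
      have : 0 ≤ ‖g x‖ ^ p := by positivity
      linarith
    · have : ‖g x‖ ^ (2 : ℝ) ≤ ‖g x‖ ^ p := Real.rpow_le_rpow_of_exponent_le h hp
      rw [Real.rpow_two] at this
      linarith
  have i : Integrable (fun x => g x k ^ 2) μ := by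
    refine ((integrable_const 1).add hi).mono'
      ((measurable_vec_apply hg k).pow_const 2).aestronglyMeasurable (.of_forall fun x => ?_)
    rw [Real.norm_eq_abs, abs_of_nonneg (sq_nonneg _)]
    exact hle x
  refine ⟨i, (integral_mono i ((integrable_const 1).add hi) hle).trans ?_⟩
  have := integral_add (integrable_const (1 : ℝ)) hi
  simp only [Pi.add_apply, integral_const, probReal_univ, smul_eq_mul, one_mul] at this ⊢
  rw [this]
  linarith

end Problem

namespace Problem

variable {d D : ℕ} {V : Problem d D} {lam : Vec D} {θ : Vec d}

theorem abs_apply_le_norm (x : Vec D) (k : Fin D) : |x k| ≤ ‖x‖ := PiLp.norm_apply_le x k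

theorem measurable_sc_right (lam : Vec D) : Measurable (V.sc lam) :=
  V.measurable_sc.comp measurable_prodMk_left

theorem measurable_el_right (lam : Vec D) : Measurable fun θ => V.el θ lam :=
  have hm : Measurable (Prod.mk lam : Vec d → Vec D × Vec d) := measurable_prodMk_left
  ((V.measurable_h.comp hm).smul (measurable_sc_right lam)).neg

theorem continuousOn_h (hθ : θ ∈ V.supp) : ContinuousOn (fun l => V.h l θ) V.M :=
  continuousOn_const.sub (V.contDiffOn_log_q θ hθ).continuousOn

theorem continuousOn_el (hθ : θ ∈ V.supp) : ContinuousOn (fun l => V.el θ l) V.M :=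
  ((continuousOn_h hθ).smul (continuousOn_sc hθ)).neg

theorem continuousOn_apply {f : Vec D → Vec D} {U : Set (Vec D)} (hf : ContinuousOn f U)
    (k : Fin D) : ContinuousOn (fun l => f l k) U :=
  (EuclideanSpace.proj (𝕜 := ℝ) k).continuous.comp_continuousOn hf

/-! ### Moments, continuity and differentiation on a good set -/

namespace IsGood

variable {p C : ℝ} {U : Set (Vec D)}

theorem sq_el (hU : V.IsGood p C U) (hl : lam ∈ U) (k : Fin D) :
    Integrable (fun θ => V.el θ lam k ^ 2) (V.law lam) ∧
      ∫ θ, V.el θ lam k ^ 2 ∂(V.law lam) ≤ 1 + C := by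
  have := isProbabilityMeasure_law (hU.subset hl)
  exact sq_moment_of_moment (measurable_el_right lam) hU.two_le (hU.integrable_el lam hl)
    (hU.integral_el lam hl) k

theorem sq_sc (hU : V.IsGood p C U) (hl : lam ∈ U) (k : Fin D) :
    Integrable (fun θ => V.sc lam θ k ^ 2) (V.law lam) ∧
      ∫ θ, V.sc lam θ k ^ 2 ∂(V.law lam) ≤ 1 + C := by
  have := isProbabilityMeasure_law (hU.subset hl)
  refine sq_moment_of_moment (p := (4 : ℕ)) (measurable_sc_right lam) (by norm_num) ?_ ?_ k
  · simpa only [Real.rpow_natCast] using hU.integrable_sc lam hl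
  · simpa only [Real.rpow_natCast] using hU.integral_sc lam hl

/-- This is where fourth moments of the score enter: the entries of its outer product must be square
integrable, both for the continuity of the Fisher matrix and for the strong law. -/
theorem sq_sc_mul_sc (hU : V.IsGood p C U) (hl : lam ∈ U) (i j : Fin D) :
    Integrable (fun θ => (V.sc lam θ i * V.sc lam θ j) ^ 2) (V.law lam) ∧
      ∫ θ, (V.sc lam θ i * V.sc lam θ j) ^ 2 ∂(V.law lam) ≤ C := by
  have hle : ∀ θ, (V.sc lam θ i * V.sc lam θ j) ^ 2 ≤ ‖V.sc lam θ‖ ^ 4 := fun θ => by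
    calc (V.sc lam θ i * V.sc lam θ j) ^ 2 = |V.sc lam θ i| ^ 2 * |V.sc lam θ j| ^ 2 := by
          rw [mul_pow, sq_abs, sq_abs]
      _ ≤ ‖V.sc lam θ‖ ^ 2 * ‖V.sc lam θ‖ ^ 2 := by
          gcongr <;> exact abs_apply_le_norm _ _
      _ = _ := by ring
  have i0 : Integrable (fun θ => (V.sc lam θ i * V.sc lam θ j) ^ 2) (V.law lam) := by
    refine (hU.integrable_sc lam hl).mono' ?_ (.of_forall fun θ => ?_)
    · exact (((measurable_vec_apply (measurable_sc_right lam) i).mul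
        (measurable_vec_apply (measurable_sc_right lam) j)).pow_const 2).aestronglyMeasurable
    · rw [Real.norm_eq_abs, abs_of_nonneg (sq_nonneg _)]
      exact hle θ
  exact ⟨i0, (integral_mono i0 (hU.integrable_sc lam hl) hle).trans (hU.integral_sc lam hl)⟩

theorem integrable_of_sq {X : Type*} [MeasurableSpace X] {μ : Measure X} [IsProbabilityMeasure μ]
    {g : X → ℝ} (hg : Measurable g) (hi : Integrable (fun x => g x ^ 2) μ) : Integrable g μ :=
  ((memLp_two_iff_integrable_sq hg.aestronglyMeasurable).2 hi).integrable (by norm_num)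

theorem integral_abs_le_of_sq {X : Type*} [MeasurableSpace X] {μ : Measure X}
    [IsProbabilityMeasure μ] {g : X → ℝ} (hg : Measurable g)
    (hi : Integrable (fun x => g x ^ 2) μ) : ∫ x, |g x| ∂μ ≤ 1 + ∫ x, g x ^ 2 ∂μ := by
  have h := integral_mono (integrable_of_sq hg hi).abs ((integrable_const (1 : ℝ)).add hi)
    (fun x => show |g x| ≤ 1 + g x ^ 2 by rw [← sq_abs]; nlinarith [sq_nonneg (|g x| - 1)])
  have := integral_add (integrable_const (1 : ℝ)) hi
  simp only [Pi.add_apply, integral_const, probReal_univ, smul_eq_mul, one_mul] at this h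
  rwa [this] at h

theorem integrable_el_apply (hU : V.IsGood p C U) (hl : lam ∈ U) (k : Fin D) :
    Integrable (fun θ => V.el θ lam k) (V.law lam) := by
  have := isProbabilityMeasure_law (hU.subset hl)
  exact integrable_of_sq (measurable_vec_apply (measurable_el_right lam) k) (hU.sq_el hl k).1

theorem integrable_sc_apply (hU : V.IsGood p C U) (hl : lam ∈ U) (k : Fin D) :
    Integrable (fun θ => V.sc lam θ k) (V.law lam) := by
  have := isProbabilityMeasure_law (hU.subset hl)
  exact integrable_of_sq (measurable_vec_apply (measurable_sc_right lam) k) (hU.sq_sc hl k).1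

theorem continuousOn_integral_el (hU : V.IsGood p C U) (k : Fin D) :
    ContinuousOn (fun l => ∫ θ, V.el θ l k ∂(V.law l)) U :=
  continuousOn_integral_law hU.subset
    (fun l _ => measurable_vec_apply (measurable_el_right l) k)
    (fun _ hθ => continuousOn_apply ((continuousOn_el hθ).mono hU.subset) k)
    (fun _ hl => (hU.sq_el hl k).1) (fun _ hl => (hU.sq_el hl k).2)

theorem continuousOn_integral_sc (hU : V.IsGood p C U) (k : Fin D) :
    ContinuousOn (fun l => ∫ θ, V.sc l θ k ∂(V.law l)) U :=
  continuousOn_integral_law hU.subset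
    (fun l _ => measurable_vec_apply (measurable_sc_right l) k)
    (fun _ hθ => continuousOn_apply ((continuousOn_sc hθ).mono hU.subset) k)
    (fun _ hl => (hU.sq_sc hl k).1) (fun _ hl => (hU.sq_sc hl k).2)

theorem continuousOn_integral_sc_mul_sc (hU : V.IsGood p C U) (i j : Fin D) :
    ContinuousOn (fun l => ∫ θ, V.sc l θ i * V.sc l θ j ∂(V.law l)) U :=
  continuousOn_integral_law hU.subset
    (fun l _ => (measurable_vec_apply (measurable_sc_right l) i).mul
      (measurable_vec_apply (measurable_sc_right l) j))
    (fun _ hθ => (continuousOn_apply ((continuousOn_sc hθ).mono hU.subset) i).mul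
      (continuousOn_apply ((continuousOn_sc hθ).mono hU.subset) j))
    (fun _ hl => (hU.sq_sc_mul_sc hl i j).1) (fun _ hl => (hU.sq_sc_mul_sc hl i j).2)

/-- Differentiation of `∫ g_lam q_lam` in the direction of the `k`-th basis vector. -/
theorem hasDerivAt_integral_line (hU : V.IsGood p C U) (hl : lam ∈ U) (k : Fin D)
    {Φ : Vec D → Vec d → ℝ} {ψ : Vec D → Vec d → ℝ}
    (hΦs : ∀ l ∈ U, ∀ θ ∉ V.supp, Φ l θ = 0)
    (hΦ : ∀ θ ∈ V.supp, ∀ u : ℝ, lam + u • EuclideanSpace.single k (1 : ℝ) ∈ U →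
      HasDerivAt (fun u : ℝ => Φ (lam + u • EuclideanSpace.single k (1 : ℝ)) θ)
        (ψ (lam + u • EuclideanSpace.single k (1 : ℝ)) θ *
          V.q (lam + u • EuclideanSpace.single k (1 : ℝ)) θ) u)
    (hΦi : ∀ l ∈ U, Integrable (Φ l))
    (hψm : Measurable fun p : Vec D × Vec d => ψ p.1 p.2)
    (hψc : ∀ θ ∈ V.supp, ContinuousOn (fun l => ψ l θ) U)
    (hψi : ∀ l ∈ U, Integrable (ψ l) (V.law l)) {C' : ℝ}
    (hψC : ∀ l ∈ U, ∫ θ, |ψ l θ| ∂(V.law l) ≤ C')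
    (hcont : ContinuousOn (fun l => ∫ θ, ψ l θ ∂(V.law l)) U) :
    HasDerivAt (fun u : ℝ => ∫ θ, Φ (lam + u • EuclideanSpace.single k (1 : ℝ)) θ)
      (∫ θ, ψ lam θ ∂(V.law lam)) 0 := by
  set e : Vec D := EuclideanSpace.single k (1 : ℝ) with he
  have hline : Continuous fun u : ℝ => lam + u • e := by fun_prop
  have h0 : (fun u : ℝ => lam + u • e) ⁻¹' U ∈ 𝓝 (0 : ℝ) :=
    hline.continuousAt.preimage_mem_nhds (hU.isOpen.mem_nhds (by simpa using hl))
  obtain ⟨ε, hε, hball⟩ := Metric.mem_nhds_iff.1 h0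
  -- Half the radius, so that a closed interval fits into the open ball.
  have hδU : ∀ u ∈ Set.Icc (-(ε / 2)) (ε / 2), lam + u • e ∈ U := fun u hu => by
    refine hball ?_
    rw [Metric.mem_ball, Real.dist_eq, sub_zero, abs_lt]
    constructor <;> linarith [hu.1, hu.2]
  have key := hasDerivAt_integral_of_continuous (μ := (volume : Measure (Vec d))) (C := C')
    (Φ := fun u θ => Φ (lam + u • e) θ) (Φ' := fun u θ => ψ (lam + u • e) θ * V.q (lam + u • e) θ)
    (half_pos hε) ?_ ?_ (fun u hu => hΦi _ (hδU u hu)) ?_ ?_ ?_ ?_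
  · simp only [zero_smul, add_zero] at key
    rwa [integral_law (hU.subset hl)]
  · refine .of_forall fun θ u hu => ?_
    by_cases hθ : θ ∈ V.supp
    · exact hΦ θ hθ u (hδU u hu)
    · simp only [V.q_eq_zero _ (hU.subset (hδU u hu)) θ hθ, mul_zero]
      refine (hasDerivAt_const u (0 : ℝ)).congr_of_eventuallyEq ?_
      filter_upwards [hline.continuousAt.preimage_mem_nhds (hU.isOpen.mem_nhds (hδU u hu))]
        with u' hu' using hΦs _ hu' θ hθ
  · refine .of_forall fun θ => ?_
    by_cases hθ : θ ∈ V.supp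
    · exact ((hψc θ hθ).mul ((continuousOn_q hθ).mono hU.subset)).comp hline.continuousOn hδU
    · refine continuousOn_const (c := (0 : ℝ)) |>.congr fun u hu => ?_
      simp [V.q_eq_zero _ (hU.subset (hδU u hu)) θ hθ]
  · have hm : Measurable fun p : ℝ × Vec d => (lam + p.1 • e, p.2) :=
      (hline.measurable.comp measurable_fst).prodMk measurable_snd
    exact (hψm.comp hm).mul (V.measurable_q.comp hm)
  · exact fun u hu => (integrable_law (hU.subset (hδU u hu))).1 (hψi _ (hδU u hu))
  · intro u hu
    refine le_of_eq_of_le ?_ (hψC _ (hδU u hu))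
    rw [integral_law (hU.subset (hδU u hu))]
    refine integral_congr_ae (.of_forall fun θ => ?_)
    simp only [abs_mul, abs_of_nonneg (q_nonneg (hU.subset (hδU u hu)) θ)]
  · refine (hcont.comp hline.continuousOn hδU).congr fun u hu => ?_
    simp only [Function.comp]
    rw [integral_law (hU.subset (hδU u hu))]

/-- The score has mean zero. -/
theorem integral_sc_eq_zero (hU : V.IsGood p C U) (hl : lam ∈ U) (k : Fin D) :
    ∫ θ, V.sc lam θ k ∂(V.law lam) = 0 := by
  have h1 := hU.hasDerivAt_integral_line hl k (Φ := V.q) (ψ := fun l θ => V.sc l θ k)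
    (C' := 1 + (1 + C)) (fun l h θ hθ => V.q_eq_zero l (hU.subset h) θ hθ)
    (fun θ hθ u hu => hasDerivAt_q_line k (hU.subset hu) hθ)
    (fun l h => integrable_q (hU.subset h)) (measurable_sc_apply k)
    (fun θ hθ => continuousOn_apply ((continuousOn_sc hθ).mono hU.subset) k)
    (fun l h => hU.integrable_sc_apply h k) (fun l h => by
      have := isProbabilityMeasure_law (hU.subset h)
      exact (integral_abs_le_of_sq (measurable_vec_apply (measurable_sc_right l) k)
        (hU.sq_sc h k).1).trans (by linarith [(hU.sq_sc h k).2]))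
    (hU.continuousOn_integral_sc k)
  have hline : Continuous fun u : ℝ => lam + u • EuclideanSpace.single k (1 : ℝ) := by fun_prop
  -- The same integral is constantly 1 near the point, by normalization of the densities.
  have h2 : HasDerivAt
      (fun u : ℝ => ∫ θ, V.q (lam + u • EuclideanSpace.single k (1 : ℝ)) θ) 0 0 := by
    refine (hasDerivAt_const (0 : ℝ) (1 : ℝ)).congr_of_eventuallyEq ?_
    have h0 : (fun u : ℝ => lam + u • EuclideanSpace.single k (1 : ℝ)) ⁻¹' U ∈ 𝓝 (0 : ℝ) :=
      hline.continuousAt.preimage_mem_nhds (hU.isOpen.mem_nhds (by simpa using hl))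
    filter_upwards [h0] with u hu using integral_q (hU.subset hu)
  exact h1.unique h2

/-- The expectation of `ℓ` is the gradient of the loss. -/
theorem integral_el_eq (hU : V.IsGood p C U) (hl : lam ∈ U) (hd : DifferentiableAt ℝ V.loss lam)
    (k : Fin D) :
    ∫ θ, V.el θ lam k ∂(V.law lam) = fderiv ℝ V.loss lam (EuclideanSpace.single k 1) := by
  have hline : Continuous fun u : ℝ => lam + u • EuclideanSpace.single k (1 : ℝ) := by fun_prop
  have hint : ∀ l ∈ U, Integrable (fun θ => V.el θ l k + V.sc l θ k) (V.law l) := fun l h =>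
    (hU.integrable_el_apply h k).add (hU.integrable_sc_apply h k)
  -- In `-h q` the parameter occurs twice: differentiating `q` gives `el`, and differentiating `-log
  -- q` inside `h` gives the score, which integrates to zero.
  have h1 := hU.hasDerivAt_integral_line hl k (Φ := fun l θ => -(V.h l θ * V.q l θ))
    (ψ := fun l θ => V.el θ l k + V.sc l θ k) (C' := (1 + (1 + C)) + (1 + (1 + C)))
    (fun l h θ hθ => by rw [V.q_eq_zero l (hU.subset h) θ hθ, mul_zero, neg_zero])
    (fun θ hθ u hu => by
      have e1 := hasDerivAt_q_line k (hU.subset hu) hθ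
      have e2 := (hasDerivAt_log_q_line k (hU.subset hu) hθ).const_sub
        (Real.log (V.prior θ) + Real.log (V.lik θ))
      refine (e2.mul e1).neg.congr_deriv ?_
      simp only [el, h, PiLp.neg_apply, PiLp.smul_apply, smul_eq_mul]
      ring)
    (fun l h => ((integrable_law (hU.subset h)).1 (V.integrable_h l (hU.subset h))).neg)
    ((measurable_vec_apply V.measurable_el k).add (measurable_sc_apply k))
    (fun θ hθ => (continuousOn_apply ((continuousOn_el hθ).mono hU.subset) k).add
      (continuousOn_apply ((continuousOn_sc hθ).mono hU.subset) k))
    hint (fun l h => by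
      have := isProbabilityMeasure_law (hU.subset h)
      have a1 := integral_abs_le_of_sq (measurable_vec_apply (measurable_el_right l) k)
        (hU.sq_el h k).1
      have a2 := integral_abs_le_of_sq (measurable_vec_apply (measurable_sc_right l) k)
        (hU.sq_sc h k).1
      have i1 := (hU.integrable_el_apply h k).abs
      have i2 := (hU.integrable_sc_apply h k).abs
      have a3 := integral_mono (hint l h).abs (i1.add i2) (fun θ => abs_add_le _ _)
      have a4 := integral_add i1 i2
      simp only [Pi.add_apply] at a3 a4
      linarith [(hU.sq_el h k).2, (hU.sq_sc h k).2])
    (((hU.continuousOn_integral_el k).add (hU.continuousOn_integral_sc k)).congr fun l h =>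
      integral_add (hU.integrable_el_apply h k) (hU.integrable_sc_apply h k))
  rw [integral_add (hU.integrable_el_apply hl k) (hU.integrable_sc_apply hl k),
    hU.integral_sc_eq_zero hl k, add_zero] at h1
  have h2 : HasDerivAt (fun u : ℝ => V.loss (lam + u • EuclideanSpace.single k (1 : ℝ)))
      (fderiv ℝ V.loss lam (EuclideanSpace.single k 1)) 0 := by
    have e1 : HasFDerivAt V.loss (fderiv ℝ V.loss lam)
        (lam + (0 : ℝ) • EuclideanSpace.single k (1 : ℝ)) := by simpa using hd.hasFDerivAt
    have e2 : HasDerivAt (fun u : ℝ => lam + u • EuclideanSpace.single k (1 : ℝ))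
        (EuclideanSpace.single k (1 : ℝ)) 0 := by
      simpa using ((hasDerivAt_id (0 : ℝ)).smul_const
        (EuclideanSpace.single k (1 : ℝ))).const_add lam
    exact e1.comp_hasDerivAt 0 e2
  refine h1.unique (h2.congr_of_eventuallyEq ?_)
  have h0 : (fun u : ℝ => lam + u • EuclideanSpace.single k (1 : ℝ)) ⁻¹' U ∈ 𝓝 (0 : ℝ) :=
    hline.continuousAt.preimage_mem_nhds (hU.isOpen.mem_nhds (by simpa using hl))
  filter_upwards [h0] with u hu
  rw [loss, LB, integral_law (hU.subset hu), integral_neg]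

/-- The truncation of the samples at level `b` introduces a bias of order `b ^ (1 - p)`. -/
theorem abs_integral_trunc_sub_le (hU : V.IsGood p C U) (hl : lam ∈ U) (k : Fin D) {b : ℝ}
    (hb : 0 < b) :
    |∫ θ, (if ‖V.el θ lam‖ ≤ b then V.el θ lam k else 0) ∂(V.law lam) -
      ∫ θ, V.el θ lam k ∂(V.law lam)| ≤ C * b ^ (1 - p) := by
  classical
  have := isProbabilityMeasure_law (hU.subset hl)
  have hm := measurable_vec_apply (V.measurable_el.comp (measurable_prodMk_left (x := lam))) k
  have hs : MeasurableSet {θ | ‖V.el θ lam‖ ≤ b} :=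
    measurableSet_le (measurable_el_right lam).norm measurable_const
  have i1 := hU.integrable_el_apply hl k
  have i2 : Integrable (fun θ => if ‖V.el θ lam‖ ≤ b then V.el θ lam k else 0) (V.law lam) := by
    refine i1.mono (Measurable.ite hs hm measurable_const).aestronglyMeasurable
      (.of_forall fun θ => ?_)
    split_ifs
    · exact le_rfl
    · simp
  rw [← integral_sub i2 i1]
  have hp := hU.two_le
  -- Only the tail contributes, and where `‖el‖ > b` one has `‖el‖ ≤ ‖el‖ ^ p * b ^ (1 - p)`.
  have hpt : ∀ θ, |(if ‖V.el θ lam‖ ≤ b then V.el θ lam k else 0) - V.el θ lam k| ≤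
      ‖V.el θ lam‖ ^ p * b ^ (1 - p) := fun θ => by
    split_ifs with h
    · simp only [sub_self, abs_zero]; positivity
    · rw [zero_sub, abs_neg]
      push Not at h
      have h0 : 0 < ‖V.el θ lam‖ := hb.trans h
      have h1 : ‖V.el θ lam‖ ^ (1 - p) ≤ b ^ (1 - p) :=
        Real.rpow_le_rpow_of_nonpos hb h.le (by linarith)
      calc |V.el θ lam k| ≤ ‖V.el θ lam‖ := abs_apply_le_norm _ _
        _ = ‖V.el θ lam‖ ^ p * ‖V.el θ lam‖ ^ (1 - p) := by
          rw [← Real.rpow_add h0, add_sub_cancel, Real.rpow_one]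
        _ ≤ _ := by gcongr
  calc _ ≤ ∫ θ, |(if ‖V.el θ lam‖ ≤ b then V.el θ lam k else 0) - V.el θ lam k| ∂(V.law lam) :=
        abs_integral_le_integral_abs
    _ ≤ ∫ θ, ‖V.el θ lam‖ ^ p * b ^ (1 - p) ∂(V.law lam) :=
        integral_mono (i2.sub i1).abs ((hU.integrable_el lam hl).mul_const _) hpt
    _ = (∫ θ, ‖V.el θ lam‖ ^ p ∂(V.law lam)) * b ^ (1 - p) := integral_mul_const _ _
    _ ≤ C * b ^ (1 - p) := by gcongr; exact hU.integral_el lam hl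

/-- Markov's inequality for the moment of order `p`. -/
theorem measure_norm_el_gt_le (hU : V.IsGood p C U) (hl : lam ∈ U) {b : ℝ} (hb : 0 < b) :
    V.law lam {θ | b < ‖V.el θ lam‖} ≤ ENNReal.ofReal (C * b ^ (-p)) := by
  have := isProbabilityMeasure_law (hU.subset hl)
  have hp := hU.two_le
  have h1 := mul_meas_ge_le_integral_of_nonneg (μ := V.law lam) (f := fun θ => ‖V.el θ lam‖ ^ p)
    (.of_forall fun θ => by positivity) (hU.integrable_el lam hl) (b ^ p)
  have h2 : (V.law lam).real {θ | b ^ p ≤ ‖V.el θ lam‖ ^ p} ≤ C * b ^ (-p) := by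
    rw [Real.rpow_neg hb.le, ← div_eq_mul_inv, le_div_iff₀ (by positivity), mul_comm]
    exact h1.trans (hU.integral_el lam hl)
  calc V.law lam {θ | b < ‖V.el θ lam‖} ≤ V.law lam {θ | b ^ p ≤ ‖V.el θ lam‖ ^ p} := by
        refine measure_mono fun θ (hθ : b < ‖V.el θ lam‖) => ?_
        exact Real.rpow_le_rpow hb.le hθ.le (by linarith)
    _ = ENNReal.ofReal ((V.law lam).real {θ | b ^ p ≤ ‖V.el θ lam‖ ^ p}) := by
        rw [Measure.real, ENNReal.ofReal_toReal (measure_ne_top _ _)]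
    _ ≤ _ := ENNReal.ofReal_le_ofReal h2

end IsGood

/-- Under the moment assumptions of the theorem there is a good neighbourhood of a point of `M`. -/
theorem exists_isGood {lamStar : Vec D} (hl : lamStar ∈ V.M) (hc : ContinuousAt V.loss lamStar)
    {η : ℝ} (hη : 0 < η)
    (hell : ∃ C₀ C₁ : ℝ, 0 ≤ C₀ ∧ 0 ≤ C₁ ∧ ∀ lam ∈ V.M,
      ∫⁻ θ, ‖V.ell θ lam‖ₑ ^ (2 + 2 * η) ∂(V.law lam) ≤
        ENNReal.ofReal (C₀ + C₁ * |V.loss lam - V.loss lamStar| ^ (1 + η)))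
    (hscore : ∃ C₀ C₁ : ℝ, 0 ≤ C₀ ∧ 0 ≤ C₁ ∧ ∀ lam ∈ V.M,
      ∫⁻ θ, ‖V.score lam θ‖ₑ ^ 4 ∂(V.law lam) ≤
        ENNReal.ofReal (C₀ + C₁ * (V.loss lam - V.loss lamStar) ^ 2)) :
    ∃ C U, lamStar ∈ U ∧ V.IsGood (2 + 2 * η) C U := by
  obtain ⟨A₀, A₁, hA₀, hA₁, hA⟩ := hell
  obtain ⟨B₀, B₁, hB₀, hB₁, hB⟩ := hscore
  -- Within distance 1 of the optimal loss, the growth terms of the moment assumptions are at most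
  -- their coefficients.
  have hnhds : V.loss ⁻¹' Metric.ball (V.loss lamStar) 1 ∩ V.M ∈ 𝓝 lamStar :=
    inter_mem (hc.preimage_mem_nhds (Metric.ball_mem_nhds _ one_pos)) (V.isOpen_M.mem_nhds hl)
  obtain ⟨U, hU, hUo, hlU⟩ := mem_nhds_iff.1 hnhds
  have hloss : ∀ l ∈ U, |V.loss l - V.loss lamStar| ≤ 1 := fun l h => by
    have : dist (V.loss l) (V.loss lamStar) < 1 := (hU h).1
    rw [Real.dist_eq] at this
    exact this.le
  set C : ℝ := 1 + A₀ + A₁ + B₀ + B₁ with hC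
  have h1 : ∀ l ∈ U, ∫⁻ θ, ‖V.el θ l‖ₑ ^ (2 + 2 * η) ∂(V.law l) ≤ ENNReal.ofReal C := by
    intro l h
    have e : ∫⁻ θ, ‖V.el θ l‖ₑ ^ (2 + 2 * η) ∂(V.law l) =
        ∫⁻ θ, ‖V.ell θ l‖ₑ ^ (2 + 2 * η) ∂(V.law l) := by
      refine lintegral_congr_ae ?_
      filter_upwards [ae_mem_supp (hU h).2] with θ hθ
      rw [el_eq (hU h).2 hθ]
    rw [e]
    refine (hA l (hU h).2).trans (ENNReal.ofReal_le_ofReal ?_)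
    have : |V.loss l - V.loss lamStar| ^ (1 + η) ≤ 1 :=
      Real.rpow_le_one (abs_nonneg _) (hloss l h) (by linarith)
    nlinarith
  have h2 : ∀ l ∈ U, ∫⁻ θ, ‖V.sc l θ‖ₑ ^ ((4 : ℕ) : ℝ) ∂(V.law l) ≤ ENNReal.ofReal C := by
    intro l h
    have e : ∫⁻ θ, ‖V.sc l θ‖ₑ ^ ((4 : ℕ) : ℝ) ∂(V.law l) =
        ∫⁻ θ, ‖V.score l θ‖ₑ ^ 4 ∂(V.law l) := by
      refine lintegral_congr_ae ?_
      filter_upwards [ae_mem_supp (hU h).2] with θ hθ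
      rw [sc_eq (hU h).2 hθ, ENNReal.rpow_natCast]
    rw [e]
    refine (hB l (hU h).2).trans (ENNReal.ofReal_le_ofReal ?_)
    have : (V.loss l - V.loss lamStar) ^ 2 ≤ 1 := by
      rw [← sq_abs]; exact pow_le_one₀ (abs_nonneg _) (hloss l h)
    nlinarith
  have hC0 : 0 ≤ C := by positivity
  have k1 := fun l h => integrable_norm_rpow_of_lintegral (measurable_el_right l)
    (by linarith) hC0 (h1 l h)
  have k2 := fun l h => integrable_norm_rpow_of_lintegral (measurable_sc_right l)
    (by norm_num) hC0 (h2 l h)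
  simp only [Real.rpow_natCast] at k2
  exact ⟨C, U, hlU, hUo, fun l h => (hU h).2, by linarith, by linarith,
    fun l h => (k1 l h).1, fun l h => (k1 l h).2, fun l h => (k2 l h).1, fun l h => (k2 l h).2⟩

end Problem

variable {d D : ℕ}

/-! ### A measurable version of the algorithm -/

/-- The unnormalized Fisher estimate after iteration `s + 1`. -/
def nextH (T : Tuning D) (s : ℕ) (H : Matrix (Fin D) (Fin D) ℝ) (φ Z : Vec D) :
    Matrix (Fin D) (Fin D) ℝ :=
  H + Matrix.vecMulVec φ φ + (T.cβ * ((s : ℝ) + 1) ^ (-T.β)) • Matrix.vecMulVec Z Z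

/-- The preconditioner of iteration `s + 1`. -/
def nextA (T : Tuning D) (s : ℕ) (H : Matrix (Fin D) (Fin D) ℝ) (φ Z : Vec D) :
    Matrix (Fin D) (Fin D) ℝ :=
  (((s : ℝ) + 1)⁻¹ • nextH T s H φ Z)⁻¹

/-- The mean of the gradient samples `el`. -/
def gradMean (V : Problem d D) {B : ℕ} (lam : Vec D) (θ : Fin B → Vec d) : Vec D :=
  (B : ℝ)⁻¹ • ∑ i, V.el (θ i) lam

/-- One iteration, with `sc` and `el` in place of the score and of `ell`. -/
def stepM (V : Problem d D) (T : Tuning D) (s : ℕ) (S : State D) (x : Draw d D T.B) : State D :=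
  let lam : Vec D := S.lam - T.τ (s + 1) •
    Matrix.toEuclideanLin (nextA T s S.H (V.sc S.avg x.2.1) x.2.2) (gradMean V S.lam x.1)
  ⟨lam, S.avg + (Real.log ((s : ℝ) + 1) ^ T.w /
      ∑ k ∈ Finset.range (s + 1), Real.log ((k : ℝ) + 1) ^ T.w) • (lam - S.avg),
    nextH T s S.H (V.sc S.avg x.2.1) x.2.2⟩

/-- The run of the algorithm, with `sc` and `el` in place of the score and of `ell`. -/
def runM (V : Problem d D) (T : Tuning D) (x : ℕ → Draw d D T.B) : ℕ → State D
  | 0 => ⟨T.lam0, T.lam0, T.H0⟩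
  | s + 1 => stepM V T s (runM V T x s) (x s)

theorem stepM_eq_step {V : Problem d D} {T : Tuning D} {s : ℕ} {S : State D} {x : Draw d D T.B}
    (hl : S.lam ∈ V.M) (ha : S.avg ∈ V.M) (hx : ∀ i, x.1 i ∈ V.supp) (hx' : x.2.1 ∈ V.supp) :
    stepM V T s S x = step V T s S x := by
  have h1 : gradMean V S.lam x.1 = gradEstimate V S.lam x.1 := by
    simp only [gradMean, gradEstimate]
    congr 1
    exact Finset.sum_congr rfl fun i _ => Problem.el_eq hl (hx i)
  simp only [stepM, step, nextA, nextH, Problem.sc_eq ha hx', h1]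

theorem runM_eq_run {V : Problem d D} {T : Tuning D} {x : ℕ → Draw d D T.B}
    (hM : ∀ s, (run V T x s).lam ∈ V.M ∧ (run V T x s).avg ∈ V.M)
    (hx : ∀ s, (∀ i, (x s).1 i ∈ V.supp) ∧ (x s).2.1 ∈ V.supp) (s : ℕ) :
    runM V T x s = run V T x s := by
  induction s with
  | zero => rfl
  | succ s ih =>
    rw [runM, run, ih]
    exact stepM_eq_step (hM s).1 (hM s).2 (hx s).1 (hx s).2

/-! ### Measurability of the matrix operations and of one iteration -/

section Measurability

variable {X : Type*} [MeasurableSpace X]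

theorem measurable_det {A : X → Matrix (Fin D) (Fin D) ℝ}
    (hA : ∀ i j, Measurable fun x => A x i j) : Measurable fun x => (A x).det := by
  simp only [Matrix.det_apply]
  exact Finset.measurable_sum _ fun σ _ =>
    (Finset.measurable_prod _ fun i _ => hA _ _).const_smul _

/-- Cramer's rule: the entries are quotients of determinants. For a singular matrix both sides take
the default value zero, so no invertibility is required. -/
theorem measurable_inv_apply {A : X → Matrix (Fin D) (Fin D) ℝ}
    (hA : ∀ i j, Measurable fun x => A x i j) (i j : Fin D) :
    Measurable fun x => (A x)⁻¹ i j := by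
  simp only [Matrix.inv_def, Matrix.smul_apply, Ring.inverse_eq_inv', smul_eq_mul,
    Matrix.adjugate_apply]
  refine (measurable_det hA).inv.mul (measurable_det fun i' j' => ?_)
  simp only [Matrix.updateRow_apply]
  split_ifs
  · exact measurable_const
  · exact hA _ _

theorem measurable_nextH {T : Tuning D} {s : ℕ} {H : X → Matrix (Fin D) (Fin D) ℝ}
    {φ Z : X → Vec D} (hH : ∀ i j, Measurable fun x => H x i j) (hφ : Measurable φ)
    (hZ : Measurable Z) (i j : Fin D) :
    Measurable fun x => nextH T s (H x) (φ x) (Z x) i j := by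
  simp only [nextH, Matrix.add_apply, Matrix.smul_apply, Matrix.vecMulVec_apply, smul_eq_mul]
  exact ((hH i j).add ((Problem.measurable_vec_apply hφ i).mul
    (Problem.measurable_vec_apply hφ j))).add (((Problem.measurable_vec_apply hZ i).mul
    (Problem.measurable_vec_apply hZ j)).const_mul _)

theorem measurable_nextA {T : Tuning D} {s : ℕ} {H : X → Matrix (Fin D) (Fin D) ℝ}
    {φ Z : X → Vec D} (hH : ∀ i j, Measurable fun x => H x i j) (hφ : Measurable φ)
    (hZ : Measurable Z) (i j : Fin D) :
    Measurable fun x => nextA T s (H x) (φ x) (Z x) i j := by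
  refine measurable_inv_apply (fun i j => ?_) i j
  simp only [Matrix.smul_apply, smul_eq_mul]
  exact (measurable_nextH hH hφ hZ i j).const_mul _

theorem measurable_toEuclideanLin {A : X → Matrix (Fin D) (Fin D) ℝ} {v : X → Vec D}
    (hA : ∀ i j, Measurable fun x => A x i j) (hv : Measurable v) :
    Measurable fun x => Matrix.toEuclideanLin (A x) (v x) := by
  refine Problem.measurable_vec fun k => ?_
  simp only [Matrix.toLpLin_apply, Matrix.mulVec, dotProduct]
  exact Finset.measurable_sum _ fun j _ => (hA k j).mul (Problem.measurable_vec_apply hv j)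

theorem measurable_gradMean {V : Problem d D} {B : ℕ} {lam : X → Vec D}
    {θ : X → Fin B → Vec d} (hl : Measurable lam) (hθ : Measurable θ) :
    Measurable fun x => gradMean V (lam x) (θ x) := by
  have : ∀ i, Measurable fun x => V.el (θ x i) (lam x) := fun i =>
    have hm : Measurable fun x => (lam x, θ x i) := hl.prodMk ((measurable_pi_apply i).comp hθ)
    ((V.measurable_h.comp hm).smul (V.measurable_sc.comp hm)).neg
  simp only [gradMean]
  exact (Finset.measurable_sum _ fun i _ => this i).const_smul (B : ℝ)⁻¹

theorem measurable_stepM {V : Problem d D} {T : Tuning D} {s : ℕ} {S : X → State D}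
    {x : X → Draw d D T.B} (hl : Measurable fun ω => (S ω).lam)
    (ha : Measurable fun ω => (S ω).avg) (hH : ∀ i j, Measurable fun ω => (S ω).H i j)
    (hx : Measurable x) :
    (Measurable fun ω => (stepM V T s (S ω) (x ω)).lam) ∧
    (Measurable fun ω => (stepM V T s (S ω) (x ω)).avg) ∧
    ∀ i j, Measurable fun ω => (stepM V T s (S ω) (x ω)).H i j := by
  have hφ : Measurable fun ω => V.sc (S ω).avg (x ω).2.1 :=
    V.measurable_sc.comp (ha.prodMk (measurable_fst.comp (measurable_snd.comp hx)))
  have hZ : Measurable fun ω => (x ω).2.2 := measurable_snd.comp (measurable_snd.comp hx)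
  have h1 : Measurable fun ω => (stepM V T s (S ω) (x ω)).lam :=
    hl.sub ((measurable_toEuclideanLin (measurable_nextA hH hφ hZ)
      (measurable_gradMean hl (measurable_fst.comp hx))).const_smul (T.τ (s + 1)))
  refine ⟨h1, ?_, measurable_nextH hH hφ hZ⟩
  exact ha.add ((h1.sub ha).const_smul (_ : ℝ))

end Measurability

theorem measurable_runM {V : Problem d D} {T : Tuning D} {Ω : Type*} [mΩ : MeasurableSpace Ω]
    {ℱ : Filtration ℕ mΩ} {X : ℕ → Ω → Draw d D T.B}
    (hX : ∀ s, Measurable[ℱ (s + 1)] (X s)) (s : ℕ) :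
    (Measurable[ℱ s] fun ω => (runM V T (fun k => X k ω) s).lam) ∧
    (Measurable[ℱ s] fun ω => (runM V T (fun k => X k ω) s).avg) ∧
    ∀ i j, Measurable[ℱ s] fun ω => (runM V T (fun k => X k ω) s).H i j := by
  induction s with
  | zero => exact ⟨measurable_const, measurable_const, fun _ _ => measurable_const⟩
  | succ s ih =>
    have hle : ℱ s ≤ ℱ (s + 1) := ℱ.mono (Nat.le_succ s)
    exact @measurable_stepM d D Ω (ℱ (s + 1)) V T s (fun ω => runM V T (fun k => X k ω) s) (X s)
      (ih.1.mono hle le_rfl) (ih.2.1.mono hle le_rfl) (fun i j => (ih.2.2 i j).mono hle le_rfl)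
      (hX s)

/-! ### The sampling kernel -/

section Kernels

variable (V : Problem d D)

/-- The laws `q_lam`, `lam ∈ M`, as a Markov kernel. -/
def lawK : Kernel (Vec D) (Vec d) :=
  haveI : DecidablePred fun l => l ∈ V.M := Classical.decPred _
  Kernel.piecewise (V.isOpen_M.measurableSet)
    (Kernel.withDensity (Kernel.const (Vec D) volume) fun l θ => ENNReal.ofReal (V.q l θ))
    -- The value outside `M` is arbitrary; a Dirac mass makes the kernel Markov everywhere.
    (Kernel.const (Vec D) (Measure.dirac 0))

theorem lawK_apply {l : Vec D} (hl : l ∈ V.M) : lawK V l = V.law l := by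
  let _ : DecidablePred fun l => l ∈ V.M := Classical.decPred _
  rw [lawK, Kernel.piecewise_apply, if_pos hl,
    Kernel.withDensity_apply _ V.measurable_q.ennreal_ofReal, Kernel.const_apply]
  rfl

instance : IsMarkovKernel (lawK V) := by
  refine ⟨fun l => ?_⟩
  let _ : DecidablePred fun l => l ∈ V.M := Classical.decPred _
  by_cases hl : l ∈ V.M
  · rw [lawK_apply V hl]; exact Problem.isProbabilityMeasure_law hl
  · rw [lawK, Kernel.piecewise_apply, if_neg hl, Kernel.const_apply]; infer_instance

/-- The joint law of one gradient sample and of the samples for the Fisher estimate, as a function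
of the iterate and of the averaged iterate. -/
def drawK : Kernel (Vec D × Vec D) (Vec d × (Vec d × Vec D)) :=
  ((lawK V).comap Prod.fst measurable_fst) ×ₖ
    (((lawK V).comap Prod.snd measurable_snd) ×ₖ Kernel.const _ (stdGaussian (Vec D)))

instance : IsMarkovKernel (drawK V) := by unfold drawK; infer_instance

theorem drawK_apply (e : Vec D × Vec D) :
    drawK V e = (lawK V e.1).prod ((lawK V e.2).prod (stdGaussian (Vec D))) := by
  rw [drawK, Kernel.prod_apply, Kernel.prod_apply, Kernel.comap_apply, Kernel.comap_apply,
    Kernel.const_apply]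

/-- Only one gradient sample is kept: the noise is linear in the samples, so each of the `B` samples
can be treated separately. -/
theorem map_drawLaw {B : ℕ} {S : State D} (hl : S.lam ∈ V.M) (ha : S.avg ∈ V.M) (i : Fin B) :
    (drawLaw V B S).map (Prod.map (Function.eval i) id) = drawK V (S.lam, S.avg) := by
  have h1 := Problem.isProbabilityMeasure_law hl
  have h2 := Problem.isProbabilityMeasure_law ha
  rw [drawLaw, ← Measure.map_prod_map _ _ (measurable_pi_apply i) measurable_id, Measure.map_id,
    (measurePreserving_eval (fun _ : Fin B => V.law S.lam) i).map_eq, drawK_apply,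
    lawK_apply V hl, lawK_apply V ha]

end Kernels

/-! ### Consequences of the conditional law of the samples -/

section Sampling

variable {V : Problem d D} {T : Tuning D} {Ω : Type*} [mΩ : MeasurableSpace Ω]
  {P : Measure Ω} {ℱ : Filtration ℕ mΩ} {X : ℕ → Ω → Draw d D T.B}

theorem IsSampling.measurable' (hX : IsSampling V T P ℱ X) (s : ℕ) : Measurable (X s) :=
  (hX.measurable s).mono (ℱ.le _) le_rfl

theorem IsSampling.measure_preimage (hX : IsSampling V T P ℱ X)
    (hM : ∀ᵐ ω ∂P, ∀ s, (run V T (fun k => X k ω) s).lam ∈ V.M ∧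
      (run V T (fun k => X k ω) s).avg ∈ V.M) (s : ℕ) {A : Set Ω} (hA : MeasurableSet[ℱ s] A)
    (i : Fin T.B) {C : Set (Vec d × (Vec d × Vec D))} (hC : MeasurableSet C) :
    P (A ∩ (fun ω => ((X s ω).1 i, (X s ω).2)) ⁻¹' C) =
      ∫⁻ ω in A, drawK V ((run V T (fun k => X k ω) s).lam, (run V T (fun k => X k ω) s).avg) C
        ∂P := by
  have hm : Measurable (Prod.map (Function.eval i) id : Draw d D T.B → Vec d × (Vec d × Vec D)) :=
    (measurable_pi_apply i).prodMap measurable_id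
  have h := hX.condLaw s A hA _ (hm hC)
  refine Eq.trans h (lintegral_congr_ae (ae_restrict_of_ae ?_))
  filter_upwards [hM] with ω hω
  rw [← map_drawLaw V (hω s).1 (hω s).2 i, Measure.map_apply hm hC]

/-- Each `q_lam` charges only `supp`. Hence `sc` and `el` almost surely agree with the score and
`ell` along the run, and `runM` may replace `run`. -/
theorem IsSampling.ae_mem_supp (hX : IsSampling V T P ℱ X)
    (hM : ∀ᵐ ω ∂P, ∀ s, (run V T (fun k => X k ω) s).lam ∈ V.M ∧
      (run V T (fun k => X k ω) s).avg ∈ V.M) :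
    ∀ᵐ ω ∂P, ∀ s, (∀ i, (X s ω).1 i ∈ V.supp) ∧ (X s ω).2.1 ∈ V.supp := by
  rw [ae_all_iff]
  intro s
  have key : ∀ i, ∀ᵐ ω ∂P, (X s ω).1 i ∈ V.supp ∧ (X s ω).2.1 ∈ V.supp := fun i => by
    set C : Set (Vec d × (Vec d × Vec D)) := {y | ¬ (y.1 ∈ V.supp ∧ y.2.1 ∈ V.supp)} with hC
    have hCm : MeasurableSet C := ((measurable_fst V.measurableSet_supp).inter
      ((measurable_fst.comp measurable_snd) V.measurableSet_supp)).compl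
    have h := hX.measure_preimage hM s (A := Set.univ) MeasurableSet.univ i hCm
    rw [Set.univ_inter] at h
    rw [ae_iff]
    refine Eq.trans h ?_
    rw [setLIntegral_univ, lintegral_congr_ae (g := fun _ => 0), lintegral_zero]
    filter_upwards [hM] with ω hω
    have h1 := Problem.isProbabilityMeasure_law (hω s).1
    have h2 := Problem.isProbabilityMeasure_law (hω s).2
    rw [drawK_apply, lawK_apply V (hω s).1, lawK_apply V (hω s).2]
    have e1 := (Measure.quasiMeasurePreserving_fst
      (μ := V.law (run V T (fun k => X k ω) s).lam)
      (ν := (V.law (run V T (fun k => X k ω) s).avg).prod (stdGaussian (Vec D)))).ae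
      (Problem.ae_mem_supp (hω s).1)
    have e2 := (Measure.quasiMeasurePreserving_snd
      (μ := V.law (run V T (fun k => X k ω) s).lam)
      (ν := (V.law (run V T (fun k => X k ω) s).avg).prod (stdGaussian (Vec D)))).ae
      ((Measure.quasiMeasurePreserving_fst (ν := stdGaussian (Vec D))).ae
        (Problem.ae_mem_supp (hω s).2))
    exact ae_iff.1 (e1.and e2)
  filter_upwards [ae_all_iff.2 key] with ω hω
  exact ⟨fun i => (hω i).1, (hω ⟨0, T.B_pos⟩).2⟩

theorem IsSampling.ae_runM_eq (hX : IsSampling V T P ℱ X)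
    (hM : ∀ᵐ ω ∂P, ∀ s, (run V T (fun k => X k ω) s).lam ∈ V.M ∧
      (run V T (fun k => X k ω) s).avg ∈ V.M) :
    ∀ᵐ ω ∂P, ∀ s, runM V T (fun k => X k ω) s = run V T (fun k => X k ω) s := by
  filter_upwards [hM, hX.ae_mem_supp hM] with ω h1 h2 s using runM_eq_run h1 h2 s

/-- The iterate and the averaged iterate. -/
def runPair (V : Problem d D) (T : Tuning D) {Ω : Type*} (X : ℕ → Ω → Draw d D T.B) (s : ℕ)
    (ω : Ω) : Vec D × Vec D :=
  ((runM V T (fun k => X k ω) s).lam, (runM V T (fun k => X k ω) s).avg)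

theorem IsSampling.measurable_runPair (hX : IsSampling V T P ℱ X) (s : ℕ) :
    Measurable[ℱ s] (runPair V T X s) :=
  (measurable_runM hX.measurable s).1.prodMk (measurable_runM hX.measurable s).2.1

/-- The joint law of the past and of the samples of iteration `s + 1`. -/
theorem IsSampling.map_eq_compProd [IsProbabilityMeasure P] (hX : IsSampling V T P ℱ X)
    (hM : ∀ᵐ ω ∂P, ∀ s, (run V T (fun k => X k ω) s).lam ∈ V.M ∧
      (run V T (fun k => X k ω) s).avg ∈ V.M) (s : ℕ) (i : Fin T.B)
    {ρ : Type*} [MeasurableSpace ρ] {r : Ω → ρ} (hr : Measurable[ℱ s] r) :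
    P.map (fun ω => ((runPair V T X s ω, r ω), ((X s ω).1 i, (X s ω).2))) =
      (P.map fun ω => (runPair V T X s ω, r ω)) ⊗ₘ (drawK V).prodMkRight ρ := by
  have hY : Measurable fun ω => ((X s ω).1 i, (X s ω).2) :=
    ((measurable_pi_apply i).comp (measurable_fst.comp (hX.measurable' s))).prodMk
      (measurable_snd.comp (hX.measurable' s))
  have hST : Measurable[ℱ s] fun ω => (runPair V T X s ω, r ω) :=
    (hX.measurable_runPair s).prodMk hr
  have hST' : Measurable fun ω => (runPair V T X s ω, r ω) := hST.mono (ℱ.le s) le_rfl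
  have : IsProbabilityMeasure (P.map fun ω => (runPair V T X s ω, r ω)) :=
    Measure.isProbabilityMeasure_map hST'.aemeasurable
  have : IsProbabilityMeasure
      (P.map fun ω => ((runPair V T X s ω, r ω), ((X s ω).1 i, (X s ω).2))) :=
    Measure.isProbabilityMeasure_map (hST'.prodMk hY).aemeasurable
  -- Measurable rectangles determine the law, and on rectangles the claim is the defining property
  -- of the sampling. The extra coordinate `r` is an arbitrary variable known at time `s`, to be
  -- frozen in later conditional integrals.
  refine Measure.ext_prod fun {A C} hA hC => ?_
  rw [Measure.map_apply (hST'.prodMk hY) (hA.prod hC), Measure.compProd_apply_prod hA hC,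
    setLIntegral_map hA (Kernel.measurable_coe _ hC) hST']
  have h := hX.measure_preimage hM s (hST hA) i hC
  refine Eq.trans h (lintegral_congr_ae (ae_restrict_of_ae ?_))
  filter_upwards [hX.ae_runM_eq hM] with ω hω
  rw [Kernel.prodMkRight_apply, runPair, hω s]

end Sampling

/-! ### Conditional moments from a disintegration -/

section Disintegration

variable {Ω E Y : Type*} [MeasurableSpace Ω] [MeasurableSpace E] [MeasurableSpace Y]
  {P : Measure Ω} [IsProbabilityMeasure P] {κ : Kernel E Y} [IsMarkovKernel κ]
  {S : Ω → E} {y : Ω → Y}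

theorem integral_of_disintegration (hS : Measurable S) (hy : Measurable y)
    (h : P.map (fun ω => (S ω, y ω)) = P.map S ⊗ₘ κ) {F : E × Y → ℝ} (hF : Measurable F)
    (hi : Integrable (fun ω => F (S ω, y ω)) P) :
    ∫ ω, F (S ω, y ω) ∂P = ∫ ω, ∫ z, F (S ω, z) ∂κ (S ω) ∂P := by
  have : IsProbabilityMeasure (P.map S) := Measure.isProbabilityMeasure_map hS.aemeasurable
  have hi' : Integrable F (P.map S ⊗ₘ κ) := by
    rw [← h]
    exact (integrable_map_measure hF.aestronglyMeasurable (hS.prodMk hy).aemeasurable).2 hi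
  have h1 := integral_map (μ := P) (hS.prodMk hy).aemeasurable hF.aestronglyMeasurable
  rw [← h1, h, Measure.integral_compProd hi', integral_map hS.aemeasurable]
  exact (hF.stronglyMeasurable.integral_kernel_prod_right' (κ := κ)).aestronglyMeasurable

theorem measurable_integral_kernel {F : E × Y → ℝ} (hF : Measurable F) :
    Measurable fun e => ∫ z, F (e, z) ∂κ e :=
  (hF.stronglyMeasurable.integral_kernel_prod_right' (κ := κ)).measurable

variable {F : E × Y → ℝ} {C : ℝ}

theorem sq_integral_kernel_le (hF : Measurable F)
    (hi : ∀ e, Integrable (fun z => F (e, z) ^ 2) (κ e)) (hC : ∀ e, ∫ z, F (e, z) ^ 2 ∂κ e ≤ C)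
    (e : E) : ∫ z, (F (e, z) - ∫ z, F (e, z) ∂κ e) ^ 2 ∂κ e ≤ C ∧ |∫ z, F (e, z) ∂κ e| ≤ 1 + C := by
  have hm : Measurable fun z => F (e, z) := hF.comp measurable_prodMk_left
  have hL : MemLp (fun z => F (e, z)) 2 (κ e) :=
    (memLp_two_iff_integrable_sq hm.aestronglyMeasurable).2 (hi e)
  constructor
  · rw [← variance_eq_integral hm.aemeasurable]
    exact (variance_le_expectation_sq hm.aestronglyMeasurable).trans (hC e)
  · exact (abs_integral_le_integral_abs).trans
      ((Problem.IsGood.integral_abs_le_of_sq hm (hi e)).trans (by linarith [hC e]))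

theorem memLp_comp_of_disintegration (hS : Measurable S) (hy : Measurable y)
    (h : P.map (fun ω => (S ω, y ω)) = P.map S ⊗ₘ κ) (hF : Measurable F)
    (hi : ∀ e, Integrable (fun z => F (e, z) ^ 2) (κ e)) (hC : ∀ e, ∫ z, F (e, z) ^ 2 ∂κ e ≤ C) :
    MemLp (fun ω => F (S ω, y ω)) 2 P := by
  have : IsProbabilityMeasure (P.map S) := Measure.isProbabilityMeasure_map hS.aemeasurable
  have hSy := hS.prodMk hy
  refine (memLp_two_iff_integrable_sq (hF.comp hSy).aestronglyMeasurable).2 ?_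
  have h1 : Integrable (fun p => F p ^ 2) (P.map fun ω => (S ω, y ω)) := by
    rw [h, Measure.integrable_compProd_iff (hF.pow_const 2).aestronglyMeasurable]
    refine ⟨.of_forall hi, Integrable.of_bound (C := C) ?_ (.of_forall fun e => ?_)⟩
    · exact (measurable_integral_kernel (hF.pow_const 2).norm).aestronglyMeasurable
    · simp only [norm_pow, Real.norm_eq_abs, sq_abs]
      rw [abs_of_nonneg (integral_nonneg fun z => sq_nonneg _)]
      exact hC e
  exact h1.comp_measurable hSy

theorem memLp_centered (hS : Measurable S) (hy : Measurable y)
    (h : P.map (fun ω => (S ω, y ω)) = P.map S ⊗ₘ κ) (hF : Measurable F)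
    (hi : ∀ e, Integrable (fun z => F (e, z) ^ 2) (κ e)) (hC : ∀ e, ∫ z, F (e, z) ^ 2 ∂κ e ≤ C) :
    MemLp (fun ω => F (S ω, y ω) - ∫ z, F (S ω, z) ∂κ (S ω)) 2 P := by
  refine (memLp_comp_of_disintegration hS hy h hF hi hC).sub ?_
  refine MemLp.of_bound ((measurable_integral_kernel hF).comp hS).aestronglyMeasurable (1 + C)
    (.of_forall fun ω => ?_)
  exact (sq_integral_kernel_le hF hi hC (S ω)).2

theorem integral_sq_centered_le (hS : Measurable S) (hy : Measurable y)
    (h : P.map (fun ω => (S ω, y ω)) = P.map S ⊗ₘ κ) (hF : Measurable F)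
    (hi : ∀ e, Integrable (fun z => F (e, z) ^ 2) (κ e)) (hC : ∀ e, ∫ z, F (e, z) ^ 2 ∂κ e ≤ C) :
    ∫ ω, (F (S ω, y ω) - ∫ z, F (S ω, z) ∂κ (S ω)) ^ 2 ∂P ≤ C := by
  have hFb := measurable_integral_kernel (κ := κ) hF
  have hG : Measurable fun p : E × Y => (F p - ∫ z, F (p.1, z) ∂κ p.1) ^ 2 :=
    (hF.sub (hFb.comp measurable_fst)).pow_const 2
  rw [integral_of_disintegration hS hy h hG (memLp_centered hS hy h hF hi hC).integrable_sq]
  have hb : ∀ ω, ∫ z, (F (S ω, z) - ∫ z, F (S ω, z) ∂κ (S ω)) ^ 2 ∂κ (S ω) ≤ C := fun ω =>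
    (sq_integral_kernel_le hF hi hC (S ω)).1
  have hint : Integrable
      (fun ω => ∫ z, (F (S ω, z) - ∫ z, F (S ω, z) ∂κ (S ω)) ^ 2 ∂κ (S ω)) P := by
    refine Integrable.of_bound (C := C)
      ((measurable_integral_kernel hG).comp hS).aestronglyMeasurable (.of_forall fun ω => ?_)
    rw [Real.norm_eq_abs, abs_of_nonneg (integral_nonneg fun z => sq_nonneg _)]
    exact hb ω
  have := integral_mono hint (integrable_const C) hb
  simpa using this

/-- Integrating first over the kernel freezes `g (S ω)`, and the centred factor has kernel mean
zero. -/
theorem integral_mul_centered (hS : Measurable S) (hy : Measurable y)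
    (h : P.map (fun ω => (S ω, y ω)) = P.map S ⊗ₘ κ) (hF : Measurable F)
    (hi : ∀ e, Integrable (fun z => F (e, z) ^ 2) (κ e)) (hC : ∀ e, ∫ z, F (e, z) ^ 2 ∂κ e ≤ C)
    {g : E → ℝ} (hg : Measurable g) (hgL : MemLp (fun ω => g (S ω)) 2 P) :
    ∫ ω, g (S ω) * (F (S ω, y ω) - ∫ z, F (S ω, z) ∂κ (S ω)) ∂P = 0 := by
  have hFb := measurable_integral_kernel (κ := κ) hF
  have hG : Measurable fun p : E × Y => g p.1 * (F p - ∫ z, F (p.1, z) ∂κ p.1) :=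
    (hg.comp measurable_fst).mul (hF.sub (hFb.comp measurable_fst))
  have h1 := integral_of_disintegration hS hy h hG
    (hgL.integrable_mul (memLp_centered hS hy h hF hi hC))
  refine h1.trans ?_
  have h2 : ∀ e, ∫ z, g e * (F (e, z) - ∫ z, F (e, z) ∂κ e) ∂κ e = 0 := fun e => by
    have hm : Measurable fun z => F (e, z) := hF.comp measurable_prodMk_left
    rw [integral_const_mul, integral_sub (Problem.IsGood.integrable_of_sq hm (hi e))
      (integrable_const _)]
    simp
  simp only [h2, integral_zero]

end Disintegration

/-! ### The noise in the gradient estimates -/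

/-- The recursion `m ↦ (1 - t) m + t ζ` with steps `t = (n + 1)⁻ᵅ`, started at zero. -/
def damped (α : ℝ) (ζ : ℕ → ℝ) : ℕ → ℝ
  | 0 => 0
  | n + 1 => (1 - ((n : ℝ) + 1) ^ (-α)) * damped α ζ n + ((n : ℝ) + 1) ^ (-α) * ζ n

section Noise

variable {V : Problem d D} {T : Tuning D} {Ω : Type*} [mΩ : MeasurableSpace Ω]
  {P : Measure Ω} {ℱ : Filtration ℕ mΩ} {X : ℕ → Ω → Draw d D T.B}

/-- The unnormalized Fisher estimate as a function on pairs of indices. -/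
def runH (V : Problem d D) (T : Tuning D) {Ω : Type*} (X : ℕ → Ω → Draw d D T.B) (s : ℕ)
    (ω : Ω) : Fin D → Fin D → ℝ := fun i j => (runM V T (fun k => X k ω) s).H i j

theorem IsSampling.measurable_runH (hX : IsSampling V T P ℱ X) (s : ℕ) :
    Measurable[ℱ s] (runH V T X s) :=
  @measurable_pi_lambda _ _ _ (ℱ s) _ _ fun i => @measurable_pi_lambda _ _ _ (ℱ s) _ _ fun j =>
    (measurable_runM hX.measurable s).2.2 i j

/-- The noise `a (f̄ - f)`, where `f̄` is the conditional mean of `f`. -/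
def noise (V : Problem d D) (a : ((Vec D × Vec D) × (Fin D → Fin D → ℝ)) × (Vec d × Vec D) → ℝ)
    (f : Vec D × Vec d → ℝ)
    (p : ((Vec D × Vec D) × (Fin D → Fin D → ℝ)) × (Vec d × (Vec d × Vec D))) : ℝ :=
  a (p.1, p.2.2) * ((∫ θ, f (p.1.1.1, θ) ∂lawK V p.1.1.1) - f (p.1.1.1, p.2.1))

variable {a : ((Vec D × Vec D) × (Fin D → Fin D → ℝ)) × (Vec d × Vec D) → ℝ}
  {f : Vec D × Vec d → ℝ} {A b v : ℝ}

theorem measurable_noise (ha : Measurable a) (hf : Measurable f) : Measurable (noise V a f) := by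
  have h1 := measurable_integral_kernel (κ := lawK V) hf
  have h2 : Measurable fun p : ((Vec D × Vec D) × (Fin D → Fin D → ℝ)) ×
      (Vec d × (Vec d × Vec D)) => p.1.1.1 := by fun_prop
  exact (ha.comp (by fun_prop)).mul ((h1.comp h2).sub (hf.comp (by fun_prop)))

theorem abs_noise_le (hA : ∀ p, |a p| ≤ A) (hb : ∀ p, |f p| ≤ b)
    (p : ((Vec D × Vec D) × (Fin D → Fin D → ℝ)) × (Vec d × (Vec d × Vec D))) :
    |noise V a f p| ≤ A * (2 * b) := by
  have hA0 : 0 ≤ A := (abs_nonneg _).trans (hA (p.1, p.2.2))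
  rw [noise, abs_mul]
  refine mul_le_mul (hA _) ?_ (abs_nonneg _) hA0
  refine (abs_sub _ _).trans ?_
  have : |∫ θ, f (p.1.1.1, θ) ∂lawK V p.1.1.1| ≤ b := by
    have := norm_integral_le_of_norm_le_const (μ := lawK V p.1.1.1)
      (f := fun θ => f (p.1.1.1, θ)) (C := b) (.of_forall fun θ => hb (p.1.1.1, θ))
    simpa using this
  linarith [hb (p.1.1.1, p.2.1)]

/-- The factor `a` depends on the fresh draws only through `θ̄` and `Z`, while the centred factor
depends only on the gradient sample. Under the product law the integral factorizes, so a
preconditioner that uses the current draws does not bias the gradient noise. -/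
theorem integral_noise (hf : Measurable f) (hb : ∀ p, |f p| ≤ b)
    (e : (Vec D × Vec D) × (Fin D → Fin D → ℝ)) :
    ∫ z, noise V a f (e, z) ∂drawK V e.1 = 0 := by
  have hi : Integrable (fun θ => f (e.1.1, θ)) (lawK V e.1.1) :=
    Integrable.of_bound (hf.comp measurable_prodMk_left).aestronglyMeasurable b
      (.of_forall fun θ => hb _)
  rw [drawK_apply]
  have h1 := integral_prod_mul (μ := lawK V e.1.1) (ν := (lawK V e.1.2).prod (stdGaussian (Vec D)))
    (fun θ => (∫ θ, f (e.1.1, θ) ∂lawK V e.1.1) - f (e.1.1, θ)) (fun z => a (e, z))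
  simp only [noise, mul_comm (a _)]
  rw [h1, integral_sub (integrable_const _) hi]
  simp

theorem integral_sq_noise_le (ha : Measurable a) (hf : Measurable f) (hA : ∀ p, |a p| ≤ A)
    (hv : ∀ l, ∫ θ, f (l, θ) ^ 2 ∂lawK V l ≤ v)
    (e : (Vec D × Vec D) × (Fin D → Fin D → ℝ)) :
    ∫ z, noise V a f (e, z) ^ 2 ∂drawK V e.1 ≤ A ^ 2 * v := by
  have hm : Measurable fun θ => f (e.1.1, θ) := hf.comp measurable_prodMk_left
  rw [drawK_apply]
  have h1 := integral_prod_mul (μ := lawK V e.1.1) (ν := (lawK V e.1.2).prod (stdGaussian (Vec D)))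
    (fun θ => ((∫ θ, f (e.1.1, θ) ∂lawK V e.1.1) - f (e.1.1, θ)) ^ 2) (fun z => a (e, z) ^ 2)
  simp only [noise, mul_pow, mul_comm (a _ ^ 2)]
  rw [h1, mul_comm]
  have ham : Measurable fun z => a (e, z) := ha.comp measurable_prodMk_left
  have h2 : ∫ z, a (e, z) ^ 2 ∂((lawK V e.1.2).prod (stdGaussian (Vec D))) ≤ A ^ 2 := by
    have hle : ∀ z, a (e, z) ^ 2 ≤ A ^ 2 := fun z => by
      rw [← sq_abs]; exact pow_le_pow_left₀ (abs_nonneg _) (hA _) 2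
    have hi : Integrable (fun z => a (e, z) ^ 2) ((lawK V e.1.2).prod (stdGaussian (Vec D))) :=
      Integrable.of_bound (ham.pow_const 2).aestronglyMeasurable (A ^ 2) (.of_forall fun z => by
        rw [Real.norm_eq_abs, abs_of_nonneg (sq_nonneg _)]; exact hle z)
    have := integral_mono hi (integrable_const (A ^ 2)) hle
    simpa using this
  have h3 : ∫ θ, ((∫ θ, f (e.1.1, θ) ∂lawK V e.1.1) - f (e.1.1, θ)) ^ 2 ∂lawK V e.1.1 ≤ v := by
    simp only [sub_sq_comm (∫ θ, f (e.1.1, θ) ∂lawK V e.1.1)]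
    rw [← variance_eq_integral hm.aemeasurable]
    exact (variance_le_expectation_sq hm.aestronglyMeasurable).trans (hv _)
  have h4 : 0 ≤ ∫ θ, ((∫ θ, f (e.1.1, θ) ∂lawK V e.1.1) - f (e.1.1, θ)) ^ 2 ∂lawK V e.1.1 :=
    integral_nonneg fun θ => sq_nonneg _
  exact mul_le_mul h2 h3 h4 (sq_nonneg _)

/-- The noise of iteration `n + 1` along the run, for the `i`-th gradient sample. -/
def runNoise (V : Problem d D) (T : Tuning D) {Ω : Type*} (X : ℕ → Ω → Draw d D T.B)
    (i : Fin T.B)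
    (a : ℕ → ((Vec D × Vec D) × (Fin D → Fin D → ℝ)) × (Vec d × Vec D) → ℝ)
    (f : ℕ → Vec D × Vec d → ℝ) (n : ℕ) (ω : Ω) : ℝ :=
  noise V (a n) (f n) ((runPair V T X n ω, runH V T X n ω), ((X n ω).1 i, (X n ω).2))

/-- Reduction to `recursion_isBigO`. The value `m n` is known at time `n`, so it is carried as an
additional coordinate of the state; `exp (c m)` is then frozen under the kernel, and mean zero and
variance at most `A² v` give the two weighted moment conditions. -/
theorem IsSampling.noise_isBigO [IsProbabilityMeasure P] (hX : IsSampling V T P ℱ X)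
    (hM : ∀ᵐ ω ∂P, ∀ s, (run V T (fun k => X k ω) s).lam ∈ V.M ∧
      (run V T (fun k => X k ω) s).avg ∈ V.M) (i : Fin T.B)
    {a : ℕ → ((Vec D × Vec D) × (Fin D → Fin D → ℝ)) × (Vec d × Vec D) → ℝ}
    {f : ℕ → Vec D × Vec d → ℝ} {A κ v : ℝ} (hA0 : 0 < A) (hκ0 : 0 ≤ κ) (hκ : κ < T.α / 2)
    (hv0 : 0 ≤ v) (ha : ∀ n, Measurable (a n)) (hf : ∀ n, Measurable (f n))
    (hA : ∀ n p, |a n p| ≤ A) (hb : ∀ n p, |f n p| ≤ ((n : ℝ) + 1) ^ κ)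
    (hv : ∀ n l, ∫ θ, f n (l, θ) ^ 2 ∂lawK V l ≤ v) :
    ∀ᵐ ω ∂P, (fun n => damped T.α (fun n => runNoise V T X i a f n ω) n) =O[atTop]
      fun n : ℕ => √(Real.log n / (n : ℝ) ^ T.α) := by
  set ζ : ℕ → Ω → ℝ := runNoise V T X i a f with hζ
  set m : ℕ → Ω → ℝ := fun n ω => damped T.α (fun n => ζ n ω) n with hm
  have hα : 0 < T.α := by linarith [T.α_gt]
  have hY : ∀ n, Measurable[ℱ (n + 1)] fun ω => ((X n ω).1 i, (X n ω).2) := fun n =>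
    (((measurable_pi_apply i).comp measurable_fst).comp (hX.measurable n)).prodMk
      (measurable_snd.comp (hX.measurable n))
  have hζF : ∀ n, Measurable[ℱ (n + 1)] (ζ n) := fun n => by
    have hle : ℱ n ≤ ℱ (n + 1) := ℱ.mono (Nat.le_succ n)
    exact (measurable_noise (ha n) (hf n)).comp
      ((((hX.measurable_runPair n).prodMk (hX.measurable_runH n)).mono hle le_rfl).prodMk (hY n))
  have hmF : ∀ n, Measurable[ℱ n] (m n) := by
    intro n
    induction n with
    | zero => exact measurable_const
    | succ n ih =>
      have hle : ℱ n ≤ ℱ (n + 1) := ℱ.mono (Nat.le_succ n)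
      exact ((ih.mono hle le_rfl).const_mul _).add ((hζF n).const_mul _)
  have hζm : ∀ n, Measurable (ζ n) := fun n => (hζF n).mono (ℱ.le _) le_rfl
  have hmm : ∀ n, Measurable (m n) := fun n => (hmF n).mono (ℱ.le _) le_rfl
  have hζb : ∀ n ω, |ζ n ω| ≤ (2 * A) * ((n : ℝ) + 1) ^ κ := fun n ω => by
    refine (abs_noise_le (hA n) (hb n) _).trans (le_of_eq (by ring))
  have hmb := fun n => recursion_bounded (m := m) (ζ := ζ) (α := T.α) (fun ω => rfl)
    (fun n ω => rfl) hζb n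
  have hdis := fun n => hX.map_eq_compProd hM n i ((hX.measurable_runH n).prodMk (hmF n))
  have hSm : ∀ n, Measurable fun ω => (runPair V T X n ω, (runH V T X n ω, m n ω)) := fun n =>
    ((hX.measurable_runPair n).prodMk ((hX.measurable_runH n).prodMk (hmF n))).mono
      (ℱ.le n) le_rfl
  have hYm : ∀ n, Measurable fun ω => ((X n ω).1 i, (X n ω).2) := fun n =>
    (hY n).mono (ℱ.le _) le_rfl
  have hE : ∀ (_ : ℕ) (c : ℝ), Measurable fun p : ((Vec D × Vec D) × ((Fin D → Fin D → ℝ) × ℝ)) ×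
      (Vec d × (Vec d × Vec D)) => Real.exp (c * p.1.2.2) := fun n c => by fun_prop
  have hN : ∀ n, Measurable fun p : ((Vec D × Vec D) × ((Fin D → Fin D → ℝ) × ℝ)) ×
      (Vec d × (Vec d × Vec D)) => noise V (a n) (f n) ((p.1.1, p.1.2.1), p.2) := fun n =>
    (measurable_noise (ha n) (hf n)).comp (by fun_prop)
  have hexp : ∀ (n : ℕ) (c : ℝ), ∃ g, ∀ ω, ‖Real.exp (c * m n ω)‖ ≤ g := fun n c => by
    obtain ⟨b, hb⟩ := hmb n
    refine ⟨Real.exp (|c| * b), fun ω => ?_⟩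
    rw [Real.norm_eq_abs, abs_of_pos (Real.exp_pos _), Real.exp_le_exp]
    calc c * m n ω ≤ |c * m n ω| := le_abs_self _
      _ = |c| * |m n ω| := abs_mul _ _
      _ ≤ |c| * b := by gcongr; exact hb ω
  have iE : ∀ (n : ℕ) (c : ℝ), Integrable (fun ω => Real.exp (c * m n ω)) P := fun n c => by
    obtain ⟨g, hg⟩ := hexp n c
    exact Integrable.of_bound ((hmm n).const_mul c).exp.aestronglyMeasurable g (.of_forall hg)
  refine recursion_isBigO (P := P) (m := m) (ζ := ζ) (K := 2 * A) (σ := A ^ 2 * v) hα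
    T.α_lt.le hκ0 hκ (by positivity) (by positivity) (fun ω => rfl) (fun n ω => rfl) hmm hζm
    hζb ?_ ?_
  · intro n c
    have h1 := integral_of_disintegration (hSm n) (hYm n) (hdis n) ((hE n c).mul (hN n))
      ((iE n c).mul_bdd (hζm n).aestronglyMeasurable (.of_forall (hζb n)))
    refine h1.trans ?_
    simp only [Kernel.prodMkRight_apply]
    have h2 : ∀ ω, ∫ z, Real.exp (c * m n ω) *
        noise V (a n) (f n) ((runPair V T X n ω, runH V T X n ω), z) ∂drawK V (runPair V T X n ω) =
        0 := fun ω => by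
      rw [integral_const_mul, integral_noise (hf n) (hb n) (runPair V T X n ω, runH V T X n ω),
        mul_zero]
    simp only [Pi.mul_apply, h2, integral_zero]
  · intro n c
    have i1 : Integrable (fun ω => Real.exp (c * m n ω) * ζ n ω ^ 2) P := by
      refine (iE n c).mul_bdd (c := ((2 * A) * ((n : ℝ) + 1) ^ κ) ^ 2)
        ((hζm n).pow_const 2).aestronglyMeasurable (.of_forall fun ω => ?_)
      rw [norm_pow]
      exact pow_le_pow_left₀ (norm_nonneg _) (hζb n ω) 2
    have h1 := integral_of_disintegration (hSm n) (hYm n) (hdis n)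
      ((hE n c).mul ((hN n).pow_const 2)) i1
    refine h1.trans_le ?_
    simp only [Kernel.prodMkRight_apply]
    have h2 : ∀ ω, ∫ z, Real.exp (c * m n ω) *
        noise V (a n) (f n) ((runPair V T X n ω, runH V T X n ω), z) ^ 2
          ∂drawK V (runPair V T X n ω) ≤ A ^ 2 * v * Real.exp (c * m n ω) := fun ω => by
      rw [integral_const_mul, mul_comm]
      gcongr
      exact integral_sq_noise_le (ha n) (hf n) (hA n) (hv n)
        (runPair V T X n ω, runH V T X n ω)
    simp only [Pi.mul_apply]
    rw [← integral_const_mul]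
    refine integral_mono_of_nonneg (.of_forall fun ω => ?_) ((iE n c).const_mul _)
      (.of_forall h2)
    exact integral_nonneg fun z => mul_nonneg (Real.exp_pos _).le (sq_nonneg _)

end Noise

/-! ### Convergence of the averaged iterates and of the Fisher estimate -/

theorem tendsto_avg {V : Problem d D} {T : Tuning D} {x : ℕ → Draw d D T.B} {lamStar : Vec D}
    (h : Tendsto (fun s => (runM V T x s).lam) atTop (𝓝 lamStar)) :
    Tendsto (fun s => (runM V T x s).avg) atTop (𝓝 lamStar) :=
  tendsto_of_weighted_average (l := fun k : ℕ => Real.log ((k : ℝ) + 1) ^ T.w)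
    (fun k => Real.rpow_nonneg (Real.log_nonneg (by linarith [Nat.cast_nonneg (α := ℝ) k])) _)
    (tendsto_sum_log_rpow T.w_nonneg) h fun _ => rfl

theorem integrable_sq_coord_mul_stdGaussian (i j : Fin D) :
    Integrable (fun z : Vec D => (z i * z j) ^ 2) (stdGaussian (Vec D)) := by
  have h4 : Integrable (fun z : Vec D => ‖z‖ ^ 4) (stdGaussian (Vec D)) := by
    have := (IsGaussian.memLp_id (stdGaussian (Vec D)) (4 : ℕ) (by simp)).integrable_norm_pow
      (by norm_num)
    simpa using this
  refine h4.mono' (by fun_prop) (.of_forall fun z => ?_)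
  rw [Real.norm_eq_abs, abs_of_nonneg (sq_nonneg _), mul_pow, ← sq_abs (z i), ← sq_abs (z j)]
  calc |z i| ^ 2 * |z j| ^ 2 ≤ ‖z‖ ^ 2 * ‖z‖ ^ 2 := by
        gcongr <;> exact Problem.abs_apply_le_norm _ _
    _ = ‖z‖ ^ 4 := by ring

open Classical in
/-- The increment of the `(i, j)` entry of the Fisher estimate, localized to `U`. -/
def fisherInc (V : Problem d D) (U : Set (Vec D)) (c : ℝ) (i j : Fin D)
    (p : (Vec D × Vec D) × (Vec d × (Vec d × Vec D))) : ℝ :=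
  (if p.1.2 ∈ U then V.sc p.1.2 p.2.2.1 i * V.sc p.1.2 p.2.2.1 j else 0) +
    c * (p.2.2.2 i * p.2.2.2 j)

section Increment

variable {V : Problem d D} {U : Set (Vec D)} {p C c : ℝ}

theorem measurable_fisherInc (hU : MeasurableSet U) (i j : Fin D) :
    Measurable (fisherInc V U c i j) := by
  have h1 : Measurable fun p : (Vec D × Vec D) × (Vec d × (Vec d × Vec D)) =>
      V.sc p.1.2 p.2.2.1 :=
    V.measurable_sc.comp (f := fun p : (Vec D × Vec D) × (Vec d × (Vec d × Vec D)) =>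
      (p.1.2, p.2.2.1)) (by fun_prop)
  have h2 : MeasurableSet {p : (Vec D × Vec D) × (Vec d × (Vec d × Vec D)) | p.1.2 ∈ U} :=
    (by fun_prop : Measurable fun p : (Vec D × Vec D) × (Vec d × (Vec d × Vec D)) => p.1.2) hU
  refine Measurable.add (Measurable.ite h2 ?_ measurable_const) (by fun_prop)
  exact (Problem.measurable_vec_apply h1 i).mul (Problem.measurable_vec_apply h1 j)

theorem integrable_comp_of_measurePreserving {X Y : Type*} [MeasurableSpace X] [MeasurableSpace Y]
    {μ : Measure X} {ν : Measure Y} {g : X → Y} (hg : MeasurePreserving g μ ν) {f : Y → ℝ}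
    (hf : Integrable f ν) : Integrable (fun x => f (g x)) μ ∧ ∫ x, f (g x) ∂μ = ∫ y, f y ∂ν := by
  refine ⟨hg.integrable_comp_of_integrable hf, ?_⟩
  rw [← hg.map_eq, integral_map hg.measurable.aemeasurable]
  rw [hg.map_eq]
  exact hf.aestronglyMeasurable

/-- The localization to `U` makes the second moment bounded uniformly in the state `e`; the mean is
identified only where the localization is inactive. -/
theorem fisherInc_moments (hU : V.IsGood p C U) (e : Vec D × Vec D) (i j : Fin D) :
    (Integrable (fun z => fisherInc V U c i j (e, z) ^ 2) (drawK V e) ∧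
    ∫ z, fisherInc V U c i j (e, z) ^ 2 ∂drawK V e ≤
      2 * C + 2 * c ^ 2 * ∫ z : Vec D, (z i * z j) ^ 2 ∂stdGaussian (Vec D)) ∧
    (e.2 ∈ U → ∫ z, fisherInc V U c i j (e, z) ∂drawK V e =
      ∫ θ, V.sc e.2 θ i * V.sc e.2 θ j ∂V.law e.2 +
        c * ∫ z : Vec D, z i * z j ∂stdGaussian (Vec D)) := by
  classical
  set g : Vec d → ℝ := fun θ => if e.2 ∈ U then V.sc e.2 θ i * V.sc e.2 θ j else 0 with hg
  have hscm : Measurable fun θ => V.sc e.2 θ i * V.sc e.2 θ j :=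
    (Problem.measurable_vec_apply (Problem.measurable_sc_right e.2) i).mul
      (Problem.measurable_vec_apply (Problem.measurable_sc_right e.2) j)
  have hgm : Measurable g := by
    by_cases he : e.2 ∈ U
    · simpa only [hg, if_pos he] using hscm
    · simp only [hg, if_neg he]; exact measurable_const
  have hC0 : 0 ≤ C := by linarith [hU.one_le]
  have hg2 : Integrable (fun θ => g θ ^ 2) (lawK V e.2) ∧ ∫ θ, g θ ^ 2 ∂lawK V e.2 ≤ C := by
    by_cases he : e.2 ∈ U
    · simp only [hg, if_pos he, lawK_apply V (hU.subset he)]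
      exact hU.sq_sc_mul_sc he i j
    · simp [hg, if_neg he, hC0]
  have hz2 := integrable_sq_coord_mul_stdGaussian (D := D) i j
  have p1 : MeasurePreserving (fun z : Vec d × (Vec d × Vec D) => z.2.1)
      ((lawK V e.1).prod ((lawK V e.2).prod (stdGaussian (Vec D)))) (lawK V e.2) :=
    measurePreserving_fst.comp measurePreserving_snd
  have p2 : MeasurePreserving (fun z : Vec d × (Vec d × Vec D) => z.2.2)
      ((lawK V e.1).prod ((lawK V e.2).prod (stdGaussian (Vec D)))) (stdGaussian (Vec D)) :=
    measurePreserving_snd.comp measurePreserving_snd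
  obtain ⟨a1, a2⟩ := integrable_comp_of_measurePreserving p1 hg2.1
  obtain ⟨b1, b2⟩ := integrable_comp_of_measurePreserving p2 hz2
  have hle : ∀ z : Vec d × (Vec d × Vec D), fisherInc V U c i j (e, z) ^ 2 ≤
      2 * g z.2.1 ^ 2 + 2 * c ^ 2 * (z.2.2 i * z.2.2 j) ^ 2 := fun z => by
    have : fisherInc V U c i j (e, z) = g z.2.1 + c * (z.2.2 i * z.2.2 j) := rfl
    rw [this]
    nlinarith [sq_nonneg (g z.2.1 - c * (z.2.2 i * z.2.2 j))]
  have hmeas : Measurable fun z => fisherInc V U c i j (e, z) :=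
    (measurable_fisherInc hU.isOpen.measurableSet i j).comp measurable_prodMk_left
  have hbi := (a1.const_mul 2).add (b1.const_mul (2 * c ^ 2))
  rw [drawK_apply]
  have hsq : Integrable (fun z => fisherInc V U c i j (e, z) ^ 2)
      ((lawK V e.1).prod ((lawK V e.2).prod (stdGaussian (Vec D)))) := by
    refine hbi.mono' (hmeas.pow_const 2).aestronglyMeasurable (.of_forall fun z => ?_)
    rw [Real.norm_eq_abs, abs_of_nonneg (sq_nonneg _)]
    exact hle z
  refine ⟨⟨hsq, ?_⟩, fun he => ?_⟩
  · refine (integral_mono hsq hbi hle).trans ?_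
    have := integral_add (a1.const_mul 2) (b1.const_mul (2 * c ^ 2))
    simp only [Pi.add_apply, integral_const_mul] at this ⊢
    rw [this, a2, b2]
    linarith [hg2.2]
  · obtain ⟨a3, a4⟩ := integrable_comp_of_measurePreserving p1
      (Problem.IsGood.integrable_of_sq hgm hg2.1)
    obtain ⟨b3, b4⟩ := integrable_comp_of_measurePreserving p2
      (Problem.IsGood.integrable_of_sq (by fun_prop) hz2)
    have h1 := integral_add a3 (b3.const_mul c)
    rw [integral_const_mul, a4, b4] at h1
    simp only [hg, if_pos he, lawK_apply V (hU.subset he)] at h1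
    rw [← h1]
    simp only [fisherInc, if_pos he, lawK_apply V (hU.subset he)]

end Increment

/-! ### Strong law and consistency of the Fisher estimate -/

section Fisher

variable {V : Problem d D} {T : Tuning D} {Ω : Type*} [mΩ : MeasurableSpace Ω]
  {P : Measure Ω} [IsProbabilityMeasure P] {ℱ : Filtration ℕ mΩ} {X : ℕ → Ω → Draw d D T.B}
  {U : Set (Vec D)} {p C : ℝ}

/-- Centred increments are orthogonal: an earlier one is known at the time of the later draw and can
be frozen. The additional real coordinate of the state holds this earlier increment, or the dummy
value 0 when only second moments are needed. -/
theorem IsSampling.strong_law_fisherInc (hX : IsSampling V T P ℱ X)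
    (hM : ∀ᵐ ω ∂P, ∀ s, (run V T (fun k => X k ω) s).lam ∈ V.M ∧
      (run V T (fun k => X k ω) s).avg ∈ V.M) (hU : V.IsGood p C U) (b : Fin T.B) (i j : Fin D)
    {c : ℕ → ℝ} {c₀ : ℝ} (hc : ∀ n, |c n| ≤ c₀) :
    ∀ᵐ ω ∂P, Tendsto (fun n : ℕ => (∑ k ∈ Finset.range n,
      (fisherInc V U (c k) i j (runPair V T X k ω, ((X k ω).1 b, (X k ω).2)) -
        ∫ z, fisherInc V U (c k) i j (runPair V T X k ω, z) ∂drawK V (runPair V T X k ω))) / n)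
      atTop (𝓝 0) := by
  have hSm : ∀ k, Measurable[ℱ k] (runPair V T X k) := hX.measurable_runPair
  have hY : ∀ k, Measurable[ℱ (k + 1)] fun ω => ((X k ω).1 b, (X k ω).2) := fun n =>
    (((measurable_pi_apply b).comp measurable_fst).comp (hX.measurable n)).prodMk
      (measurable_snd.comp (hX.measurable n))
  have hYm : ∀ k, Measurable fun ω => ((X k ω).1 b, (X k ω).2) := fun n =>
    (hY n).mono (ℱ.le _) le_rfl
  set F : ℕ → ((Vec D × Vec D) × ℝ) × (Vec d × (Vec d × Vec D)) → ℝ := fun k p =>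
    fisherInc V U (c k) i j (p.1.1, p.2) with hF
  have hFm : ∀ k, Measurable (F k) := fun k =>
    (measurable_fisherInc hU.isOpen.measurableSet i j).comp (by fun_prop)
  set G : ℝ := ∫ z : Vec D, (z i * z j) ^ 2 ∂stdGaussian (Vec D) with hG
  have hG0 : 0 ≤ G := integral_nonneg fun z => sq_nonneg _
  have hFi : ∀ k (e : (Vec D × Vec D) × ℝ), Integrable (fun z => F k (e, z) ^ 2)
      ((drawK V).prodMkRight ℝ e) := fun k e => ((fisherInc_moments hU e.1 i j).1).1
  have hFC : ∀ k (e : (Vec D × Vec D) × ℝ), ∫ z, F k (e, z) ^ 2 ∂(drawK V).prodMkRight ℝ e ≤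
      2 * C + 2 * c₀ ^ 2 * G := fun k e => by
    refine ((fisherInc_moments hU e.1 i j).1).2.trans ?_
    have : c k ^ 2 ≤ c₀ ^ 2 := by
      rw [← sq_abs]; exact pow_le_pow_left₀ (abs_nonneg _) (hc k) 2
    gcongr
  set dd : ℕ → Ω → ℝ := fun k ω =>
    fisherInc V U (c k) i j (runPair V T X k ω, ((X k ω).1 b, (X k ω).2)) -
        ∫ z, fisherInc V U (c k) i j (runPair V T X k ω, z) ∂drawK V (runPair V T X k ω) with hdd
  have hdm : ∀ k, Measurable[ℱ (k + 1)] (dd k) := fun k => by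
    have hle : ℱ k ≤ ℱ (k + 1) := ℱ.mono (Nat.le_succ k)
    have h1 := measurable_fisherInc (V := V) (c := c k) hU.isOpen.measurableSet i j
    exact (h1.comp (((hSm k).mono hle le_rfl).prodMk (hY k))).sub
      ((measurable_integral_kernel (κ := drawK V) h1).comp ((hSm k).mono hle le_rfl))
  have hdis := fun k (g : Ω → ℝ) (hg : Measurable[ℱ k] g) => hX.map_eq_compProd hM k b hg
  have hSg : ∀ k (g : Ω → ℝ), Measurable[ℱ k] g → Measurable fun ω => (runPair V T X k ω, g ω) :=
    fun k g hg => ((hSm k).prodMk hg).mono (ℱ.le k) le_rfl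
  have hLp : ∀ k, MemLp (dd k) 2 P := fun k =>
    memLp_centered (F := F k) (κ := (drawK V).prodMkRight ℝ)
      (S := fun ω => (runPair V T X k ω, (0 : Ω → ℝ) ω)) (hSg k 0 measurable_const) (hYm k)
      (hdis k 0 measurable_const) (hFm k) (hFi k)
      (hFC k)
  refine strong_law_of_orthogonal hLp (C := 2 * C + 2 * c₀ ^ 2 * G) (fun k => ?_)
    (fun j' k hjk => ?_)
  · exact integral_sq_centered_le (F := F k) (κ := (drawK V).prodMkRight ℝ)
      (S := fun ω => (runPair V T X k ω, (0 : Ω → ℝ) ω)) (hSg k 0 measurable_const) (hYm k)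
      (hdis k 0 measurable_const)
      (hFm k) (hFi k) (hFC k)
  · have hg : Measurable[ℱ k] (dd j') := (hdm j').mono (ℱ.mono hjk) le_rfl
    exact integral_mul_centered (F := F k) (κ := (drawK V).prodMkRight ℝ)
      (S := fun ω => (runPair V T X k ω, dd j' ω)) (hSg k _ hg) (hYm k)
      (hdis k _ hg) (hFm k) (hFi k) (hFC k)
      (g := fun e => e.2) measurable_snd (hLp j')

/-- Since `β > 0`, the Gaussian regularization contributes nothing to the limit of the averages. -/
theorem tendsto_beta (T : Tuning D) :
    Tendsto (fun n : ℕ => T.cβ * ((n : ℝ) + 1) ^ (-T.β)) atTop (𝓝 0) := by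
  simpa using (tendsto_rpow_neg_succ T.β_pos).const_mul T.cβ

theorem fisher_eq {lamStar : Vec D} (hl : lamStar ∈ V.M) (i j : Fin D) :
    V.fisher lamStar i j = ∫ θ, V.sc lamStar θ i * V.sc lamStar θ j ∂V.law lamStar := by
  rw [Problem.fisher, Matrix.of_apply]
  refine integral_congr_ae ?_
  filter_upwards [Problem.ae_mem_supp hl] with θ hθ
  rw [Problem.sc_eq hl hθ]

/-- Consistency of the estimate of the Fisher matrix. -/
theorem IsSampling.tendsto_runH (hX : IsSampling V T P ℱ X)
    (hM : ∀ᵐ ω ∂P, ∀ s, (run V T (fun k => X k ω) s).lam ∈ V.M ∧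
      (run V T (fun k => X k ω) s).avg ∈ V.M) (hU : V.IsGood p C U) {lamStar : Vec D}
    (hl : lamStar ∈ U)
    (hconv : ∀ᵐ ω ∂P, Tendsto (fun s => (runM V T (fun k => X k ω) s).lam) atTop (𝓝 lamStar)) :
    ∀ᵐ ω ∂P, ∀ i j, Tendsto (fun n : ℕ => runH V T X n ω i j / n) atTop
      (𝓝 (V.fisher lamStar i j)) := by
  set c : ℕ → ℝ := fun n => T.cβ * ((n : ℝ) + 1) ^ (-T.β) with hc
  have hcb : ∀ n, |c n| ≤ T.cβ := fun n => by
    obtain ⟨h0, h1⟩ := one_sub_rpow_mem T.β_pos n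
    rw [hc, abs_of_nonneg (mul_nonneg T.cβ_nonneg h0.le)]
    exact mul_le_of_le_one_right T.cβ_nonneg h1
  have hsl : ∀ᵐ ω ∂P, ∀ i j, _ := ae_all_iff.2 fun i => ae_all_iff.2 fun j =>
    hX.strong_law_fisherInc hM hU ⟨0, T.B_pos⟩ i j hcb
  filter_upwards [hconv, hsl] with ω hω hsl i j
  have havg := tendsto_avg hω
  set b : Fin T.B := ⟨0, T.B_pos⟩
  set S : ℕ → State D := fun k => runM V T (fun k => X k ω) k with hS
  set f : ℕ → ℝ := fun k =>
    fisherInc V U (c k) i j (runPair V T X k ω, ((X k ω).1 b, (X k ω).2)) with hf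
  set g : ℕ → ℝ := fun k =>
    ∫ z, fisherInc V U (c k) i j (runPair V T X k ω, z) ∂drawK V (runPair V T X k ω) with hg
  have hsl' : Tendsto (fun n : ℕ => (∑ k ∈ Finset.range n, (f k - g k)) / n) atTop (𝓝 0) := hsl i j
  have hevU : ∀ᶠ k in atTop, (S k).avg ∈ U := havg.eventually (hU.isOpen.mem_nhds hl)
  have hinc : ∀ᶠ k in atTop, runH V T X (k + 1) ω i j - runH V T X k ω i j = f k := by
    filter_upwards [hevU] with k hk
    have e1 : runH V T X (k + 1) ω i j =
        nextH T k (S k).H (V.sc (S k).avg (X k ω).2.1) (X k ω).2.2 i j := rfl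
    have e2 : f k = V.sc (S k).avg (X k ω).2.1 i * V.sc (S k).avg (X k ω).2.1 j +
        c k * ((X k ω).2.2 i * (X k ω).2.2 j) := by
      simp only [hf, fisherInc]
      rw [if_pos (show (runPair V T X k ω).2 ∈ U from hk)]
      rfl
    have e3 : runH V T X k ω i j = (S k).H i j := rfl
    rw [e1, e2, e3]
    simp only [nextH, Matrix.add_apply, Matrix.smul_apply, Matrix.vecMulVec_apply, smul_eq_mul]
    ring
  have hgl : Tendsto g atTop (𝓝 (V.fisher lamStar i j)) := by
    have h1 : Tendsto (fun k => ∫ θ, V.sc (S k).avg θ i * V.sc (S k).avg θ j ∂V.law (S k).avg)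
        atTop (𝓝 (V.fisher lamStar i j)) := by
      rw [fisher_eq (hU.subset hl)]
      exact ((hU.continuousOn_integral_sc_mul_sc i j).continuousAt
        (hU.isOpen.mem_nhds hl)).tendsto.comp havg
    have h2 := h1.add ((tendsto_beta T).mul_const (∫ z : Vec D, z i * z j ∂stdGaussian (Vec D)))
    rw [zero_mul, add_zero] at h2
    refine h2.congr' ?_
    filter_upwards [hevU] with k hk
    exact ((fisherInc_moments hU (runPair V T X k ω) i j).2 hk).symm
  -- The true increments agree with the localized ones only eventually; the finitely many exceptions
  -- disappear in the Cesàro mean, so the exact telescoping sum can be used below.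
  have hg2 : Tendsto (fun k => runH V T X (k + 1) ω i j - runH V T X k ω i j - (f k - g k)) atTop
      (𝓝 (V.fisher lamStar i j)) := by
    refine hgl.congr' ?_
    filter_upwards [hinc] with k hk
    rw [hk]; ring
  have h3 := (hg2.cesaro.add hsl').add
    (tendsto_const_nhds (x := runH V T X 0 ω i j).div_atTop tendsto_natCast_atTop_atTop)
  rw [add_zero, add_zero] at h3
  refine h3.congr fun n => ?_
  rw [Finset.sum_sub_distrib, Finset.sum_range_sub (fun k => runH V T X k ω i j)]
  rw [div_eq_inv_mul, div_eq_inv_mul, div_eq_inv_mul]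
  ring

theorem tendsto_matrix_inv {A : ℕ → Matrix (Fin D) (Fin D) ℝ} {A₀ : Matrix (Fin D) (Fin D) ℝ}
    (h : Tendsto A atTop (𝓝 A₀)) (h₀ : A₀.det ≠ 0) :
    Tendsto (fun n => (A n)⁻¹) atTop (𝓝 A₀⁻¹) := by
  simp only [Matrix.inv_def, Ring.inverse_eq_inv']
  have h1 : Tendsto (fun n => (A n).det) atTop (𝓝 A₀.det) :=
    ((continuous_id.matrix_det).tendsto A₀).comp h
  have h2 : Tendsto (fun n => (A n).adjugate) atTop (𝓝 A₀.adjugate) :=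
    ((continuous_id.matrix_adjugate).tendsto A₀).comp h
  exact (h1.inv₀ h₀).smul h2

/-- The preconditioner of iteration `s + 1` along the run. -/
def runA (V : Problem d D) (T : Tuning D) {Ω : Type*} (X : ℕ → Ω → Draw d D T.B) (s : ℕ) (ω : Ω) :
    Matrix (Fin D) (Fin D) ℝ :=
  nextA T s (runM V T (fun k => X k ω) s).H
    (V.sc (runM V T (fun k => X k ω) s).avg (X s ω).2.1) (X s ω).2.2

end Fisher

theorem tendsto_runA {V : Problem d D} {T : Tuning D} {Ω : Type*} {X : ℕ → Ω → Draw d D T.B}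
    {lamStar : Vec D} {ω : Ω} (hdet : (V.fisher lamStar).det ≠ 0)
    (h : ∀ i j, Tendsto (fun n : ℕ => runH V T X n ω i j / n) atTop
      (𝓝 (V.fisher lamStar i j))) :
    Tendsto (fun n => runA V T X n ω) atTop (𝓝 (V.fisher lamStar)⁻¹) := by
  refine tendsto_matrix_inv (tendsto_pi_nhds.2 fun i => tendsto_pi_nhds.2 fun j => ?_) hdet
  -- The preconditioner of iteration `n + 1` already uses the updated sum, divided by `n + 1`.
  refine ((h i j).comp (tendsto_add_atTop_nat 1)).congr fun n => ?_
  simp only [Function.comp, Matrix.smul_apply, smul_eq_mul]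
  rw [div_eq_inv_mul]
  push_cast
  rfl

/-! ### Matrices as operators -/

/-- A matrix as a continuous linear map of Euclidean space. -/
def matL (A : Matrix (Fin D) (Fin D) ℝ) : Vec D →L[ℝ] Vec D :=
  LinearMap.toContinuousLinearMap (Matrix.toEuclideanLin A)

theorem matL_eq (A : Matrix (Fin D) (Fin D) ℝ) (x : Vec D) :
    matL A x = Matrix.toEuclideanLin A x := rfl

theorem matL_apply (A : Matrix (Fin D) (Fin D) ℝ) (x : Vec D) (k : Fin D) :
    matL A x k = ∑ l, A k l * x l := by
  simp only [matL_eq, Matrix.toLpLin_apply, Matrix.mulVec, dotProduct]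

theorem matL_sub (A B : Matrix (Fin D) (Fin D) ℝ) (x : Vec D) :
    matL (A - B) x = matL A x - matL B x := by
  ext k
  simp only [PiLp.sub_apply, matL_apply, Matrix.sub_apply, sub_mul, Finset.sum_sub_distrib]

theorem matL_mul (A B : Matrix (Fin D) (Fin D) ℝ) (x : Vec D) :
    matL (A * B) x = matL A (matL B x) := by
  simp only [matL_eq, Matrix.toEuclideanLin, Matrix.toLpLin_mul 2 2 2 A B]
  rfl

theorem inner_matL (A : Matrix (Fin D) (Fin D) ℝ) (x y : Vec D) :
    inner ℝ x (matL A y) = ∑ i, ∑ j, x i * A i j * y j := by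
  simp only [PiLp.inner_apply, matL_apply, RCLike.inner_apply, conj_trivial, Finset.sum_mul]
  exact Finset.sum_congr rfl fun i _ => Finset.sum_congr rfl fun j _ => by ring

theorem inner_matL_symm {A : Matrix (Fin D) (Fin D) ℝ} (hA : A.IsHermitian) (x y : Vec D) :
    inner ℝ (matL A x) y = inner ℝ x (matL A y) := by
  rw [real_inner_comm, inner_matL, inner_matL, Finset.sum_comm]
  refine Finset.sum_congr rfl fun i _ => Finset.sum_congr rfl fun j _ => ?_
  have := hA.apply i j
  simp only [star_trivial] at this
  rw [this]
  ring

/-- The constant is the minimum of the quadratic form on the compact unit sphere. -/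
theorem exists_posDef_bound {A : Matrix (Fin D) (Fin D) ℝ} (hA : A.PosDef) :
    ∃ c, 0 < c ∧ ∀ x : Vec D, c * ‖x‖ ^ 2 ≤ inner ℝ x (matL A x) := by
  have hpos : ∀ x : Vec D, x ≠ 0 → 0 < inner ℝ x (matL A x) := fun x hx => by
    have h1 : x.ofLp ≠ 0 := fun h => hx (by ext i; exact congrFun h i)
    have h2 := hA.dotProduct_mulVec_pos h1
    rw [EuclideanSpace.inner_eq_star_dotProduct, dotProduct_comm]
    exact h2
  have hcont : Continuous fun x : Vec D => inner ℝ x (matL A x) :=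
    continuous_id.inner (matL A).continuous
  -- The sphere is empty when `D = 0`.
  rcases (Metric.sphere (0 : Vec D) 1).eq_empty_or_nonempty with he | hne
  · refine ⟨1, one_pos, fun x => ?_⟩
    have hx : x = 0 := by
      by_contra hx
      have : ‖x‖⁻¹ • x ∈ Metric.sphere (0 : Vec D) 1 := by
        rw [mem_sphere_zero_iff_norm, norm_smul, norm_inv, norm_norm,
          inv_mul_cancel₀ (norm_ne_zero_iff.2 hx)]
      rw [he] at this
      exact this
    simp [hx]
  · obtain ⟨x₀, hx₀, hmin⟩ := (isCompact_sphere (0 : Vec D) 1).exists_isMinOn hne hcont.continuousOn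
    have hx₀' : x₀ ≠ 0 := by
      rintro rfl
      simp at hx₀
    refine ⟨_, hpos x₀ hx₀', fun x => ?_⟩
    rcases eq_or_ne x 0 with rfl | hx
    · simp
    have hn : 0 < ‖x‖ := norm_pos_iff.2 hx
    have hmem : ‖x‖⁻¹ • x ∈ Metric.sphere (0 : Vec D) 1 := by
      rw [mem_sphere_zero_iff_norm, norm_smul, norm_inv, norm_norm, inv_mul_cancel₀ hn.ne']
    have h1 := isMinOn_iff.1 hmin _ hmem
    rw [map_smul, real_inner_smul_left, real_inner_smul_right] at h1
    calc inner ℝ x₀ (matL A x₀) * ‖x‖ ^ 2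
        ≤ (‖x‖⁻¹ * (‖x‖⁻¹ * inner ℝ x (matL A x))) * ‖x‖ ^ 2 := by gcongr
      _ = inner ℝ x (matL A x) := by field_simp

/-! ### Coordinatewise asymptotics -/

theorem isBigO_apply (x : ℕ → Vec D) (k : Fin D) : (fun n => x n k) =O[atTop] x :=
  IsBigO.of_bound 1 (.of_forall fun n => by
    rw [one_mul]; exact Problem.abs_apply_le_norm (x n) k)

theorem eq_sum_single (x : Vec D) : x = ∑ k, x k • EuclideanSpace.single k (1 : ℝ) := by
  ext i
  simp [Pi.single_apply]

theorem norm_le_sum_abs (x : Vec D) : ‖x‖ ≤ ∑ k, |x k| := by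
  calc ‖x‖ = ‖∑ k, x k • EuclideanSpace.single k (1 : ℝ)‖ := by rw [← eq_sum_single x]
    _ ≤ ∑ k, ‖x k • EuclideanSpace.single k (1 : ℝ)‖ := norm_sum_le _ _
    _ = ∑ k, |x k| := by simp [norm_smul]

theorem isBigO_sum_abs (x : ℕ → Vec D) : x =O[atTop] fun n => ∑ k, |x n k| :=
  IsBigO.of_bound 1 (.of_forall fun n => by
    rw [one_mul, Real.norm_eq_abs]; exact (norm_le_sum_abs (x n)).trans (le_abs_self _))

theorem isBigO_of_apply {x : ℕ → Vec D} {g : ℕ → ℝ} (h : ∀ k, (fun n => x n k) =O[atTop] g) :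
    x =O[atTop] g :=
  (isBigO_sum_abs x).trans (IsBigO.fun_sum fun k _ => (h k).abs_left)

theorem isLittleO_of_apply {E : Type*} [NormedAddCommGroup E] {x : ℕ → Vec D} {g : ℕ → E}
    (h : ∀ k, (fun n => x n k) =o[atTop] g) : x =o[atTop] g :=
  (isBigO_sum_abs x).trans_isLittleO (IsLittleO.fun_sum fun k _ => (h k).abs_left)

theorem matL_sub_isLittleO {A : ℕ → Matrix (Fin D) (Fin D) ℝ} {A₀ : Matrix (Fin D) (Fin D) ℝ}
    (hA : Tendsto A atTop (𝓝 A₀)) (x : ℕ → Vec D) :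
    (fun n => matL (A n - A₀) (x n)) =o[atTop] x := by
  refine isLittleO_of_apply fun k => ?_
  simp only [matL_apply]
  refine IsLittleO.fun_sum fun l _ => ?_
  have h1 : (fun n => (A n - A₀) k l) =o[atTop] fun _ => (1 : ℝ) := by
    rw [isLittleO_one_iff]
    have h2 := tendsto_pi_nhds.1 (tendsto_pi_nhds.1 hA k) l
    simpa using h2.sub_const (A₀ k l)
  have h3 : (fun n => (A n - A₀) k l * x n l) =o[atTop] fun n => 1 * ‖x n‖ :=
    h1.mul_isBigO (isBigO_apply x l).norm_right
  simp only [one_mul] at h3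
  exact h3.of_norm_right

/-! ### The deterministic part of the argument -/

/-- The rate for a preconditioned gradient recursion, in which `M n` collects the noise and `g n`
is the mean gradient, up to a bias. -/
theorem rate_of_recursion {α c₁ c₂ : ℝ} {τ : ℕ → ℝ} (hα0 : 0 < α) (hα1 : α < 1) (hc₁ : 0 < c₁)
    (hτ₁ : ∀ n : ℕ, c₁ * ((n : ℝ) + 1) ^ (-α) ≤ τ n)
    (hτ₂ : ∀ n : ℕ, τ n ≤ c₂ * ((n : ℝ) + 1) ^ (-α))
    {F Hs : Matrix (Fin D) (Fin D) ℝ} (hF : F.PosDef) (hHs : Hs.PosDef)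
    {A : ℕ → Matrix (Fin D) (Fin D) ℝ} (hA : Tendsto A atTop (𝓝 F⁻¹)) {Δ M b₁ b₂ : ℕ → Vec D}
    (hM : M =O[atTop] fun n : ℕ => √(Real.log n / (n : ℝ) ^ α)) (hb₁ : b₁ =o[atTop] Δ)
    (hb₂ : b₂ =O[atTop] fun n : ℕ => √(Real.log n / (n : ℝ) ^ α))
    (hrec : ∀ᶠ n in atTop, Δ (n + 1) - M (n + 1) = Δ n - M n -
      τ n • matL (A n) (matL Hs (Δ n) + b₁ n + b₂ n) + ((n : ℝ) + 1) ^ (-α) • M n) :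
    Δ =O[atTop] fun n : ℕ => √(Real.log n / (n : ℝ) ^ α) := by
  set v : ℕ → ℝ := fun n => √(Real.log n / (n : ℝ) ^ α) with hv
  set R : ℕ → Vec D := fun n => Δ n - M n with hR
  set g : ℕ → Vec D := fun n => matL Hs (Δ n) + b₁ n + b₂ n with hg
  set G : ℕ → ℝ := fun n => ‖R n‖ + v n with hG
  have hv0 : ∀ n, 0 ≤ v n := fun n => Real.sqrt_nonneg _
  have hRG : R =O[atTop] G := IsBigO.of_bound 1 (.of_forall fun n => by
    rw [one_mul, Real.norm_eq_abs]
    exact (le_add_of_nonneg_right (hv0 n)).trans (le_abs_self _))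
  have hvG : v =O[atTop] G := IsBigO.of_bound 1 (.of_forall fun n => by
    rw [one_mul, Real.norm_eq_abs, Real.norm_eq_abs, abs_of_nonneg (hv0 n)]
    exact (le_add_of_nonneg_left (norm_nonneg _)).trans (le_abs_self _))
  have hΔG : Δ =O[atTop] G := by
    have := hRG.add (hM.trans hvG)
    simpa [hR] using this
  have hgG : g =O[atTop] G :=
    ((((matL Hs).isBigO_comp Δ atTop).trans hΔG).add (hb₁.isBigO.trans hΔG)).add (hb₂.trans hvG)
  set Γ : Vec D →L[ℝ] Vec D := matL (F⁻¹ * Hs) with hΓ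
  have hdet : IsUnit F.det := hF.det_pos.ne'.isUnit
  obtain ⟨c₀, hc₀, hFpos⟩ := exists_posDef_bound hF
  obtain ⟨h₀, hh₀, hHpos⟩ := exists_posDef_bound hHs
  -- The error terms are sorted by size: `e₁` holds the error of the preconditioner and the Taylor
  -- remainder, both negligible against `‖R‖` plus the rate, and `e₂` holds the bias together with
  -- all terms in `M`, which already have the rate.
  set e₁ : ℕ → Vec D := fun n => -(matL (A n - F⁻¹) (g n) + matL F⁻¹ (b₁ n)) with he₁
  set e₂ : ℕ → Vec D := fun n =>
    ((τ n)⁻¹ * ((n : ℝ) + 1) ^ (-α)) • M n - (matL F⁻¹ (b₂ n) + Γ (M n)) with he₂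
  have he₁' : e₁ =o[atTop] G := by
    refine (((matL_sub_isLittleO hA g).trans_isBigO hgG).add ?_).neg_left
    exact (((matL F⁻¹).isBigO_comp b₁ atTop).trans_isLittleO hb₁).trans_isBigO hΔG
  have he₂' : e₂ =O[atTop] v := by
    refine IsBigO.sub ?_ ((((matL F⁻¹).isBigO_comp b₂ atTop).trans hb₂).add
      ((Γ.isBigO_comp M atTop).trans hM))
    -- The damping of `M` uses `(n + 1)⁻ᵅ` instead of `τ n`; their ratio is bounded.
    have h1 : (fun n : ℕ => (τ n)⁻¹ * ((n : ℝ) + 1) ^ (-α)) =O[atTop] fun _ => (1 : ℝ) := by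
      refine IsBigO.of_bound c₁⁻¹ (.of_forall fun n => ?_)
      have ht : 0 < ((n : ℝ) + 1) ^ (-α) := by positivity
      have hτp : 0 < τ n := lt_of_lt_of_le (by positivity) (hτ₁ n)
      rw [Real.norm_eq_abs, abs_of_pos (by positivity), norm_one, mul_one, ← div_eq_inv_mul,
        div_le_iff₀ hτp, ← div_eq_inv_mul, le_div_iff₀ hc₁, mul_comm]
      exact hτ₁ n
    have h2 := h1.smul hM
    simpa using h2
  have hRO : R =O[atTop] v := by
    refine linear_recursion_isBigO hα0 hα1 hc₁ hτ₁ hτ₂ (matL F) Γ (inner_matL_symm hF.1) hc₀ hFpos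
      hh₀ (fun x => ?_) ?_ he₁' he₂'
    -- In the form of `F` the factor `F⁻¹` cancels, and positivity of the Hessian remains.
    · rw [inner_matL_symm hF.1, hΓ, ← matL_mul, ← mul_assoc, Matrix.mul_nonsing_inv _ hdet, one_mul]
      exact hHpos x
    · filter_upwards [hrec] with n hn
      have hτp : τ n ≠ 0 := (lt_of_lt_of_le (by positivity) (hτ₁ n)).ne'
      simp only [hR] at hn ⊢
      rw [hn]
      simp only [he₁, he₂, hg, hΓ, matL_mul, matL_sub, map_sub, map_add, smul_add, smul_sub,
        smul_neg, smul_smul]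
      rw [← mul_assoc, mul_inv_cancel₀ hτp, one_mul]
      abel
  have := hRO.add hM
  simpa [hR] using this

/-- The Taylor expansion of the partial derivatives at a critical point. -/
theorem fderiv_expansion {f : Vec D → ℝ} {x₀ : Vec D} (hcrit : gradient f x₀ = 0)
    (hC2 : ContDiffAt ℝ 2 f x₀) (hsymm : (hessian f x₀).IsHermitian) (k : Fin D) :
    (fun x => fderiv ℝ f x (EuclideanSpace.single k 1) - matL (hessian f x₀) (x - x₀) k)
      =o[𝓝 x₀] fun x => x - x₀ := by
  have h1 : DifferentiableAt ℝ (fderiv ℝ f) x₀ :=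
    (hC2.fderiv_right (m := 1) (by norm_num)).differentiableAt (by simp)
  have h0 : fderiv ℝ f x₀ = 0 := by
    rw [gradient] at hcrit
    exact (LinearIsometryEquiv.map_eq_zero_iff _).1 hcrit
  have h2 := h1.hasFDerivAt.isLittleO
  have h3 := ((ContinuousLinearMap.apply ℝ ℝ (EuclideanSpace.single k (1 : ℝ) : Vec D)).isBigO_comp
    _ (𝓝 x₀)).trans_isLittleO h2
  refine h3.congr_left fun x => ?_
  simp only [ContinuousLinearMap.apply_apply, h0, sub_zero, sub_apply]
  congr 1
  rw [matL_apply]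
  set y := x - x₀
  conv_lhs => rw [eq_sum_single y]
  rw [map_sum, sum_apply]
  refine Finset.sum_congr rfl fun l _ => ?_
  -- The derivative of the gradient yields the second derivative with the directions in the other
  -- order, hence the use of symmetry.
  have h4 := hsymm.apply k l
  simp only [star_trivial] at h4
  rw [map_smul, smul_apply, smul_eq_mul, mul_comm, ← h4]
  simp only [hessian, Matrix.of_apply, iteratedFDeriv_two_apply]
  rfl

/-! ### Truncated gradient samples -/

open Classical in
/-- The `k`-th coordinate of `el`, localized to `lam ∈ U` and truncated at norm `b`. -/
def truncEl (V : Problem d D) (U : Set (Vec D)) (b : ℝ) (k : Fin D) (p : Vec D × Vec d) : ℝ :=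
  if p.1 ∈ U ∧ ‖V.el p.2 p.1‖ ≤ b then V.el p.2 p.1 k else 0

section Trunc

variable {V : Problem d D} {U : Set (Vec D)} {p C b : ℝ}

theorem measurable_truncEl (hU : MeasurableSet U) (k : Fin D) : Measurable (truncEl V U b k) := by
  have h1 : MeasurableSet {q : Vec D × Vec d | q.1 ∈ U ∧ ‖V.el q.2 q.1‖ ≤ b} :=
    (measurable_fst hU).inter (measurableSet_le V.measurable_el.norm measurable_const)
  exact Measurable.ite h1 (Problem.measurable_vec_apply V.measurable_el k) measurable_const

theorem abs_truncEl_le (hb : 0 ≤ b) (k : Fin D) (q : Vec D × Vec d) : |truncEl V U b k q| ≤ b := by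
  unfold truncEl
  split_ifs with h
  · exact (Problem.abs_apply_le_norm _ _).trans h.2
  · simpa using hb

theorem integral_sq_truncEl_le (hU : V.IsGood p C U) (k : Fin D) (l : Vec D) :
    ∫ θ, truncEl V U b k (l, θ) ^ 2 ∂lawK V l ≤ 1 + C := by
  by_cases hl : l ∈ U
  · rw [lawK_apply V (hU.subset hl)]
    refine le_trans (integral_mono_of_nonneg (.of_forall fun θ => sq_nonneg _)
      (hU.sq_el hl k).1 (.of_forall fun θ => ?_)) (hU.sq_el hl k).2
    simp only [truncEl]
    split_ifs
    · exact le_rfl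
    · simpa using sq_nonneg (V.el θ l k)
  · have : ∀ θ, truncEl V U b k (l, θ) = 0 := fun θ => if_neg fun h => hl h.1
    simp only [this]
    have := hU.one_le
    simp
    linarith

/-- The mean of the untruncated sample is the partial derivative of the loss, so the only
discrepancy is the truncation bias. -/
theorem abs_integral_truncEl_sub_le (hU : V.IsGood p C U) {l : Vec D} (hl : l ∈ U)
    (hd : DifferentiableAt ℝ V.loss l) (hb : 0 < b) (k : Fin D) :
    |∫ θ, truncEl V U b k (l, θ) ∂lawK V l -
      fderiv ℝ V.loss l (EuclideanSpace.single k 1)| ≤ C * b ^ (1 - p) := by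
  classical
  rw [lawK_apply V (hU.subset hl), ← hU.integral_el_eq hl hd k]
  refine le_of_eq_of_le ?_ (hU.abs_integral_trunc_sub_le hl k hb)
  simp only [truncEl, hl, true_and]

end Trunc

/-! ### The step sizes -/

theorem step_le (T : Tuning D) (n : ℕ) : T.τ (n + 1) ≤ T.cα * ((n : ℝ) + 1) ^ (-T.α) := by
  have h0 := T.cα_pos
  have h1 := T.cα'_nonneg
  have hα : 0 < T.α := by linarith [T.α_gt]
  rw [Tuning.τ, Real.rpow_neg (by positivity), ← div_eq_mul_inv]
  push_cast
  have h2 : (n : ℝ) + 1 ≤ T.cα' + ((n : ℝ) + 1) := by linarith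
  exact div_le_div_of_nonneg_left h0.le (by positivity)
    (Real.rpow_le_rpow (by positivity) h2 hα.le)

/-- For `n + 1 ≥ 1` the shift is absorbed multiplicatively: `c' + (n + 1) ≤ (c' + 1) (n + 1)`. -/
theorem step_ge (T : Tuning D) (n : ℕ) :
    T.cα / (T.cα' + 1) ^ T.α * ((n : ℝ) + 1) ^ (-T.α) ≤ T.τ (n + 1) := by
  have h0 := T.cα_pos
  have h1 := T.cα'_nonneg
  have hα : 0 < T.α := by linarith [T.α_gt]
  have hn : (0 : ℝ) ≤ n := Nat.cast_nonneg n
  rw [Tuning.τ, Real.rpow_neg (by positivity), ← div_eq_mul_inv, div_div,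
    ← Real.mul_rpow (by positivity) (by positivity)]
  push_cast
  gcongr
  nlinarith

/-! ### The preconditioner as a bounded measurable function -/

open Classical in
/-- The `(j, k)` entry of the preconditioner, clipped at `K` and multiplied by the step size
relative to `(n + 1)⁻ᵅ`. -/
def clipA (V : Problem d D) (T : Tuning D) (K : ℝ) (j k : Fin D) (n : ℕ)
    (p : ((Vec D × Vec D) × (Fin D → Fin D → ℝ)) × (Vec d × Vec D)) : ℝ :=
  T.τ (n + 1) * ((n : ℝ) + 1) ^ T.α *
    if |nextA T n p.1.2 (V.sc p.1.1.2 p.2.1) p.2.2 j k| ≤ K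
      then nextA T n p.1.2 (V.sc p.1.1.2 p.2.1) p.2.2 j k else 0

section Clip

variable {V : Problem d D} {T : Tuning D} {K : ℝ}

theorem measurable_clipA (j k : Fin D) (n : ℕ) : Measurable (clipA V T K j k n) := by
  have h1 : Measurable fun p : ((Vec D × Vec D) × (Fin D → Fin D → ℝ)) × (Vec d × Vec D) =>
      V.sc p.1.1.2 p.2.1 :=
    V.measurable_sc.comp (f := fun p : ((Vec D × Vec D) × (Fin D → Fin D → ℝ)) ×
      (Vec d × Vec D) => (p.1.1.2, p.2.1)) (by fun_prop)
  have h2 : Measurable fun p : ((Vec D × Vec D) × (Fin D → Fin D → ℝ)) × (Vec d × Vec D) =>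
      nextA T n p.1.2 (V.sc p.1.1.2 p.2.1) p.2.2 j k :=
    measurable_nextA (fun i j => by fun_prop) h1 (by fun_prop) j k
  exact (Measurable.ite (measurableSet_le h2.abs measurable_const) h2
    measurable_const).const_mul _

theorem abs_clipA_le (hK : 0 ≤ K) (j k : Fin D) (n : ℕ)
    (p : ((Vec D × Vec D) × (Fin D → Fin D → ℝ)) × (Vec d × Vec D)) :
    |clipA V T K j k n p| ≤ T.cα * K := by
  have h0 := T.cα_pos
  have hτ : 0 ≤ T.τ (n + 1) := by
    have := T.cα'_nonneg
    rw [Tuning.τ]; positivity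
  have h1 : T.τ (n + 1) * ((n : ℝ) + 1) ^ T.α ≤ T.cα := by
    have h2 := step_le T n
    rwa [Real.rpow_neg (by positivity), ← div_eq_mul_inv, le_div_iff₀ (by positivity)] at h2
  rw [clipA, abs_mul, abs_of_nonneg (by positivity)]
  gcongr
  split_ifs with h
  · exact h
  · simpa using hK

end Clip

/-! ### Eventually the truncation is inactive -/

/-- Conditionally on the past, an exceedance inside `U` has probability at most `C (n + 1) ^ (-κ p)`
by Markov. This is summable as `κ p > 1`, and Borel–Cantelli applies. -/
theorem IsSampling.eventually_norm_el_le {V : Problem d D} {T : Tuning D} {Ω : Type*}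
    [mΩ : MeasurableSpace Ω] {P : Measure Ω} [IsProbabilityMeasure P] {ℱ : Filtration ℕ mΩ}
    {X : ℕ → Ω → Draw d D T.B} {U : Set (Vec D)} {p C κ : ℝ} (hX : IsSampling V T P ℱ X)
    (hM : ∀ᵐ ω ∂P, ∀ s, (run V T (fun k => X k ω) s).lam ∈ V.M ∧
      (run V T (fun k => X k ω) s).avg ∈ V.M) (hU : V.IsGood p C U) (hκ : 1 < κ * p) :
    ∀ᵐ ω ∂P, ∀ i, ∀ᶠ n : ℕ in atTop, (runPair V T X n ω).1 ∈ U →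
      ‖V.el ((X n ω).1 i) (runPair V T X n ω).1‖ ≤ ((n : ℝ) + 1) ^ κ := by
  rw [ae_all_iff]
  intro i
  set Q : ℕ → Set (((Vec D × Vec D) × Unit) × (Vec d × (Vec d × Vec D))) := fun n =>
    {q | q.1.1.1 ∈ U ∧ ((n : ℝ) + 1) ^ κ < ‖V.el q.2.1 q.1.1.1‖} with hQ
  have hQm : ∀ n, MeasurableSet (Q n) := fun n => by
    have h1 : Measurable fun q : ((Vec D × Vec D) × Unit) × (Vec d × (Vec d × Vec D)) =>
        q.1.1.1 := by fun_prop
    have h2 : Measurable fun q : ((Vec D × Vec D) × Unit) × (Vec d × (Vec d × Vec D)) =>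
        V.el q.2.1 q.1.1.1 :=
      V.measurable_el.comp (f := fun q : ((Vec D × Vec D) × Unit) × (Vec d × (Vec d × Vec D)) =>
        (q.1.1.1, q.2.1)) (by fun_prop)
    exact (h1 hU.isOpen.measurableSet).inter (measurableSet_lt measurable_const h2.norm)
  have hC0 : 0 ≤ C := by linarith [hU.one_le]
  have hbound : ∀ n, P {ω | (runPair V T X n ω).1 ∈ U ∧
      ((n : ℝ) + 1) ^ κ < ‖V.el ((X n ω).1 i) (runPair V T X n ω).1‖} ≤
        ENNReal.ofReal (C * ((n : ℝ) + 1) ^ (-(κ * p))) := fun n => by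
    have hb : 0 < ((n : ℝ) + 1) ^ κ := by positivity
    have hST : Measurable fun ω => (runPair V T X n ω, ()) :=
      ((hX.measurable_runPair n).mono (ℱ.le n) le_rfl).prodMk measurable_const
    have hY : Measurable fun ω => ((X n ω).1 i, (X n ω).2) :=
      (((measurable_pi_apply i).comp measurable_fst).comp (hX.measurable' n)).prodMk
        (measurable_snd.comp (hX.measurable' n))
    have : IsProbabilityMeasure (P.map fun ω => (runPair V T X n ω, ())) :=
      Measure.isProbabilityMeasure_map hST.aemeasurable
    have h1 : P {ω | (runPair V T X n ω).1 ∈ U ∧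
        ((n : ℝ) + 1) ^ κ < ‖V.el ((X n ω).1 i) (runPair V T X n ω).1‖} =
        (P.map fun ω => ((runPair V T X n ω, ()), ((X n ω).1 i, (X n ω).2))) (Q n) := by
      rw [Measure.map_apply (hST.prodMk hY) (hQm n)]
      rfl
    rw [h1, hX.map_eq_compProd hM n i measurable_const, Measure.compProd_apply (hQm n)]
    have h2 : ∀ e : (Vec D × Vec D) × Unit, (drawK V).prodMkRight Unit e (Prod.mk e ⁻¹' Q n) ≤
        ENNReal.ofReal (C * ((n : ℝ) + 1) ^ (-(κ * p))) := fun e => by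
      rw [Kernel.prodMkRight_apply, drawK_apply]
      by_cases he : e.1.1 ∈ U
      · have h3 : Prod.mk e ⁻¹' Q n = Prod.fst ⁻¹'
            {θ | ((n : ℝ) + 1) ^ κ < ‖V.el θ e.1.1‖} := by
          ext z
          simp [hQ, he]
        have h4 : MeasurableSet {θ | ((n : ℝ) + 1) ^ κ < ‖V.el θ e.1.1‖} :=
          measurableSet_lt measurable_const (Problem.measurable_el_right e.1.1).norm
        rw [h3, measurePreserving_fst.measure_preimage h4.nullMeasurableSet,
          lawK_apply V (hU.subset he)]
        refine (hU.measure_norm_el_gt_le he hb).trans (ENNReal.ofReal_le_ofReal ?_)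
        rw [← Real.rpow_mul (by positivity), mul_neg]
      · have h3 : Prod.mk e ⁻¹' Q n = ∅ := by
          ext z
          simp [hQ, he]
        rw [h3, measure_empty]
        exact zero_le
    refine (lintegral_mono h2).trans ?_
    simp
  have hs : Summable fun n : ℕ => C * ((n : ℝ) + 1) ^ (-(κ * p)) := by
    refine Summable.mul_left _ ?_
    have := (summable_nat_add_iff (f := fun n : ℕ => (n : ℝ) ^ (-(κ * p))) 1).2
      (Real.summable_nat_rpow.2 (by linarith))
    simpa using this
  have hsum : ∑' n, P {ω | (runPair V T X n ω).1 ∈ U ∧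
      ((n : ℝ) + 1) ^ κ < ‖V.el ((X n ω).1 i) (runPair V T X n ω).1‖} ≠ ⊤ := by
    refine ne_top_of_le_ne_top ?_ (ENNReal.tsum_le_tsum hbound)
    rw [← ENNReal.ofReal_tsum_of_nonneg (fun n => by positivity) hs]
    exact ENNReal.ofReal_ne_top
  filter_upwards [ae_eventually_notMem hsum] with ω hω
  filter_upwards [hω] with n hn hl
  by_contra hlt
  exact hn ⟨hl, not_le.1 hlt⟩

/-! ### The error recursion after splitting off the noise -/

section Recursion

variable {V : Problem d D} {T : Tuning D} {Ω : Type*} {X : ℕ → Ω → Draw d D T.B}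
  {U : Set (Vec D)} {K κ : ℝ}

/-- The conditional mean of the truncated gradient sample. -/
def truncMean (V : Problem d D) (U : Set (Vec D)) (b : ℝ) (l : Vec D) : Vec D :=
  WithLp.toLp 2 fun k => ∫ θ, truncEl V U b k (l, θ) ∂lawK V l

/-- The accumulated noise: the vector of damped sums of the preconditioned truncated noise. -/
def noiseVec (V : Problem d D) (T : Tuning D) (X : ℕ → Ω → Draw d D T.B) (U : Set (Vec D))
    (K κ : ℝ) (ω : Ω) (n : ℕ) : Vec D :=
  WithLp.toLp 2 fun j => (T.B : ℝ)⁻¹ * ∑ i, ∑ k, damped T.α (fun n =>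
    runNoise V T X i (clipA V T K j k) (fun n => truncEl V U (((n : ℝ) + 1) ^ κ) k) n ω) n

/-- Once localization, truncation and clipping are inactive, the artificial noise equals the true
one. The factor `(n + 1)ᵅ` in `clipA` cancels the damping step and restores the step size `τ`. -/
theorem noiseVec_succ {ω : Ω} {n : ℕ} (hU : (runPair V T X n ω).1 ∈ U)
    (hel : ∀ i, ‖V.el ((X n ω).1 i) (runPair V T X n ω).1‖ ≤ ((n : ℝ) + 1) ^ κ)
    (hA : ∀ j k, |runA V T X n ω j k| ≤ K) :
    noiseVec V T X U K κ ω (n + 1) =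
      noiseVec V T X U K κ ω n - ((n : ℝ) + 1) ^ (-T.α) • noiseVec V T X U K κ ω n +
      T.τ (n + 1) • matL (runA V T X n ω)
        (truncMean V U (((n : ℝ) + 1) ^ κ) (runPair V T X n ω).1 -
          gradMean V (runPair V T X n ω).1 (X n ω).1) := by
  set l := (runPair V T X n ω).1 with hl
  set t : ℝ := ((n : ℝ) + 1) ^ (-T.α) with ht
  have hB : (T.B : ℝ) ≠ 0 := Nat.cast_ne_zero.2 T.B_pos.ne'
  have htt : t * ((n : ℝ) + 1) ^ T.α = 1 := by
    rw [ht, ← Real.rpow_add (by positivity), neg_add_cancel, Real.rpow_zero]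
  have hnoise : ∀ i j k, t * runNoise V T X i (clipA V T K j k)
      (fun n => truncEl V U (((n : ℝ) + 1) ^ κ) k) n ω = T.τ (n + 1) * (runA V T X n ω j k *
        (truncMean V U (((n : ℝ) + 1) ^ κ) l k - V.el ((X n ω).1 i) l k)) := fun i j k => by
    have h1 : clipA V T K j k n ((runPair V T X n ω, runH V T X n ω), (X n ω).2) =
        T.τ (n + 1) * ((n : ℝ) + 1) ^ T.α * runA V T X n ω j k := by
      rw [clipA]
      exact congrArg _ (if_pos (hA j k))
    have h2 : truncEl V U (((n : ℝ) + 1) ^ κ) k (l, (X n ω).1 i) = V.el ((X n ω).1 i) l k :=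
      if_pos ⟨hU, hel i⟩
    have h3 : runNoise V T X i (clipA V T K j k)
        (fun n => truncEl V U (((n : ℝ) + 1) ^ κ) k) n ω =
        clipA V T K j k n ((runPair V T X n ω, runH V T X n ω), (X n ω).2) *
          (truncMean V U (((n : ℝ) + 1) ^ κ) l k -
            truncEl V U (((n : ℝ) + 1) ^ κ) k (l, (X n ω).1 i)) := rfl
    rw [h3, h1, h2]
    linear_combination (T.τ (n + 1) * (runA V T X n ω j k *
        (truncMean V U (((n : ℝ) + 1) ^ κ) l k - V.el ((X n ω).1 i) l k))) * htt
  ext j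
  have hg : ∀ k, gradMean V l (X n ω).1 k = (T.B : ℝ)⁻¹ * ∑ i, V.el ((X n ω).1 i) l k := fun k => by
    simp [gradMean]
  simp only [PiLp.add_apply, PiLp.sub_apply, PiLp.smul_apply, smul_eq_mul, matL_apply, hg]
  have hmean : ∀ k, truncMean V U (((n : ℝ) + 1) ^ κ) l k -
      (T.B : ℝ)⁻¹ * ∑ i, V.el ((X n ω).1 i) l k =
      (T.B : ℝ)⁻¹ * ∑ i, (truncMean V U (((n : ℝ) + 1) ^ κ) l k - V.el ((X n ω).1 i) l k) :=
    fun k => by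
      rw [Finset.sum_sub_distrib, Finset.sum_const, Finset.card_univ, Fintype.card_fin,
        nsmul_eq_mul, mul_sub, inv_mul_cancel_left₀ hB]
  simp only [hmean, noiseVec, damped, Finset.sum_add_distrib, ← ht, hnoise]
  simp only [← Finset.mul_sum]
  have hswap : ∀ (a : Fin D → ℝ) (u : Fin T.B → Fin D → ℝ),
      ∑ k, a k * ((T.B : ℝ)⁻¹ * ∑ i, u i k) = (T.B : ℝ)⁻¹ * ∑ i, ∑ k, a k * u i k :=
    fun a u => by
      rw [Finset.sum_comm, Finset.mul_sum]
      refine Finset.sum_congr rfl fun k _ => ?_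
      rw [← Finset.mul_sum]
      ring
  rw [hswap (fun k => runA V T X n ω j k)
    (fun i k => truncMean V U (((n : ℝ) + 1) ^ κ) l k - V.el ((X n ω).1 i) l k)]
  ring

/-- The recursion for the error, after subtraction of the accumulated noise. -/
theorem runPair_sub_noiseVec_succ {ω : Ω} {n : ℕ} (lamStar : Vec D)
    (hU : (runPair V T X n ω).1 ∈ U)
    (hel : ∀ i, ‖V.el ((X n ω).1 i) (runPair V T X n ω).1‖ ≤ ((n : ℝ) + 1) ^ κ)
    (hA : ∀ j k, |runA V T X n ω j k| ≤ K) :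
    (runPair V T X (n + 1) ω).1 - lamStar - noiseVec V T X U K κ ω (n + 1) =
      (runPair V T X n ω).1 - lamStar - noiseVec V T X U K κ ω n -
      T.τ (n + 1) • matL (runA V T X n ω)
        (truncMean V U (((n : ℝ) + 1) ^ κ) (runPair V T X n ω).1) +
      ((n : ℝ) + 1) ^ (-T.α) • noiseVec V T X U K κ ω n := by
  have h1 : (runPair V T X (n + 1) ω).1 = (runPair V T X n ω).1 -
      T.τ (n + 1) • matL (runA V T X n ω) (gradMean V (runPair V T X n ω).1 (X n ω).1) := rfl
  rw [h1, noiseVec_succ hU hel hA, map_sub, smul_sub]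
  abel

end Recursion

/-! ### Size of the error terms -/

theorem isBigO_rpow_of_le {α r : ℝ} (hα : 0 < α) (hr : r ≤ -(α / 2)) :
    (fun n : ℕ => ((n : ℝ) + 1) ^ r) =O[atTop] fun n : ℕ => √(Real.log n / (n : ℝ) ^ α) := by
  refine IsBigO.of_bound 1 ?_
  have hlog : ∀ᶠ n : ℕ in atTop, 1 ≤ Real.log n :=
    (Real.tendsto_log_atTop.comp tendsto_natCast_atTop_atTop).eventually_ge_atTop 1
  filter_upwards [hlog, eventually_gt_atTop 0] with n hn hn0
  have hn1 : (0 : ℝ) < n := Nat.cast_pos.2 hn0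
  rw [one_mul, Real.norm_eq_abs, Real.norm_eq_abs, abs_of_nonneg (by positivity),
    abs_of_nonneg (Real.sqrt_nonneg _)]
  refine Real.le_sqrt_of_sq_le ?_
  calc (((n : ℝ) + 1) ^ r) ^ 2 = ((n : ℝ) + 1) ^ (r * 2) := by
        rw [← Real.rpow_natCast, ← Real.rpow_mul (by positivity)]; norm_num
    _ ≤ ((n : ℝ) + 1) ^ (-α) := Real.rpow_le_rpow_of_exponent_le (by linarith) (by linarith)
    _ ≤ (n : ℝ) ^ (-α) := Real.rpow_le_rpow_of_nonpos hn1 (by linarith) (by linarith)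
    _ = 1 / (n : ℝ) ^ α := by rw [Real.rpow_neg hn1.le, one_div]
    _ ≤ Real.log n / (n : ℝ) ^ α := by gcongr

theorem sq_isBigO_of_sqrt {E : Type*} [NormedAddCommGroup E] {x : ℕ → E} {α : ℝ}
    (h : x =O[atTop] fun n : ℕ => √(Real.log n / (n : ℝ) ^ α)) :
    (fun n => ‖x n‖ ^ 2) =O[atTop] fun n : ℕ => Real.log n / (n : ℝ) ^ α := by
  refine (h.norm_left.pow 2).congr_right fun n => Real.sq_sqrt ?_
  exact div_nonneg (Real.log_natCast_nonneg n) (by positivity)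

/-- With `p = 2 + 2η`, the assumption on `η` says `1 / p < α / 2`, and `κ` is the midpoint. The bias
condition then follows: `κ - κ p < α / 2 - 1 < -α / 2` because `α < 1`. -/
theorem exists_truncation_exponent {α η : ℝ} (hα : 1 / 2 < α) (hα1 : α < 1) (hη : 1 / α - 1 < η) :
    ∃ κ, 0 ≤ κ ∧ κ < α / 2 ∧ 1 < κ * (2 + 2 * η) ∧ κ * (1 - (2 + 2 * η)) ≤ -(α / 2) := by
  have hα0 : 0 < α := by linarith
  have h1 : 1 < α * (1 + η) := by
    have := mul_lt_mul_of_pos_left hη hα0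
    rw [mul_sub, mul_one_div_cancel hα0.ne'] at this
    linarith
  have hη0 : 0 < 1 + η := by
    by_contra h
    nlinarith
  set p := 2 + 2 * η with hp
  have hp0 : 0 < p := by linarith
  have h2 : 1 / p < α / 2 := by
    rw [div_lt_iff₀ hp0, hp]; linarith
  have h3 : (1 / p + α / 2) / 2 * p = (1 + α / 2 * p) / 2 := by field_simp
  have h4 : 1 < (1 / p + α / 2) / 2 * p := by rw [h3, hp]; linarith
  have h5 : (1 / p + α / 2) / 2 < α / 2 := by linarith
  exact ⟨(1 / p + α / 2) / 2, by positivity, h5, h4, by linarith⟩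

theorem IsSampling.noiseVec_isBigO {V : Problem d D} {T : Tuning D} {Ω : Type*}
    [mΩ : MeasurableSpace Ω] {P : Measure Ω} [IsProbabilityMeasure P] {ℱ : Filtration ℕ mΩ}
    {X : ℕ → Ω → Draw d D T.B} {U : Set (Vec D)} {p C K κ : ℝ} (hX : IsSampling V T P ℱ X)
    (hM : ∀ᵐ ω ∂P, ∀ s, (run V T (fun k => X k ω) s).lam ∈ V.M ∧
      (run V T (fun k => X k ω) s).avg ∈ V.M) (hU : V.IsGood p C U) (hK : 0 < K) (hκ0 : 0 ≤ κ)
    (hκ : κ < T.α / 2) :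
    ∀ᵐ ω ∂P, noiseVec V T X U K κ ω =O[atTop] fun n : ℕ => √(Real.log n / (n : ℝ) ^ T.α) := by
  have hC : 0 ≤ C := by linarith [hU.one_le]
  have h := ae_all_iff.2 fun j => ae_all_iff.2 fun i => ae_all_iff.2 fun k =>
    hX.noise_isBigO hM i (a := clipA V T K j k)
      (f := fun n => truncEl V U (((n : ℝ) + 1) ^ κ) k) (mul_pos T.cα_pos hK) hκ0 hκ
      (add_nonneg zero_le_one hC) (fun n => measurable_clipA j k n)
      (fun n => measurable_truncEl hU.isOpen.measurableSet k)
      (fun n q => abs_clipA_le hK.le j k n q)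
      (fun n q => abs_truncEl_le (by positivity) k q)
      (fun n l => integral_sq_truncEl_le hU k l)
  filter_upwards [h] with ω hω
  refine isBigO_of_apply fun j => ?_
  exact (IsBigO.fun_sum fun i _ => IsBigO.fun_sum fun k _ => hω j i k).const_mul_left _

/-- The order of quantifiers matters: the clipping level depends only on the limit, so it is
deterministic and can be fixed before the random sequence is known. -/
theorem exists_eventually_abs_le (A₀ : Matrix (Fin D) (Fin D) ℝ) :
    ∃ K : ℝ, 0 < K ∧ ∀ A : ℕ → Matrix (Fin D) (Fin D) ℝ, Tendsto A atTop (𝓝 A₀) →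
      ∀ᶠ n in atTop, ∀ j k, |A n j k| ≤ K := by
  refine ⟨1 + ∑ j, ∑ k, |A₀ j k|, by positivity, fun A hA => ?_⟩
  rw [eventually_all]; intro j
  rw [eventually_all]; intro k
  have h1 := (tendsto_pi_nhds.1 (tendsto_pi_nhds.1 hA j) k).abs
  refine (h1.eventually_lt_const (lt_of_le_of_lt ?_ (lt_one_add _))).mono fun n h => h.le
  calc |A₀ j k| ≤ ∑ k, |A₀ j k| :=
        Finset.single_le_sum (f := fun k => |A₀ j k|) (fun _ _ => abs_nonneg _) (Finset.mem_univ k)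
    _ ≤ ∑ j, ∑ k, |A₀ j k| :=
        Finset.single_le_sum (f := fun j => ∑ k, |A₀ j k|)
          (fun _ _ => Finset.sum_nonneg fun _ _ => abs_nonneg _) (Finset.mem_univ j)

end VB

end

/-! ### The almost sure rate -/

theorem mainTheorem3 {d D : ℕ} (V : VB.Problem d D) (T : VB.Tuning D)
    {Ω : Type*} [mΩ : MeasurableSpace Ω] (P : Measure Ω) [IsProbabilityMeasure P]
    (ℱ : Filtration ℕ mΩ) (X : ℕ → Ω → VB.Draw d D T.B)
    (hX : VB.IsSampling V T P ℱ X)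
    -- the algorithm stays in the parameter space
    (hM : ∀ᵐ ω ∂P, ∀ s, (VB.run V T (fun k => X k ω) s).lam ∈ V.M ∧
      (VB.run V T (fun k => X k ω) s).avg ∈ V.M)
    (lamStar : VB.Vec D) (hlamStar : lamStar ∈ V.M)
    (hconv : ∀ᵐ ω ∂P,
      Tendsto (fun s => (VB.run V T (fun k => X k ω) s).lam) atTop (𝓝 lamStar))
    (hdiff : DifferentiableOn ℝ V.loss V.M)
    (hcrit : gradient V.loss lamStar = 0)
    (hC2 : ContDiffAt ℝ 2 V.loss lamStar)
    (hell : ∃ η : ℝ, 1 / T.α - 1 < η ∧ ∃ C₀ C₁ : ℝ, 0 ≤ C₀ ∧ 0 ≤ C₁ ∧ ∀ lam ∈ V.M,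
      ∫⁻ θ, ‖V.ell θ lam‖ₑ ^ (2 + 2 * η) ∂(V.law lam) ≤
        ENNReal.ofReal (C₀ + C₁ * |V.loss lam - V.loss lamStar| ^ (1 + η)))
    (hscore : ∃ C₀ C₁ : ℝ, 0 ≤ C₀ ∧ 0 ≤ C₁ ∧ ∀ lam ∈ V.M,
      ∫⁻ θ, ‖V.score lam θ‖ₑ ^ 4 ∂(V.law lam) ≤
        ENNReal.ofReal (C₀ + C₁ * (V.loss lam - V.loss lamStar) ^ 2))
    (hHess : (VB.hessian V.loss lamStar).PosDef)
    (hFisher : (V.fisher lamStar).PosDef) :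
    ∀ᵐ ω ∂P, (fun s : ℕ => ‖(VB.run V T (fun k => X k ω) s).lam - lamStar‖ ^ 2) =O[atTop]
      fun s : ℕ => Real.log s / (s : ℝ) ^ T.α := by
  open VB in
  obtain ⟨η, hη, hell⟩ := hell
  have hα0 : 0 < T.α := by linarith [T.α_gt]
  have hη0 : 0 < η := by
    have := one_lt_one_div hα0 T.α_lt
    linarith
  obtain ⟨κ, hκ0, hκ, hκp, hκb⟩ := exists_truncation_exponent T.α_gt T.α_lt hη
  have hda : ∀ l ∈ V.M, DifferentiableAt ℝ V.loss l := fun l hl =>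
    hdiff.differentiableAt (V.isOpen_M.mem_nhds hl)
  obtain ⟨C, U, hlU, hU⟩ := Problem.exists_isGood hlamStar (hda _ hlamStar).continuousAt hη0
    hell hscore
  obtain ⟨K, hK, hKA⟩ := exists_eventually_abs_le (V.fisher lamStar)⁻¹
  have hrun := hX.ae_runM_eq hM
  have hconvM : ∀ᵐ ω ∂P, Tendsto (fun s => (runM V T (fun k => X k ω) s).lam) atTop
      (𝓝 lamStar) := by
    filter_upwards [hrun, hconv] with ω h1 h2
    simpa only [h1] using h2
  -- From here on the sample path is fixed and the argument is deterministic.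
  filter_upwards [hrun, hconvM, hX.tendsto_runH hM hU hlU hconvM,
    hX.noiseVec_isBigO hM hU hK hκ0 hκ, hX.eventually_norm_el_le hM hU hκp]
    with ω hrun hlim hH hnoise hel
  have hA := tendsto_runA hFisher.det_pos.ne' hH
  set lam : ℕ → Vec D := fun n => (runPair V T X n ω).1 with hlam
  replace hlim : Tendsto lam atTop (𝓝 lamStar) := hlim
  have hevU : ∀ᶠ n in atTop, lam n ∈ U := hlim.eventually (hU.isOpen.mem_nhds hlU)
  set Hs := hessian V.loss lamStar
  set g : ℕ → Vec D := fun n =>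
    WithLp.toLp 2 fun k => fderiv ℝ V.loss (lam n) (EuclideanSpace.single k 1) with hg
  set e : ℕ → Vec D := fun n => truncMean V U (((n : ℝ) + 1) ^ κ) (lam n) with he
  -- `g` is the exact gradient along the path and `e` the mean of the truncated samples: `g` differs
  -- from the Hessian term by the Taylor remainder, and `e` from `g` by the truncation bias.
  have hb₁ : (fun n => g n - matL Hs (lam n - lamStar)) =o[atTop] fun n => lam n - lamStar :=
    isLittleO_of_apply fun k => (fderiv_expansion hcrit hC2 hHess.1 k).comp_tendsto hlim
  have hb₂ : (fun n => e n - g n) =O[atTop] fun n : ℕ => √(Real.log n / (n : ℝ) ^ T.α) := by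
    refine isBigO_of_apply fun k => IsBigO.trans (IsBigO.of_bound C ?_)
      (isBigO_rpow_of_le hα0 hκb)
    filter_upwards [hevU] with n hn
    have h1 := abs_integral_truncEl_sub_le hU hn (hda _ (hU.subset hn))
      (show 0 < ((n : ℝ) + 1) ^ κ by positivity) k
    rw [← Real.rpow_mul (by positivity)] at h1
    rw [Real.norm_eq_abs, Real.norm_eq_abs, abs_of_nonneg (by positivity :
      0 ≤ ((n : ℝ) + 1) ^ (κ * (1 - (2 + 2 * η))))]
    exact h1
  have hrate : (fun n => lam n - lamStar) =O[atTop]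
      fun n : ℕ => √(Real.log n / (n : ℝ) ^ T.α) := by
    have := T.cα_pos
    have := T.cα'_nonneg
    refine rate_of_recursion (τ := fun n => T.τ (n + 1)) hα0 T.α_lt
      (by positivity : 0 < T.cα / (T.cα' + 1) ^ T.α) (step_ge T) (step_le T) hFisher hHess hA
      hnoise hb₁ hb₂ ?_
    filter_upwards [hevU, hKA _ hA, eventually_all.2 hel] with n h1 h2 h3
    have h4 := runPair_sub_noiseVec_succ lamStar h1 (fun i => h3 i h1) h2
    -- Hessian term, Taylor remainder and bias add up to the truncated mean `e n`.
    rw [add_sub_cancel, add_sub_cancel]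
    exact h4
  refine (sq_isBigO_of_sqrt hrate).congr_left fun n => ?_
  rw [← hrun n]
  rfl
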